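/- **Model.** Consider $n$ parties in a fully connected asynchronous network with reliable authenticated channels, of which an adaptive adversary corrupts at most $t$, where $3t<n$. Corrupted parties behave arbitrarily; parties that are never corrupted are honest. The adversary schedules all messages, and must only deliver each message between honest parties eventually. Local computation is instantaneous. To multicast is to send to every party (oneself included). Honest parties keep running forever after they output. An instance of a protocol keeps the messages that reach it before it is started. A repeated output command is ignored. "Upon" rules may fire at any time while the instance runs. A protocol *takes at most $R$ rounds* if (i) it is live: whenever all honest parties eventually acquire their inputs, all honest parties output; and (ii) whenever no message between honest parties is delayed by more than $\Delta$, all honest parties output within time $R\Delta$ after the time by which all of them have acquired their inputs. *Edge agreement* in the infinite path $\mathbb N$ (consecutive integers are adjacent) means: every two honest outputs are equal or adjacent, and every honest output lies on the path between two (possibly equal) honest inputs. **Binary 2-graded consensus $\mathsf{GC}_2$** (two possible inputs, outputs $(k,g)$ with $k$ one of these two values and $g\in\{1,2\}$, or $(\bot,0)$). On its input $v$ a party runs $\mathsf{GC}_1$ with the input $v$ and joins $\mathsf{Prop}$; the $\mathsf{GC}_1$ output is its $\mathsf{Prop}$ input. - $\mathsf{GC}_1$ starts with $V=W=\varnothing$.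 Multicast $\langle \mathtt{ECHO},v\rangle$. Upon echoes on $\bot$ or on values other than $v$ from $t+1$ parties, multicast $\langle\mathtt{ECHO},\bot\rangle$ and output $(\bot,0)$. Upon echoes on $\bot$ or $b$ from $t+1$ parties, add $b$ to $V$, and output $(\bot,0)$ if $V$ now holds both values. Upon echoes on $\bot$ or $b$ from $2t+1$ parties, add $b$ to $W$, and multicast $\langle\mathtt{PROP},b\rangle$ if now $W=\{b\}$. Upon proposals on $b$ from $n-t$ parties, output $(b,1)$ if $b=v$ and $(\bot,0)$ otherwise. - $\mathsf{Prop}$ starts with $V=\varnothing$. On the input $x$, multicast $\langle\mathtt{ECHO},x\rangle$ (each echo is sent only once). Upon echoes on $x$ from $t+1$ parties, multicast $\langle\mathtt{ECHO},x\rangle$, add $x$ to $V$, and output $V$ if now $|V|=2$. For the first $x$ with echoes from $2t+1$ parties, multicast $\langle\mathtt{PROP},x\rangle$. Upon proposals on $x$ from $n-t$ parties, output $\{x\}$. - The $\mathsf{GC}_2$ output is $(y,2i)$ if the $\mathsf{Prop}$ output is $\{(y,i)\}$, and $(y',2i+1)$ if it is $\{(y,i),(y',i+1)\}$. **$\mathsf{TC}_j$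 on paths.** The input is $(v,T,a,b)$, where $v$ is a vertex, $T$ is a path of length $2^j$ or $\bot$, and each of $a,b$ is an end of the path or $\bot$. $\mathsf{TC}_0$ outputs $v$. For $j\ge1$, $\mathsf{TC}_j$ joins an instance of $\mathsf{GC}_2$ with inputs in $\{1,2\}$ and an instance of $\mathsf{TC}_{j-1}$: - If $T=\bot$ and $a\ne\bot$: input $1$ to $\mathsf{GC}_2$ and $(v,\bot,\bot,a)$ to $\mathsf{TC}_{j-1}$, and output $a$. - If $T=\bot$ and $a=\bot$: input $2$ to $\mathsf{GC}_2$ and $(v,\bot,\bot,b)$ to $\mathsf{TC}_{j-1}$, and output $b$. - If $T\neq\bot$: let $\sigma$ be the midpoint of $T$, $H_1$ the half of $T$ (including $\sigma$) that contains $a$, and $H_2$ the other half (including $\sigma$). Input to $\mathsf{GC}_2$ the least $k$ with $v\in H_k$. Upon its output $(\bot,0)$, input $(\sigma,\bot,\sigma,\bot)$ to $\mathsf{TC}_{j-1}$ and output $\sigma$. Upon an output $(k,g)$ with $g\ge1$, input $(v',H_k,\sigma,b')$ to $\mathsf{TC}_{j-1}$, where $v'=v$ if $g=2$ and $v\in H_k$,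 $v'=\sigma$ otherwise, and $b'=a$ if $k=1$, $b'=b$ if $k=2$. - Upon an output $y$ from $\mathsf{TC}_{j-1}$, output $y$. **$\mathsf{Exp}_j$ with the input $v\in\mathbb N$.** Let $c=2^{j+1}-1$. Input $\mathtt{LEFT}$ to an instance of $\mathsf{GC}_2$ if $v<2^{j+1}$, and $\mathtt{RIGHT}$ otherwise; wait for its output $(k,g)$. - If $(k,g)=(\mathtt{LEFT},2)$: let $v^{\mathsf{next}}=\min(v,c)$ and $\mathsf{side}=\mathtt{LEFT}$. If $(k,g)=(\mathtt{RIGHT},2)$: let $v^{\mathsf{next}}=\max(v,c)$ and $\mathsf{side}=\mathtt{RIGHT}$. - If $g=1$: let $v^{\mathsf{next}}=c$ and $\mathsf{side}=k$, and multicast $k$. - If $(k,g)=(\bot,0)$: let $v^{\mathsf{next}}=c$, output $c$, multicast $\mathtt{CENTER}$, wait until some $k'\in\{\mathtt{LEFT},\mathtt{RIGHT}\}$ has been received from $t+1$ parties, and let $\mathsf{side}=k'$. When $\mathsf{side}$ is set: if $\mathsf{side}=\mathtt{LEFT}$, run $\mathsf{TC}_j$ with the input $(v^{\mathsf{next}},T,a,\bot)$,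 where $T$ is the path $(2^j-1,\dots,2^{j+1}-1)$ and $a$ is an end of $T$ (a fixed choice for each $j$, common to all parties); if $\mathsf{side}=\mathtt{RIGHT}$, run $\mathsf{Exp}_{j+1}$ with the input $v^{\mathsf{next}}$. When this subprotocol outputs $y$, output $y$ if $g\ge1$. At any time (even while waiting), upon receiving $\mathtt{CENTER}$ from $t+1$ parties, output $c$. **Theorem.** Let $q\ge1$ and $0\le j<q$ be integers, and suppose that the honest parties run $\mathsf{Exp}_j$ with inputs in $\{2^j-1,\dots,2^q-1\}$. Then they reach edge agreement in $\mathbb N$ with respect to their inputs, in at most $6q$ rounds if $q=j+1$, and in at most $7+12q-6j$ rounds otherwise. -/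

import Mathlib

/-!
Edge agreement in the infinite path on the natural numbers, by exponential search with binary
2-graded consensus, in an asynchronous network of `n` parties of which at most `t` are byzantine.

Every party is a state machine. Its state holds one sub-state for each subprotocol instance it can
ever take part in; a sub-state whose `inp` is `none` is dormant (the party has not yet begun to
run that instance), and messages that arrive for a dormant instance are kept in its `recv` field.
-/

/-- The number of parties from which a message with the property `P` has been received. -/
noncomputable def heard {n : ℕ} {M : Type} (recv : Fin n → Set M) (P : M → Prop) : ℕ :=
  Set.ncard {p : Fin n | ∃ m ∈ recv p, P m}

/-! ### Binary 2-graded consensus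

The protocol is binary 1-graded consensus followed by the proposal protocol. The outputs `(⊥, 0)`
and `(b, 1)` of 1-graded consensus are written `none` and `some b`. -/

/-- Messages of one instance of 2-graded consensus. -/
inductive GCMsg : Type
  /-- an echo inside 1-graded consensus, on `⊥` (`none`) or on the bit `b` (`some b`) -/
  | echo₁ (x : Option Bool)
  /-- a proposal inside 1-graded consensus, on a bit -/
  | prop₁ (b : Bool)
  /-- an echo inside the proposal protocol, on an output of 1-graded consensus -/
  | echo₂ (x : Option Bool)
  /-- a proposal inside the proposal protocol, on an output of 1-graded consensus -/
  | prop₂ (x : Option Bool)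

/-- The local state of a party in one instance of 2-graded consensus. -/
structure GCState (n : ℕ) : Type where
  /-- the input bit, once acquired -/
  inp : Option Bool
  /-- the messages received so far from each party -/
  recv : Fin n → Set GCMsg
  /-- the messages multicast so far -/
  sent : Set GCMsg
  /-- the set `V` of 1-graded consensus -/
  V₁ : Finset Bool
  /-- the set `W` of 1-graded consensus -/
  W₁ : Finset Bool
  /-- the output of 1-graded consensus -/
  out₁ : Option (Option Bool)
  /-- the set `V` of the proposal protocol -/
  V₂ : Finset (Option Bool)
  /-- the output set of the proposal protocol -/
  out₂ : Option (Finset (Option Bool))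

/-- A dormant instance without any received message. -/
def GCState.initial (n : ℕ) : GCState n where
  inp := none
  recv := fun _ => ∅
  sent := ∅
  V₁ := ∅
  W₁ := ∅
  out₁ := none
  V₂ := ∅
  out₂ := none

/-- The 2-graded consensus output `(k, g)` belonging to an output set of the proposal protocol:
`{(y, i)}` gives `(y, 2i)`, and `{(y, i), (y', i + 1)}` gives `(y', 2i + 1)`. -/
def gradeDouble (Y : Finset (Option Bool)) : Option (Option Bool × ℕ) :=
  if Y = {none} then some (none, 0)
  else if Y = {some false} then some (some false, 2)
  else if Y = {some true} then some (some true, 2)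
  else if Y = {none, some false} then some (some false, 1)
  else if Y = {none, some true} then some (some true, 1)
  else none

/-- The output `(k, g)` of an instance of 2-graded consensus, if there is one already. -/
def GCState.out {n : ℕ} (s : GCState n) : Option (Option Bool × ℕ) :=
  s.out₂.bind gradeDouble

/-- The local steps of 2-graded consensus. `o.or (some y)` is the register `o` after the command
"output `y` if you have not output before". -/
inductive GCStep {n : ℕ} (t : ℕ) : GCState n → GCState n → Prop
  /-- 1-graded consensus: multicast an echo on the input. -/
  | echoInput (s : GCState n) (v : Bool) :
      s.inp = some v → GCMsg.echo₁ (some v) ∉ s.sent →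
      GCStep t s { s with sent := insert (GCMsg.echo₁ (some v)) s.sent }
  /-- 1-graded consensus: upon echoes on `⊥` or on other values than the input from `t + 1`
  parties, multicast an echo on `⊥` and output `(⊥, 0)`. -/
  | echoBot (s : GCState n) (v : Bool) :
      s.inp = some v → GCMsg.echo₁ none ∉ s.sent →
      t + 1 ≤ heard s.recv (fun m => ∃ x, m = GCMsg.echo₁ x ∧ x ≠ some v) →
      GCStep t s { s with
        sent := insert (GCMsg.echo₁ none) s.sent
        out₁ := s.out₁.or (some none) }
  /-- 1-graded consensus: upon echoes on `⊥` or `b` from `t + 1` parties, add `b` to `V`; output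
  `(⊥, 0)` if this makes `V = {0, 1}`. -/
  | addV₁ (s : GCState n) (v b : Bool) :
      s.inp = some v → b ∉ s.V₁ →
      t + 1 ≤ heard s.recv (fun m => m = GCMsg.echo₁ none ∨ m = GCMsg.echo₁ (some b)) →
      GCStep t s { s with
        V₁ := insert b s.V₁
        out₁ := if insert b s.V₁ = Finset.univ then s.out₁.or (some none) else s.out₁ }
  /-- 1-graded consensus: upon echoes on `⊥` or `b` from `2t + 1` parties, add `b` to `W`;
  multicast a proposal on `b` if this makes `W = {b}`. -/
  | addW₁ (s : GCState n) (v b : Bool) :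
      s.inp = some v → b ∉ s.W₁ →
      2 * t + 1 ≤ heard s.recv (fun m => m = GCMsg.echo₁ none ∨ m = GCMsg.echo₁ (some b)) →
      GCStep t s { s with
        W₁ := insert b s.W₁
        sent := if insert b s.W₁ = {b} then insert (GCMsg.prop₁ b) s.sent else s.sent }
  /-- 1-graded consensus: upon proposals on `b` from `n - t` parties, output `(b, 1)` if `b` is the
  input, and `(⊥, 0)` otherwise. -/
  | decide₁ (s : GCState n) (v b : Bool) :
      s.inp = some v → s.out₁ = none →
      n - t ≤ heard s.recv (fun m => m = GCMsg.prop₁ b) →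
      GCStep t s { s with out₁ := some (if b = v then some b else none) }
  /-- Proposal protocol: its input is the output of 1-graded consensus; multicast an echo on it if
  this has not been done before. -/
  | echoOut₁ (s : GCState n) (x : Option Bool) :
      s.out₁ = some x → GCMsg.echo₂ x ∉ s.sent →
      GCStep t s { s with sent := insert (GCMsg.echo₂ x) s.sent }
  /-- Proposal protocol: upon echoes on `x` from `t + 1` parties, multicast an echo on `x` if this
  has not been done before, and add `x` to `V`; output `V` if this makes `|V| = 2`. -/
  | addV₂ (s : GCState n) (v : Bool) (x : Option Bool) :
      s.inp = some v → x ∉ s.V₂ →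
      t + 1 ≤ heard s.recv (fun m => m = GCMsg.echo₂ x) →
      GCStep t s { s with
        sent := insert (GCMsg.echo₂ x) s.sent
        V₂ := insert x s.V₂
        out₂ := if (insert x s.V₂).card = 2 then s.out₂.or (some (insert x s.V₂)) else s.out₂ }
  /-- Proposal protocol: for the first `x` with echoes on `x` from `2t + 1` parties, multicast a
  proposal on `x`. -/
  | propose₂ (s : GCState n) (v : Bool) (x : Option Bool) :
      s.inp = some v → (∀ y, GCMsg.prop₂ y ∉ s.sent) →
      2 * t + 1 ≤ heard s.recv (fun m => m = GCMsg.echo₂ x) →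
      GCStep t s { s with sent := insert (GCMsg.prop₂ x) s.sent }
  /-- Proposal protocol: upon proposals on `x` from `n - t` parties, output `{x}`. -/
  | decide₂ (s : GCState n) (v : Bool) (x : Option Bool) :
      s.inp = some v → s.out₂ = none →
      n - t ≤ heard s.recv (fun m => m = GCMsg.prop₂ x) →
      GCStep t s { s with out₂ := some {x} }

/-! ### States of the edge agreement protocols -/

/-- An input `(v, T, a, b)` of the edge agreement protocol `TC` for finite trees, here for trees
that are paths: `T = some (lo, hi)` is the path `lo, lo + 1, …, hi`, and `none` is `⊥`. -/
structure TCInput : Type where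
  v : ℕ
  T : Option (ℕ × ℕ)
  a : Option ℕ
  b : Option ℕ

/-- The local state of a party in one instance of `TC`, apart from the instances below it. -/
structure TCState : Type where
  inp : Option TCInput
  out : Option ℕ

/-- The messages that `Exp` sends itself: `side false` is `LEFT` and `side true` is `RIGHT`. -/
inductive ExpMsg : Type
  | side (k : Bool)
  | center

/-- The local state of a party in one instance of `Exp`, apart from the instances below it. -/
structure ExpState (n : ℕ) : Type where
  /-- the input -/
  inp : Option ℕ
  /-- the messages received so far from each party -/
  recv : Fin n → Set ExpMsg
  /-- the messages multicast so far -/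
  sent : Set ExpMsg
  /-- the value `v_next`, once it is set -/
  next : Option ℕ
  /-- the variable `side`, once it is set: `false` is `LEFT` and `true` is `RIGHT` -/
  side : Option Bool
  /-- the output -/
  out : Option ℕ

/-- A dormant instance without any received message. -/
def ExpState.initial (n : ℕ) : ExpState n where
  inp := none
  recv := fun _ => ∅
  sent := ∅
  next := none
  side := none
  out := none

/-- Names of the instances of 2-graded consensus: the one that `Exp m` runs directly, and the one
that `TC l` runs directly when `TC l` appears inside the instance of `TC m` run by `Exp m`. -/
inductive GCId : Type
  | exp (m : ℕ)
  | tc (m l : ℕ)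
  deriving DecidableEq

/-- Messages, tagged with the instance to which they belong. -/
inductive Msg : Type
  | gc (id : GCId) (c : GCMsg)
  | exp (m : ℕ) (c : ExpMsg)

/-- The local state of a party: `exp m` is for the protocol `Exp m`, and `tc m l` is for the
protocol `TC l` inside the instance of `TC m` that `Exp m` runs. -/
structure PState (n : ℕ) : Type where
  gc : GCId → GCState n
  tc : ℕ → ℕ → TCState
  exp : ℕ → ExpState n

namespace PState

variable {n : ℕ}

/-- The state of a party before it acquires its input or receives a message. -/
def initial (n : ℕ) : PState n where
  gc := fun _ => GCState.initial n
  tc := fun _ _ => ⟨none, none⟩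
  exp := fun _ => ExpState.initial n

/-- The party has multicast the message (that is, has sent it to every party, itself included). -/
def Sent (s : PState n) : Msg → Prop
  | .gc id c => c ∈ (s.gc id).sent
  | .exp m c => c ∈ (s.exp m).sent

def setGC (s : PState n) (id : GCId) (g : GCState n) : PState n :=
  { s with gc := Function.update s.gc id g }

def setTC (s : PState n) (m l : ℕ) (c : TCState) : PState n :=
  { s with tc := Function.update s.tc m (Function.update (s.tc m) l c) }

def setExp (s : PState n) (m : ℕ) (e : ExpState n) : PState n :=
  { s with exp := Function.update s.exp m e }

/-- Receive a message from party `p`. -/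
def receive (s : PState n) (p : Fin n) : Msg → PState n
  | .gc id c => s.setGC id
      { s.gc id with recv := Function.update (s.gc id).recv p (insert c ((s.gc id).recv p)) }
  | .exp m c => s.setExp m
      { s.exp m with recv := Function.update (s.exp m).recv p (insert c ((s.exp m).recv p)) }

/-- Give an instance of 2-graded consensus its input. -/
def inputGC (s : PState n) (id : GCId) (b : Bool) : PState n :=
  s.setGC id { s.gc id with inp := some b }

/-- Give an instance of `TC` its input. -/
def inputTC (s : PState n) (m l : ℕ) (x : TCInput) : PState n :=
  s.setTC m l { s.tc m l with inp := some x }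

/-- Give an instance of `Exp` its input. -/
def inputExp (s : PState n) (m : ℕ) (v : ℕ) : PState n :=
  s.setExp m { s.exp m with inp := some v }

/-- Output from an instance of `TC`, unless there was an output before. -/
def outputTC (s : PState n) (m l : ℕ) (y : Option ℕ) : PState n :=
  s.setTC m l { s.tc m l with out := (s.tc m l).out.or y }

/-- Output from an instance of `Exp`, unless there was an output before. -/
def outputExp (s : PState n) (m : ℕ) (y : ℕ) : PState n :=
  s.setExp m { s.exp m with out := (s.exp m).out.or (some y) }

end PState

/-! ### The protocol `TC` on paths -/

/-- The center of the path `lo, …, hi`. -/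
def pathCenter (lo hi : ℕ) : ℕ := (lo + hi) / 2

/-- The two central subtrees `H₁` (index `false`) and `H₂` (index `true`) of the path `lo, …, hi`:
the two halves of the path, of which `H₁` is the one that contains the leaf `a`. -/
def centralSubtree (lo hi a : ℕ) (k : Bool) : ℕ × ℕ :=
  if (a ≤ pathCenter lo hi) ↔ k = false then (lo, pathCenter lo hi) else (pathCenter lo hi, hi)

/-- `v` is a vertex of the path `H.1, …, H.2`. -/
def OnPath (v : ℕ) (H : ℕ × ℕ) : Prop := H.1 ≤ v ∧ v ≤ H.2

instance (v : ℕ) (H : ℕ × ℕ) : Decidable (OnPath v H) :=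
  inferInstanceAs (Decidable (H.1 ≤ v ∧ v ≤ H.2))

/-- The local steps of `TC l` inside the instance of `TC m` run by `Exp m`, apart from the steps of
2-graded consensus. The inputs `1` and `2` of 2-graded consensus are written `false`, `true`. -/
inductive TCStep {n : ℕ} (m : ℕ) : PState n → PState n → Prop
  /-- `TC 0`: output the input vertex. -/
  | base (s : PState n) (x : TCInput) :
      (s.tc m 0).inp = some x → (s.tc m 0).out = none →
      TCStep m s (s.outputTC m 0 (some x.v))
  /-- Upon acquiring an input with `T = ⊥` and `a ≠ ⊥`. -/
  | inputA (s : PState n) (l v a : ℕ) (b : Option ℕ) :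
      (s.tc m (l + 1)).inp = some ⟨v, none, some a, b⟩ →
      (s.gc (.tc m (l + 1))).inp = none →
      TCStep m s (((s.inputGC (.tc m (l + 1)) false).inputTC m l
        ⟨v, none, none, some a⟩).outputTC m (l + 1) (some a))
  /-- Upon acquiring an input with `T = ⊥` and `a = ⊥`. -/
  | inputB (s : PState n) (l v : ℕ) (b : Option ℕ) :
      (s.tc m (l + 1)).inp = some ⟨v, none, none, b⟩ →
      (s.gc (.tc m (l + 1))).inp = none →
      TCStep m s (((s.inputGC (.tc m (l + 1)) true).inputTC m l
        ⟨v, none, none, b⟩).outputTC m (l + 1) b)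
  /-- Upon acquiring an input with `T ≠ ⊥`: input to 2-graded consensus the least index of a
  central subtree that contains the input vertex. -/
  | inputT (s : PState n) (l v lo hi a : ℕ) (b : Option ℕ) :
      (s.tc m (l + 1)).inp = some ⟨v, some (lo, hi), some a, b⟩ →
      (s.gc (.tc m (l + 1))).inp = none →
      TCStep m s (s.inputGC (.tc m (l + 1))
        (if OnPath v (centralSubtree lo hi a false) then false else true))
  /-- Upon the output `(⊥, 0)` from 2-graded consensus, if `T ≠ ⊥`. -/
  | grade0 (s : PState n) (l v lo hi a : ℕ) (b : Option ℕ) :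
      (s.tc m (l + 1)).inp = some ⟨v, some (lo, hi), some a, b⟩ →
      (s.gc (.tc m (l + 1))).out = some (none, 0) →
      (s.tc m l).inp = none →
      TCStep m s ((s.inputTC m l
        ⟨pathCenter lo hi, none, some (pathCenter lo hi), none⟩).outputTC m (l + 1)
          (some (pathCenter lo hi)))
  /-- Upon an output `(k, g)` with `g ≥ 1` from 2-graded consensus, if `T ≠ ⊥`. -/
  | gradePos (s : PState n) (l v lo hi a g : ℕ) (b : Option ℕ) (k : Bool) :
      (s.tc m (l + 1)).inp = some ⟨v, some (lo, hi), some a, b⟩ →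
      (s.gc (.tc m (l + 1))).out = some (some k, g) →
      (s.tc m l).inp = none →
      TCStep m s (s.inputTC m l
        ⟨if g = 2 ∧ OnPath v (centralSubtree lo hi a k) then v else pathCenter lo hi,
          some (centralSubtree lo hi a k),
          some (pathCenter lo hi),
          if k = false then some a else b⟩)
  /-- Upon an output from `TC l`, output it from `TC (l + 1)` (if that instance is running). -/
  | inner (s : PState n) (l y : ℕ) (x : TCInput) :
      (s.tc m (l + 1)).inp = some x →
      (s.tc m l).out = some y → (s.tc m (l + 1)).out = none →
      TCStep m s (s.outputTC m (l + 1) (some y))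

/-! ### The protocol `Exp` -/

/-- The local steps of `Exp m`, apart from those of its subprotocols. The number `leaf m` is the
leaf of the path `2 ^ m - 1, …, 2 ^ (m + 1) - 1` that serves as the auxiliary input `a` of `TC m`.
Below, `LEFT` is `false`, `RIGHT` is `true`, and `⊥` is `none`. -/
inductive ExpStep {n : ℕ} (t : ℕ) (leaf : ℕ → ℕ) (m : ℕ) : PState n → PState n → Prop
  /-- Input `LEFT` to 2-graded consensus if the input is below `2 ^ (m + 1)`, and else `RIGHT`. -/
  | inputGC (s : PState n) (v : ℕ) :
      (s.exp m).inp = some v → (s.gc (.exp m)).inp = none →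
      ExpStep t leaf m s (s.inputGC (.exp m) (if v < 2 ^ (m + 1) then false else true))
  /-- The 2-graded consensus output is `(LEFT, 2)`. -/
  | left2 (s : PState n) (v : ℕ) :
      (s.exp m).inp = some v → (s.gc (.exp m)).out = some (some false, 2) →
      (s.exp m).next = none →
      ExpStep t leaf m s (s.setExp m { s.exp m with
        next := some (min v (2 ^ (m + 1) - 1))
        side := some false })
  /-- The 2-graded consensus output is `(RIGHT, 2)`. -/
  | right2 (s : PState n) (v : ℕ) :
      (s.exp m).inp = some v → (s.gc (.exp m)).out = some (some true, 2) →
      (s.exp m).next = none →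
      ExpStep t leaf m s (s.setExp m { s.exp m with
        next := some (max v (2 ^ (m + 1) - 1))
        side := some true })
  /-- The 2-graded consensus output is `(k, 1)`, where `k` is `LEFT` or `RIGHT`. -/
  | grade1 (s : PState n) (v : ℕ) (k : Bool) :
      (s.exp m).inp = some v → (s.gc (.exp m)).out = some (some k, 1) →
      (s.exp m).next = none →
      ExpStep t leaf m s (s.setExp m { s.exp m with
        next := some (2 ^ (m + 1) - 1)
        side := some k
        sent := insert (ExpMsg.side k) (s.exp m).sent })
  /-- The 2-graded consensus output is `(⊥, 0)`. -/
  | grade0 (s : PState n) (v : ℕ) :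
      (s.exp m).inp = some v → (s.gc (.exp m)).out = some (none, 0) →
      (s.exp m).next = none →
      ExpStep t leaf m s (s.setExp m { s.exp m with
        next := some (2 ^ (m + 1) - 1)
        out := (s.exp m).out.or (some (2 ^ (m + 1) - 1))
        sent := insert ExpMsg.center (s.exp m).sent })
  /-- After the output `(⊥, 0)`: receive `LEFT` or `RIGHT` from `t + 1` parties. -/
  | learnSide (s : PState n) (w : ℕ) (k : Bool) :
      (s.exp m).next = some w → (s.exp m).side = none →
      t + 1 ≤ heard (s.exp m).recv (fun c => c = ExpMsg.side k) →
      ExpStep t leaf m s (s.setExp m { s.exp m with side := some k })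
  /-- If `side = LEFT`, run `TC m` on the path `2 ^ m - 1, …, 2 ^ (m + 1) - 1`. -/
  | runTC (s : PState n) (w : ℕ) :
      (s.exp m).next = some w → (s.exp m).side = some false → (s.tc m m).inp = none →
      ExpStep t leaf m s (s.inputTC m m
        ⟨w, some (2 ^ m - 1, 2 ^ (m + 1) - 1), some (leaf m), none⟩)
  /-- If `side = RIGHT`, run `Exp (m + 1)`. -/
  | runExp (s : PState n) (w : ℕ) :
      (s.exp m).next = some w → (s.exp m).side = some true → (s.exp (m + 1)).inp = none →
      ExpStep t leaf m s (s.inputExp (m + 1) w)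
  /-- Upon an output from `TC m`, output it if `g ≥ 1`. -/
  | outLeft (s : PState n) (k : Option Bool) (g y : ℕ) :
      (s.exp m).side = some false → (s.gc (.exp m)).out = some (k, g) → 1 ≤ g →
      (s.tc m m).out = some y → (s.exp m).out = none →
      ExpStep t leaf m s (s.outputExp m y)
  /-- Upon an output from `Exp (m + 1)`, output it if `g ≥ 1`. -/
  | outRight (s : PState n) (k : Option Bool) (g y : ℕ) :
      (s.exp m).side = some true → (s.gc (.exp m)).out = some (k, g) → 1 ≤ g →
      (s.exp (m + 1)).out = some y → (s.exp m).out = none →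
      ExpStep t leaf m s (s.outputExp m y)
  /-- Upon receiving `CENTER` from `t + 1` parties, while running `Exp m` (in any phase). -/
  | center (s : PState n) (v : ℕ) :
      (s.exp m).inp = some v → (s.exp m).out = none →
      t + 1 ≤ heard (s.exp m).recv (fun c => c = ExpMsg.center) →
      ExpStep t leaf m s (s.outputExp m (2 ^ (m + 1) - 1))

/-- All local steps of a party. -/
inductive LocalStep {n : ℕ} (t : ℕ) (leaf : ℕ → ℕ) : PState n → PState n → Prop
  | gc (s : PState n) (id : GCId) (g : GCState n) :
      GCStep t (s.gc id) g → LocalStep t leaf s (s.setGC id g)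
  | tc (s s' : PState n) (m : ℕ) : TCStep m s s' → LocalStep t leaf s s'
  | exp (s s' : PState n) (m : ℕ) : ExpStep t leaf m s s' → LocalStep t leaf s s'

/-- The party has nothing left to do until it acquires its input or receives a message. -/
def Quiescent {n : ℕ} (t : ℕ) (leaf : ℕ → ℕ) (s : PState n) : Prop :=
  ∀ s', ¬ LocalStep t leaf s s'

/-! ### Asynchronous executions -/

/-- The possible moves of an honest party that runs `Exp j` with the input `v`, in a network with
the set `H` of honest parties and with the current states `c` of the parties. Channels are
authenticated: a message is received from an honest party only if that party has sent it.
Nothing is demanded of messages from other parties. -/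
inductive Move {n : ℕ} (t j : ℕ) (leaf : ℕ → ℕ) (H : Finset (Fin n)) (v : ℕ)
    (c : Fin n → PState n) : PState n → PState n → Prop
  | idle (s : PState n) : Move t j leaf H v c s s
  | acquire (s : PState n) : (s.exp j).inp = none → Move t j leaf H v c s (s.inputExp j v)
  | receive (s : PState n) (p : Fin n) (msg : Msg) : (p ∈ H → (c p).Sent msg) →
      Move t j leaf H v c s (s.receive p msg)
  | compute (s s' : PState n) : LocalStep t leaf s s' → Move t j leaf H v c s s'

/-- An execution of `Exp j` among `n` parties, at most `t` of which are ever corrupted.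

`honest` is the set of the parties that are never corrupted. As nothing is demanded of the messages
that come from the other parties, these may also follow the protocol up to a moment of corruption
chosen adaptively, and what they sent before it may be delivered or not.

`state k` holds the states of the parties at the time `time k` on an external clock, which the
parties cannot read. Local computation takes no time: at each time that occurs, each honest party
gets to the point where it has nothing left to do. -/
structure Execution (n t j : ℕ) (leaf : ℕ → ℕ) where
  honest : Finset (Fin n)
  card_corrupted : honestᶜ.card ≤ t
  /-- the inputs of the parties -/
  input : Fin n → ℕ
  time : ℕ → ℝ
  time_mono : Monotone time
  state : ℕ → Fin n → PState n
  state_zero : ∀ i ∈ honest, state 0 i = PState.initial n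
  move : ∀ k, ∀ i ∈ honest,
    Move t j leaf honest (input i) (state k) (state k i) (state (k + 1) i)
  instant : ∀ k, ∀ i ∈ honest, ∃ k' ≥ k, time k' = time k ∧ Quiescent t leaf (state k' i)

namespace Execution

variable {n t j : ℕ} {leaf : ℕ → ℕ} (E : Execution n t j leaf)

/-- Party `i` has acquired its input by the `k`-th point of the execution. -/
def HasInput (k : ℕ) (i : Fin n) : Prop := ((E.state k i).exp j).inp = some (E.input i)

/-- Party `i` has output `y` from `Exp j` by the `k`-th point of the execution. -/
def HasOutput (k : ℕ) (i : Fin n) (y : ℕ) : Prop := ((E.state k i).exp j).out = some y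

/-- Party `i` has received `msg` from party `p` by the `k`-th point of the execution. -/
def HasReceived (k : ℕ) (i p : Fin n) : Msg → Prop
  | .gc id c => c ∈ ((E.state k i).gc id).recv p
  | .exp m c => c ∈ ((E.state k i).exp m).recv p

/-- Every message that an honest party sends to an honest party is eventually delivered. -/
def EventualDelivery : Prop :=
  ∀ p ∈ E.honest, ∀ i ∈ E.honest, ∀ k msg, (E.state k p).Sent msg →
    ∃ k', E.HasReceived k' i p msg

/-- Every message that an honest party sends to an honest party is delivered with a delay of at
most `Δ`. -/
def DelayAtMost (Δ : ℝ) : Prop :=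
  ∀ p ∈ E.honest, ∀ i ∈ E.honest, ∀ k msg, (E.state k p).Sent msg →
    ∃ k', E.time k' ≤ E.time k + Δ ∧ E.HasReceived k' i p msg

/-- Edge agreement: honest output vertices are equal or adjacent in the tree `G`. -/
def EdgeAgreement (G : SimpleGraph ℕ) : Prop :=
  ∀ i ∈ E.honest, ∀ i' ∈ E.honest, ∀ k k' y y',
    E.HasOutput k i y → E.HasOutput k' i' y' → y = y' ∨ G.Adj y y'

/-- Convex validity: every honest output vertex is on the path in the tree `G` between two (possibly
equal) honest input vertices. -/
def ConvexValidity (G : SimpleGraph ℕ) : Prop :=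
  ∀ i ∈ E.honest, ∀ k y, E.HasOutput k i y →
    ∃ i₁ ∈ E.honest, ∃ i₂ ∈ E.honest,
      ∃ p : G.Walk (E.input i₁) (E.input i₂), p.IsPath ∧ y ∈ p.support

/-- Liveness: if every honest party eventually acquires its input, then (as the adversary has to
deliver the messages between honest parties eventually) every honest party outputs. -/
def Live : Prop :=
  E.EventualDelivery → (∀ i ∈ E.honest, ∃ k, E.HasInput k i) →
    ∀ i ∈ E.honest, ∃ k y, E.HasOutput k i y

/-- The execution takes at most `R` rounds: it is live, and if no message between honest parties
takes longer than `Δ`, then all honest parties output within the time `R * Δ` after the time `τ` by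
which all of them have acquired their inputs. -/
def AtMostRounds (R : ℝ) : Prop :=
  E.Live ∧
  ∀ Δ τ : ℝ, E.DelayAtMost Δ → (∀ i ∈ E.honest, ∃ k, E.time k ≤ τ ∧ E.HasInput k i) →
    ∀ i ∈ E.honest, ∃ k y, E.time k ≤ τ + R * Δ ∧ E.HasOutput k i y

end Execution

/-! ### Counting senders -/

/-! Safety of 2-graded consensus is quorum intersection. Two quorums of `n - t` senders share an
honest party, which proposes only one value in each of the two phases. So all outputs `(b, 1)` of
1-graded consensus carry the same bit (`out₁_agree`), all singleton outputs of the proposal protocol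
agree (`out₂_singleton`), and the grades 0 and 2 exclude each other. An honest echo that does not
come from the sender's own value needs `t + 1` echoes of others, hence an earlier honest one.
Following these echoes back, unanimous inputs `v` force the output `(v, 2)` (`out_of_unanimous`).
Conversely, a grade of at most 1 certifies that both bits are honest inputs, that is, that honest
vertices lie on both sides of the center. This is what makes moving to the center valid.

`TC` on a common path (`OnCommon.out`): if nobody obtains grade 0, all honest parties go on with the
same half. If somebody does, nobody has grade 2, so all stand at the midpoint `σ` and have to stay
there, although some hold a half of the path and others hold no path at all. The auxiliary inputs
make them vote alike: at the next level for the half that contains `a = σ` (`AtA`), and below that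
always for the half away from the new `a`, which has `σ` as its end (`AtB`). Unanimity turns each
vote into grade 2, so nobody moves.

`Exp` (`exp_safe`): the value of `side` is common, so only one subprotocol matters. If somebody
obtains grade 0, all continue from the center `c`, and validity of the subprotocol with both bounds
equal to `c` forces every output to be `c`. Otherwise no honest party sends `CENTER`, and outputs
come from the one subprotocol. Going right needs an honest input of at least `2 ^ (m + 1)`, so the
recursion ends at `m = q - 1`.

Rounds: 2-graded consensus takes 3 + 3 rounds and `TC l` takes `6 * l`. If grade 0 occurs in `Exp
m`, one more round brings either `CENTER` or a common `side` from `t + 1` honest parties; at worst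
`Exp (m + 1)` then runs with all inputs `c`, which takes `6 * (m + 2)` rounds. If grade 0 does not
occur, 6 rounds lead at worst to `Exp (m + 1)`. Hence the bound `19 + 6 * m + 12 * (q - m - 1) = 7 +
12 * q - 6 * m`. Points of the execution are compared with rounds only through a predicate `W`, so
one argument yields both liveness (`W` always true) and the time bound.

All of this is drawn from two local facts: states only grow (`Le`), and whatever a register or set
contains has a recorded origin (`Good`). -/

theorem heard_mono {n : ℕ} {M : Type} {recv recv' : Fin n → Set M} {P Q : M → Prop}
    (h : ∀ p, recv p ⊆ recv' p) (hPQ : ∀ m, P m → Q m) : heard recv P ≤ heard recv' Q :=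
  Set.ncard_le_ncard (fun p ⟨m, hm, hP⟩ => ⟨m, h p hm, hPQ m hP⟩) (Set.toFinite _)

/-- Among more than `t` senders there is an honest one. -/
theorem exists_honest_of_heard {n t : ℕ} {M : Type} {H : Finset (Fin n)} (hH : Hᶜ.card ≤ t)
    {recv : Fin n → Set M} {P : M → Prop} (h : t + 1 ≤ heard recv P) :
    ∃ p ∈ H, ∃ m ∈ recv p, P m := by
  by_contra hc
  push Not at hc
  have : {p : Fin n | ∃ m ∈ recv p, P m} ⊆ (↑(Hᶜ) : Set (Fin n)) := by
    rintro p ⟨m, hm, hP⟩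
    simp only [Finset.coe_compl, Set.mem_compl_iff, Finset.mem_coe]
    exact fun hp => hc p hp m hm hP
  have h2 := Set.ncard_le_ncard this (Set.toFinite _)
  rw [Set.ncard_coe_finset] at h2
  unfold heard at h
  omega

/-- The messages sent by the members of `S` are heard from at least `#S` parties. -/
theorem le_heard {n : ℕ} {M : Type} {S : Finset (Fin n)} {recv : Fin n → Set M} {P : M → Prop}
    (h : ∀ p ∈ S, ∃ m ∈ recv p, P m) : S.card ≤ heard recv P := by
  rw [← Set.ncard_coe_finset]
  exact Set.ncard_le_ncard (fun p hp => h p hp) (Set.toFinite _)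

/-- At most `t` of the parties heard from are corrupted. -/
theorem exists_honest_senders {n t : ℕ} {M : Type} {H : Finset (Fin n)} (hH : Hᶜ.card ≤ t)
    {recv : Fin n → Set M} {P : M → Prop} {a : ℕ} (h : a + t ≤ heard recv P) :
    ∃ S ⊆ H, a ≤ S.card ∧ ∀ p ∈ S, ∃ m ∈ recv p, P m := by
  classical
  refine ⟨H.filter fun p => ∃ m ∈ recv p, P m, Finset.filter_subset _ _, ?_, fun p hp =>
    (Finset.mem_filter.1 hp).2⟩
  have h1 : heard recv P = (Finset.univ.filter fun p => ∃ m ∈ recv p, P m).card := by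
    rw [← Set.ncard_coe_finset]
    simp [heard]
  have h2 : (Finset.univ.filter fun p => ∃ m ∈ recv p, P m) ⊆
      (H.filter fun p => ∃ m ∈ recv p, P m) ∪ Hᶜ := by
    intro p hp
    simp only [Finset.mem_filter, Finset.mem_univ, true_and, Finset.mem_union,
      Finset.mem_compl] at hp ⊢
    exact (em (p ∈ H)).imp_left fun h => ⟨h, hp⟩
  have h3 := (Finset.card_le_card h2).trans (Finset.card_union_le _ _)
  omega

/-- Two quorums of `n - t` senders have an honest sender in common. -/
theorem exists_honest_common {n t : ℕ} (ht : 3 * t < n) {M M' : Type} {H : Finset (Fin n)}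
    (hH : Hᶜ.card ≤ t) {recv : Fin n → Set M} {recv' : Fin n → Set M'} {P : M → Prop}
    {P' : M' → Prop} (h : n - t ≤ heard recv P) (h' : n - t ≤ heard recv' P') :
    ∃ p ∈ H, (∃ m ∈ recv p, P m) ∧ ∃ m ∈ recv' p, P' m := by
  classical
  obtain ⟨S, hS, hc, hm⟩ := exists_honest_senders (a := n - t - t) hH (by omega : _ ≤ heard recv P)
  obtain ⟨S', hS', hc', hm'⟩ :=
    exists_honest_senders (a := n - t - t) hH (by omega : _ ≤ heard recv' P')
  by_contra hcon
  push Not at hcon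
  obtain ⟨A, hA⟩ : ∃ A : Finset (Fin n), A = {p | ∃ m ∈ recv p, P m} :=
    ⟨Set.toFinset {p | ∃ m ∈ recv p, P m}, by simp⟩
  obtain ⟨A', hA'⟩ : ∃ A : Finset (Fin n), A = {p | ∃ m ∈ recv' p, P' m} :=
    ⟨Set.toFinset {p | ∃ m ∈ recv' p, P' m}, by simp⟩
  have e : heard recv P = A.card := by rw [heard, ← hA, Set.ncard_coe_finset]
  have e' : heard recv' P' = A'.card := by rw [heard, ← hA', Set.ncard_coe_finset]
  -- If all common senders were corrupted there would be at most `t` of them, but two sets of at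
  -- least `n - t` parties meet in at least `n - 2 * t > t`.
  have hint : A ∩ A' ⊆ Hᶜ := by
    intro p hp
    rw [Finset.mem_inter, ← Finset.mem_coe, ← Finset.mem_coe, hA, hA'] at hp
    obtain ⟨hp, m', hm', hP'⟩ := hp
    rw [Finset.mem_compl]
    exact fun hpH => hcon p hpH hp m' hm' hP'
  have h1 := Finset.card_le_card hint
  have h2 := Finset.card_union_add_card_inter A A'
  have h3 := Finset.card_le_univ (A ∪ A')
  rw [Fintype.card_fin] at h3
  omega

/-- More than `2 * t` parties are honest. -/
theorem card_honest {n t : ℕ} {H : Finset (Fin n)} (hH : Hᶜ.card ≤ t) : n - t ≤ H.card := by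
  rw [Finset.card_compl, Fintype.card_fin] at hH
  omega

/-! ### Local invariants of 2-graded consensus -/

namespace GCState

variable {n : ℕ}

/-- The state `s'` arises from `s` by setting registers and adding elements to sets. -/
structure Le (s s' : GCState n) : Prop where
  inp : ∀ b, s.inp = some b → s'.inp = some b
  recv : ∀ p, s.recv p ⊆ s'.recv p
  sent : s.sent ⊆ s'.sent
  V₁ : s.V₁ ⊆ s'.V₁
  W₁ : s.W₁ ⊆ s'.W₁
  out₁ : ∀ x, s.out₁ = some x → s'.out₁ = some x
  V₂ : s.V₂ ⊆ s'.V₂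
  out₂ : ∀ Y, s.out₂ = some Y → s'.out₂ = some Y

theorem Le.rfl {s : GCState n} : s.Le s := by constructor <;> simp

theorem Le.trans {s s' s'' : GCState n} (h : s.Le s') (h' : s'.Le s'') : s.Le s'' where
  inp b hb := h'.inp b (h.inp b hb)
  recv p := (h.recv p).trans (h'.recv p)
  sent := h.sent.trans h'.sent
  V₁ := h.V₁.trans h'.V₁
  W₁ := h.W₁.trans h'.W₁
  out₁ x hx := h'.out₁ x (h.out₁ x hx)
  V₂ := h.V₂.trans h'.V₂
  out₂ Y hY := h'.out₂ Y (h.out₂ Y hY)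

theorem Le.out {s s' : GCState n} (h : s.Le s') {o} (ho : s.out = some o) : s'.out = some o := by
  unfold GCState.out at *
  obtain ⟨Y, hY, ho⟩ := Option.bind_eq_some_iff.1 ho
  rw [h.out₂ Y hY]
  exact ho

/-- What the sets and registers of a party say about the messages that it has received. -/
structure Good (t : ℕ) (s : GCState n) : Prop where
  echo₁_some : ∀ b, .echo₁ (some b) ∈ s.sent → s.inp = some b
  echo₁_none : .echo₁ none ∈ s.sent → ∃ v, s.inp = some v ∧
    t + 1 ≤ heard s.recv (fun m => ∃ x, m = GCMsg.echo₁ x ∧ x ≠ some v)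
  V₁ : ∀ b ∈ s.V₁,
    t + 1 ≤ heard s.recv (fun m => m = GCMsg.echo₁ none ∨ m = GCMsg.echo₁ (some b))
  V₁_univ : s.V₁ = Finset.univ → s.out₁ ≠ none
  W₁ : ∀ b ∈ s.W₁,
    2 * t + 1 ≤ heard s.recv (fun m => m = GCMsg.echo₁ none ∨ m = GCMsg.echo₁ (some b))
  W₁_prop₁ : ∀ b ∈ s.W₁, ∃ b', .prop₁ b' ∈ s.sent
  prop₁_W₁ : ∀ b, .prop₁ b ∈ s.sent → b ∈ s.W₁
  prop₁_unique : ∀ b b', .prop₁ b ∈ s.sent → .prop₁ b' ∈ s.sent → b = b'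
  out₁_some : ∀ b, s.out₁ = some (some b) → s.inp = some b ∧
    n - t ≤ heard s.recv (fun m => m = GCMsg.prop₁ b)
  out₁_none : s.out₁ = some none → ∃ v, s.inp = some v ∧
    (t + 1 ≤ heard s.recv (fun m => ∃ x, m = GCMsg.echo₁ x ∧ x ≠ some v) ∨
      s.V₁ = Finset.univ ∨ ∃ b ≠ v, n - t ≤ heard s.recv (fun m => m = GCMsg.prop₁ b))
  echo₂ : ∀ x, .echo₂ x ∈ s.sent →
    s.out₁ = some x ∨ t + 1 ≤ heard s.recv (fun m => m = GCMsg.echo₂ x)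
  V₂ : ∀ x ∈ s.V₂, .echo₂ x ∈ s.sent ∧ t + 1 ≤ heard s.recv (fun m => m = GCMsg.echo₂ x)
  V₂_card : 2 ≤ s.V₂.card → s.out₂ ≠ none
  prop₂ : ∀ x, .prop₂ x ∈ s.sent → 2 * t + 1 ≤ heard s.recv (fun m => m = GCMsg.echo₂ x)
  prop₂_unique : ∀ x y, .prop₂ x ∈ s.sent → .prop₂ y ∈ s.sent → x = y
  out₂ : ∀ Y, s.out₂ = some Y → s.inp ≠ none ∧
    ((∃ x, Y = {x} ∧ n - t ≤ heard s.recv (fun m => m = GCMsg.prop₂ x)) ∨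
      Y.card = 2 ∧ ∀ x ∈ Y, t + 1 ≤ heard s.recv (fun m => m = GCMsg.echo₂ x))

theorem good_initial (t : ℕ) : (GCState.initial n).Good t := by
  constructor <;> simp [GCState.initial]
  exact Finset.univ_nonempty.ne_empty.symm

/-- Receiving messages keeps the invariants. -/
theorem Good.receive {t : ℕ} {s : GCState n} (h : s.Good t) {r : Fin n → Set GCMsg}
    (hr : ∀ p, s.recv p ⊆ r p) : Good t { s with recv := r } := by
  have hh : ∀ P : GCMsg → Prop, heard s.recv P ≤ heard r P := fun P => heard_mono hr fun _ => id
  obtain ⟨h1, h2, h3, h4, h5, h6, h7, h8, h9, h10, h11, h12, h13, h14, h15, h16⟩ := h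
  constructor
  · exact h1
  · intro h; obtain ⟨v, a, b⟩ := h2 h; exact ⟨v, a, b.trans (hh _)⟩
  · exact fun b hb => (h3 b hb).trans (hh _)
  · exact h4
  · exact fun b hb => (h5 b hb).trans (hh _)
  · exact h6
  · exact h7
  · exact h8
  · exact fun b hb => ⟨(h9 b hb).1, (h9 b hb).2.trans (hh _)⟩
  · intro h
    obtain ⟨v, a, b⟩ := h10 h
    refine ⟨v, a, ?_⟩
    rcases b with b | b | ⟨b, hb, c⟩
    · exact .inl (b.trans (hh _))
    · exact .inr (.inl b)
    · exact .inr (.inr ⟨b, hb, c.trans (hh _)⟩)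
  · exact fun x hx => (h11 x hx).imp_right fun h => h.trans (hh _)
  · exact fun x hx => ⟨(h12 x hx).1, (h12 x hx).2.trans (hh _)⟩
  · exact h13
  · exact fun x hx => (h14 x hx).trans (hh _)
  · exact h15
  · intro Y hY
    obtain ⟨a, ⟨x, b, c⟩ | ⟨b, c⟩⟩ := h16 Y hY
    · exact ⟨a, .inl ⟨x, b, c.trans (hh _)⟩⟩
    · exact ⟨a, .inr ⟨b, fun x hx => (c x hx).trans (hh _)⟩⟩

/-- The clauses that record an input all presuppose one, so they are vacuous for a dormant instance;
the other clauses do not involve the input. -/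
theorem Good.input {t : ℕ} {s : GCState n} (h : s.Good t) (hi : s.inp = none) (b : Bool) :
    Good t { s with inp := some b } := by
  obtain ⟨h1, h2, h3, h4, h5, h6, h7, h8, h9, h10, h11, h12, h13, h14, h15, h16⟩ := h
  rw [hi] at h1 h2 h9 h10 h16
  constructor
  · exact fun b hb => absurd (h1 b hb) (by simp)
  · exact fun h => absurd (h2 h) (by simp)
  · exact h3
  · exact h4
  · exact h5
  · exact h6
  · exact h7
  · exact h8
  · exact fun b hb => absurd (h9 b hb).1 (by simp)
  · exact fun h => absurd (h10 h) (by simp)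
  · exact h11
  · exact h12
  · exact h13
  · exact h14
  · exact h15
  · exact fun Y hY => absurd rfl (h16 Y hY).1

end GCState

theorem GCStep.le {n t : ℕ} {s s' : GCState n} (h : GCStep t s s') : s.Le s' := by
  cases h <;> refine ⟨fun _ => id, fun _ => subset_rfl, ?_, ?_, ?_, ?_, ?_, ?_⟩ <;> dsimp only <;>
    first
    | exact subset_rfl
    | exact Set.subset_insert _ _
    | exact Finset.subset_insert _ _
    | exact fun _ => id
    | (intro x hx; simp_all; done)
    | (split_ifs <;> simp +contextual [Set.subset_insert])

/-- The guard of each rule is the very evidence that the invariant records for what the rule adds.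
-/
theorem GCStep.good {n t : ℕ} {s s' : GCState n} (h : GCStep t s s') (g : s.Good t) :
    s'.Good t := by
  cases h <;>
    obtain ⟨h1, h2, h3, h4, h5, h6, h7, h8, h9, h10, h11, h12, h13, h14, h15, h16⟩ := g <;>
    constructor <;> dsimp only <;>
    first
    | assumption
    | grind [Option.or_eq_some_iff, Option.or_eq_none_iff]
    | skip
  case addV₁.out₁_none v b hv hb hh =>
    intro h
    split_ifs at h with hu
    · exact ⟨v, hv, .inr (.inl hu)⟩
    · obtain ⟨w, hw, hc | hc | hc⟩ := h10 h
      · exact ⟨w, hw, .inl hc⟩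
      · exact absurd (hc ▸ Finset.mem_univ b) hb
      · exact ⟨w, hw, .inr (.inr hc)⟩
  case addW₁.prop₁_unique v b hv hb hh =>
    intro c c' hc hc'
    split_ifs at hc hc' with hW
    -- If adding the new element `b` makes `W` equal to `{b}`, then `W` was empty, so nothing had
    -- been proposed yet.
    · have hW' : ∀ d, .prop₁ d ∉ s.sent := fun d hd => by
        have h1 := h7 d hd
        have h2 : d ∈ insert b s.W₁ := Finset.mem_insert_of_mem h1
        rw [hW, Finset.mem_singleton] at h2
        exact hb (h2 ▸ h1)
      have e : ∀ d, .prop₁ d ∈ insert (GCMsg.prop₁ b) s.sent → d = b := fun d hd =>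
        (Set.mem_insert_iff.1 hd).elim (fun h => GCMsg.prop₁.inj h) fun h => absurd h (hW' d)
      rw [e c hc, e c' hc']
    · exact h8 c c' hc hc'
  case decide₁.out₁_none v b hv hb hh =>
    intro h
    refine ⟨v, hv, .inr (.inr ⟨b, fun e => ?_, hh⟩)⟩
    simp [e] at h

theorem GCStep.recv_eq {n t : ℕ} {s s' : GCState n} (h : GCStep t s s') : s'.recv = s.recv := by
  cases h <;> rfl

theorem GCStep.inp_eq {n t : ℕ} {s s' : GCState n} (h : GCStep t s s') : s'.inp = s.inp := by
  cases h <;> rfl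

/-! ### One instance of 2-graded consensus in a network -/

/-- The moves of an honest party, as far as they concern one instance of 2-graded consensus. -/
inductive GCMove {n : ℕ} (t : ℕ) (H : Finset (Fin n)) (c : Fin n → GCState n)
    (s s' : GCState n) : Prop
  | idle : s' = s → GCMove t H c s s'
  | acquire (b : Bool) : s.inp = none → s' = { s with inp := some b } → GCMove t H c s s'
  | receive (p : Fin n) (m : GCMsg) : (p ∈ H → m ∈ (c p).sent) →
      s' = { s with recv := Function.update s.recv p (insert m (s.recv p)) } → GCMove t H c s s'
  | compute : GCStep t s s' → GCMove t H c s s'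

theorem GCMove.le {n t : ℕ} {H : Finset (Fin n)} {c : Fin n → GCState n} {s s' : GCState n}
    (h : GCMove t H c s s') : s.Le s' := by
  rcases h with rfl | ⟨b, hb, rfl⟩ | ⟨p, m, -, rfl⟩ | h
  · exact .rfl
  · constructor <;> simp [hb]
  · refine ⟨fun _ => id, fun q => ?_, subset_rfl, subset_rfl, subset_rfl, fun _ => id, subset_rfl,
      fun _ => id⟩
    by_cases hq : q = p
    · subst hq; simp
    · simp [hq]
  · exact h.le

theorem GCMove.good {n t : ℕ} {H : Finset (Fin n)} {c : Fin n → GCState n} {s s' : GCState n}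
    (h : GCMove t H c s s') (g : s.Good t) : s'.Good t := by
  have hle := h.le
  rcases h with rfl | ⟨b, hb, rfl⟩ | ⟨p, m, -, rfl⟩ | h
  · exact g
  · exact g.input hb b
  · exact g.receive hle.recv
  · exact h.good g

/-- An instance of 2-graded consensus among the honest parties `H`. -/
structure GCRun {n : ℕ} (t : ℕ) (H : Finset (Fin n)) (G : ℕ → Fin n → GCState n) : Prop where
  card : Hᶜ.card ≤ t
  zero : ∀ i ∈ H, G 0 i = GCState.initial n
  move : ∀ k, ∀ i ∈ H, GCMove t H (G k) (G k i) (G (k + 1) i)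

theorem gradeDouble_singleton_some (b : Bool) : gradeDouble {some b} = some (some b, 2) := by
  cases b <;> decide

theorem gradeDouble_pair (b : Bool) : gradeDouble {none, some b} = some (some b, 1) := by
  cases b <;> decide

theorem gradeDouble_singleton_none : gradeDouble {none} = some (none, 0) := by decide

namespace GCRun

variable {n t : ℕ} {H : Finset (Fin n)} {G : ℕ → Fin n → GCState n}

theorem good (R : GCRun t H G) (k : ℕ) {i : Fin n} (hi : i ∈ H) : (G k i).Good t := by
  induction k with
  | zero => rw [R.zero i hi]; exact GCState.good_initial t
  | succ k ih => exact (R.move k i hi).good ih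

theorem le (R : GCRun t H G) {k k' : ℕ} (hk : k ≤ k') {i : Fin n} (hi : i ∈ H) :
    (G k i).Le (G k' i) := by
  induction k', hk using Nat.le_induction with
  | base => exact .rfl
  | succ k' _ ih => exact ih.trans (R.move k' i hi).le

/-- Authenticity of the channels. That the sending is strictly earlier is what makes the inductions
along chains of echoes well-founded. -/
theorem sent_of_recv (R : GCRun t H G) {k : ℕ} {i p : Fin n} (hi : i ∈ H) (hp : p ∈ H)
    {m : GCMsg} (hm : m ∈ (G k i).recv p) : ∃ k' < k, m ∈ (G k' p).sent := by
  induction k with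
  | zero => simp [R.zero i hi, GCState.initial] at hm
  | succ k ih =>
    have ih' : m ∈ (G k i).recv p → ∃ k' < k + 1, m ∈ (G k' p).sent := fun h =>
      let ⟨k', h1, h2⟩ := ih h
      ⟨k', by omega, h2⟩
    rcases R.move k i hi with h | ⟨b, -, h⟩ | ⟨q, m', hq, h⟩ | h
    · exact ih' (h ▸ hm)
    · exact ih' (by rw [h] at hm; exact hm)
    · rw [h] at hm
      by_cases hpq : p = q
      · subst hpq
        simp only [Function.update_self, Set.mem_insert_iff] at hm
        rcases hm with rfl | hm
        · exact ⟨k, by omega, hq hp⟩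
        · exact ih' hm
      · simp only [Function.update_of_ne hpq] at hm
        exact ih' hm
    · exact ih' (h.recv_eq ▸ hm)

/-- What is heard from more than `t` parties has been sent by an honest party. -/
theorem sent_of_heard (R : GCRun t H G) {k : ℕ} {i : Fin n} (hi : i ∈ H) {P : GCMsg → Prop}
    (h : t + 1 ≤ heard (G k i).recv P) : ∃ p ∈ H, ∃ k' < k, ∃ m ∈ (G k' p).sent, P m := by
  obtain ⟨p, hp, m, hm, hP⟩ := exists_honest_of_heard R.card h
  obtain ⟨k', hk, hs⟩ := R.sent_of_recv hi hp hm
  exact ⟨p, hp, k', hk, m, hs, hP⟩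

/-! ### Unanimous inputs in 1-graded consensus -/

section Unanimous

variable {v : Bool}

/-- There is no first honest echo on `⊥`: it would need deviating echoes from `t + 1` parties, one
of them honest and earlier. -/
theorem echo₁_of_unanimous (R : GCRun t H G)
    (hv : ∀ k, ∀ i ∈ H, ∀ b, (G k i).inp = some b → b = v) (k : ℕ) :
    ∀ i ∈ H, ∀ x, .echo₁ x ∈ (G k i).sent → x = some v := by
  induction k using Nat.strong_induction_on with
  | _ k ih =>
    intro i hi x hx
    cases x with
    | some b => rw [hv k i hi b ((R.good k hi).echo₁_some b hx)]
    | none =>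
      obtain ⟨w, hw, h⟩ := (R.good k hi).echo₁_none hx
      obtain ⟨p, hp, k', hk, m, hm, x, rfl, hne⟩ := R.sent_of_heard hi h
      exact absurd (hv k i hi w hw ▸ ih k' hk p hp x hm) hne

theorem not_heard_of_unanimous (R : GCRun t H G)
    (hv : ∀ k, ∀ i ∈ H, ∀ b, (G k i).inp = some b → b = v) {k : ℕ} {i : Fin n} (hi : i ∈ H)
    {b : Bool}
    (h : t + 1 ≤ heard (G k i).recv (fun m => m = GCMsg.echo₁ none ∨ m = GCMsg.echo₁ (some b))) :
    b = v := by
  obtain ⟨p, hp, k', -, m, hm, rfl | rfl⟩ := R.sent_of_heard hi h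
  · exact absurd (R.echo₁_of_unanimous hv k' p hp _ hm) (by simp)
  · exact Option.some.inj (R.echo₁_of_unanimous hv k' p hp _ hm)

/-- Each of the three reasons for the output `⊥` (deviating echoes, a full `V`, proposals on the
other bit) leads back to an honest echo that is not on `v`. -/
theorem out₁_of_unanimous (R : GCRun t H G) (ht : 3 * t < n)
    (hv : ∀ k, ∀ i ∈ H, ∀ b, (G k i).inp = some b → b = v) {k : ℕ} {i : Fin n} (hi : i ∈ H)
    {x : Option Bool} (hx : (G k i).out₁ = some x) : x = some v := by
  cases x with
  | some b => rw [hv k i hi b ((R.good k hi).out₁_some b hx).1]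
  | none =>
    exfalso
    obtain ⟨w, hw, h | h | ⟨b, hb, h⟩⟩ := (R.good k hi).out₁_none hx
    · obtain ⟨p, hp, k', hk, m, hm, x, rfl, hne⟩ := R.sent_of_heard hi h
      exact hne (hv k i hi w hw ▸ R.echo₁_of_unanimous hv k' p hp x hm)
    · have := R.not_heard_of_unanimous hv hi ((R.good k hi).V₁ (!v) (h ▸ Finset.mem_univ _))
      simp at this
    · obtain ⟨p, hp, k', hk, m, hm, rfl⟩ := R.sent_of_heard hi ((by omega : t + 1 ≤ n - t).trans h)
      have h1 := (R.good k' hp).W₁ b ((R.good k' hp).prop₁_W₁ b hm)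
      exact hb ((R.not_heard_of_unanimous hv hp ((by omega : t + 1 ≤ 2 * t + 1).trans h1)).trans
        (hv k i hi w hw).symm)

end Unanimous

/-! ### Agreement and the exclusion of grades in 2-graded consensus -/

theorem out₁_agree (R : GCRun t H G) (ht : 3 * t < n) {k k' : ℕ} {i i' : Fin n} (hi : i ∈ H)
    (hi' : i' ∈ H) {b b' : Bool} (h : (G k i).out₁ = some (some b))
    (h' : (G k' i').out₁ = some (some b')) : b = b' := by
  obtain ⟨p, hp, ⟨m, hm, rfl⟩, ⟨m', hm', rfl⟩⟩ := exists_honest_common ht R.card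
    ((R.good k hi).out₁_some b h).2 ((R.good k' hi').out₁_some b' h').2
  obtain ⟨l, -, hl⟩ := R.sent_of_recv hi hp hm
  obtain ⟨l', -, hl'⟩ := R.sent_of_recv hi' hp hm'
  exact (R.good (max l l') hp).prop₁_unique b b' ((R.le (le_max_left _ _) hp).sent hl)
    ((R.le (le_max_right _ _) hp).sent hl')

/-- An amplified echo leads back to an honest echo on the same value at an earlier point, and such a
chain can only end at a party that echoes its own output of 1-graded consensus. -/
theorem out₁_of_echo₂ (R : GCRun t H G) {x : Option Bool} (k : ℕ) :
    ∀ i ∈ H, .echo₂ x ∈ (G k i).sent → ∃ k', ∃ i' ∈ H, (G k' i').out₁ = some x := by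
  induction k using Nat.strong_induction_on with
  | _ k ih =>
    intro i hi hx
    rcases (R.good k hi).echo₂ x hx with h | h
    · exact ⟨k, i, hi, h⟩
    · obtain ⟨p, hp, k', hk, m, hm, rfl⟩ := R.sent_of_heard hi h
      exact ih k' hk p hp hm

theorem out₁_of_heard_echo₂ (R : GCRun t H G) {x : Option Bool} {k : ℕ} {i : Fin n} (hi : i ∈ H)
    (h : t + 1 ≤ heard (G k i).recv (fun m => m = GCMsg.echo₂ x)) :
    ∃ k', ∃ i' ∈ H, (G k' i').out₁ = some x := by
  obtain ⟨p, hp, k', hk, m, hm, rfl⟩ := R.sent_of_heard hi h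
  exact R.out₁_of_echo₂ k' p hp hm

/-- This carries properties of 1-graded consensus over to the proposal protocol. A singleton rests
on proposals and so on `2 * t + 1` echoes at an honest proposer, a pair on `t + 1` echoes for each
of its elements. -/
theorem out₁_of_mem_out₂ (R : GCRun t H G) (ht : 3 * t < n) {x : Option Bool} {k : ℕ} {i : Fin n}
    (hi : i ∈ H) {Y : Finset (Option Bool)} (hY : (G k i).out₂ = some Y) (hx : x ∈ Y) :
    ∃ k', ∃ i' ∈ H, (G k' i').out₁ = some x := by
  rcases ((R.good k hi).out₂ Y hY).2 with ⟨y, rfl, h⟩ | ⟨-, h⟩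
  · obtain rfl := Finset.mem_singleton.1 hx
    obtain ⟨p, hp, k', hk, m, hm, rfl⟩ := R.sent_of_heard hi ((by omega : t + 1 ≤ n - t).trans h)
    have := (R.good k' hp).prop₂ x hm
    exact R.out₁_of_heard_echo₂ hp ((by omega : t + 1 ≤ 2 * t + 1).trans this)
  · exact R.out₁_of_heard_echo₂ hi (h x hx)

theorem out₂_singleton (R : GCRun t H G) (ht : 3 * t < n) {x y : Option Bool} {k k' : ℕ}
    {i i' : Fin n} (hi : i ∈ H) (hi' : i' ∈ H) (h : (G k i).out₂ = some {x})
    (h' : (G k' i').out₂ = some {y}) : x = y := by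
  -- A singleton cannot come from `V`, which is output only with two elements; so it comes from a
  -- quorum of proposals.
  have key : ∀ {x : Option Bool} {k : ℕ} {i : Fin n}, i ∈ H → (G k i).out₂ = some {x} →
      n - t ≤ heard (G k i).recv (fun m => m = GCMsg.prop₂ x) := by
    intro x k i hi h
    rcases ((R.good k hi).out₂ _ h).2 with ⟨y, hy, h⟩ | ⟨h, -⟩
    · rwa [Finset.singleton_inj.1 hy]
    · simp at h
  obtain ⟨p, hp, ⟨m, hm, rfl⟩, ⟨m', hm', rfl⟩⟩ := exists_honest_common ht R.card
    (key hi h) (key hi' h')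
  obtain ⟨l, -, hl⟩ := R.sent_of_recv hi hp hm
  obtain ⟨l', -, hl'⟩ := R.sent_of_recv hi' hp hm'
  exact (R.good (max l l') hp).prop₂_unique x y ((R.le (le_max_left _ _) hp).sent hl)
    ((R.le (le_max_right _ _) hp).sent hl')

/-- A pair of two bits is impossible, because the bits output by 1-graded consensus agree. So
`gradeDouble` is never applied outside its intended cases. -/
theorem out₂_cases (R : GCRun t H G) (ht : 3 * t < n) {k : ℕ} {i : Fin n} (hi : i ∈ H)
    {Y : Finset (Option Bool)} (hY : (G k i).out₂ = some Y) :
    Y = {none} ∨ ∃ b, Y = {some b} ∨ Y = {none, some b} := by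
  rcases ((R.good k hi).out₂ Y hY).2 with ⟨x, rfl, h⟩ | ⟨h, -⟩
  · cases x with
    | none => exact .inl rfl
    | some b => exact .inr ⟨b, .inl rfl⟩
  · obtain ⟨x, y, hxy, rfl⟩ := Finset.card_eq_two.1 h
    obtain ⟨k₁, i₁, hi₁, h₁⟩ := R.out₁_of_mem_out₂ ht hi hY (Finset.mem_insert_self x {y})
    obtain ⟨k₂, i₂, hi₂, h₂⟩ :=
      R.out₁_of_mem_out₂ ht hi hY (Finset.mem_insert_of_mem (Finset.mem_singleton_self y))
    match x, y with
    | none, none => exact absurd rfl hxy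
    | none, some b => exact .inr ⟨b, .inr rfl⟩
    | some b, none => exact .inr ⟨b, .inr (Finset.pair_comm _ _)⟩
    | some b, some b' => exact absurd (congrArg some (R.out₁_agree ht hi₁ hi₂ h₁ h₂)) hxy

theorem out_cases (R : GCRun t H G) (ht : 3 * t < n) {k : ℕ} {i : Fin n} (hi : i ∈ H)
    {o : Option Bool × ℕ} (ho : (G k i).out = some o) :
    ((G k i).out₂ = some {none} ∧ o = (none, 0)) ∨
      ∃ b, ((G k i).out₂ = some {some b} ∧ o = (some b, 2)) ∨
        ((G k i).out₂ = some {none, some b} ∧ o = (some b, 1)) := by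
  obtain ⟨Y, hY, hg⟩ := Option.bind_eq_some_iff.1 ho
  rw [hY]
  rcases R.out₂_cases ht hi hY with rfl | ⟨b, rfl | rfl⟩
  · rw [gradeDouble_singleton_none] at hg
    exact .inl ⟨rfl, (Option.some.inj hg).symm⟩
  · rw [gradeDouble_singleton_some] at hg
    exact .inr ⟨b, .inl ⟨rfl, (Option.some.inj hg).symm⟩⟩
  · rw [gradeDouble_pair] at hg
    exact .inr ⟨b, .inr ⟨rfl, (Option.some.inj hg).symm⟩⟩

theorem out_ne_none (R : GCRun t H G) (ht : 3 * t < n) {k : ℕ} {i : Fin n} (hi : i ∈ H)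
    (h : (G k i).out₂ ≠ none) : ∃ o, (G k i).out = some o := by
  obtain ⟨Y, hY⟩ := Option.ne_none_iff_exists'.1 h
  unfold GCState.out
  rw [hY]
  rcases R.out₂_cases ht hi hY with rfl | ⟨b, rfl | rfl⟩
  · exact ⟨_, gradeDouble_singleton_none⟩
  · exact ⟨_, gradeDouble_singleton_some b⟩
  · exact ⟨_, gradeDouble_pair b⟩

/-- The possible outputs of 2-graded consensus. -/
theorem out_shape (R : GCRun t H G) (ht : 3 * t < n) {k : ℕ} {i : Fin n} (hi : i ∈ H)
    {o : Option Bool × ℕ} (ho : (G k i).out = some o) :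
    o = (none, 0) ∨ ∃ b, o = (some b, 1) ∨ o = (some b, 2) := by
  rcases R.out_cases ht hi ho with h | ⟨b, h | h⟩
  · exact .inl h.2
  · exact .inr ⟨b, .inr h.2⟩
  · exact .inr ⟨b, .inl h.2⟩

theorem exists_out₁ (R : GCRun t H G) (ht : 3 * t < n) {k : ℕ} {i : Fin n} (hi : i ∈ H)
    {b : Bool} {g : ℕ} (ho : (G k i).out = some (some b, g)) :
    ∃ k', ∃ i' ∈ H, (G k' i').out₁ = some (some b) := by
  rcases R.out_cases ht hi ho with h | ⟨c, h | h⟩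
  · simp at h
  · obtain rfl : b = c := by simpa using (Prod.ext_iff.1 h.2).1
    exact R.out₁_of_mem_out₂ ht hi h.1 (by simp)
  · obtain rfl : b = c := by simpa using (Prod.ext_iff.1 h.2).1
    exact R.out₁_of_mem_out₂ ht hi h.1 (by simp)

/-- The values of positive grade agree. -/
theorem out_agree (R : GCRun t H G) (ht : 3 * t < n) {k k' : ℕ} {i i' : Fin n} (hi : i ∈ H)
    (hi' : i' ∈ H) {b b' : Bool} {g g' : ℕ} (h : (G k i).out = some (some b, g))
    (h' : (G k' i').out = some (some b', g')) : b = b' := by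
  obtain ⟨l, p, hp, hl⟩ := R.exists_out₁ ht hi h
  obtain ⟨l', p', hp', hl'⟩ := R.exists_out₁ ht hi' h'
  exact R.out₁_agree ht hp hp' hl hl'

/-- The grades `0` and `2` exclude each other. -/
theorem not_zero_two (R : GCRun t H G) (ht : 3 * t < n) {k k' : ℕ} {i i' : Fin n} (hi : i ∈ H)
    (hi' : i' ∈ H) {b : Option Bool} (h : (G k i).out = some (none, 0))
    (h' : (G k' i').out = some (b, 2)) : False := by
  rcases R.out_cases ht hi h with ⟨e, -⟩ | ⟨c, h | h⟩
  · rcases R.out_cases ht hi' h' with h' | ⟨c, ⟨e', -⟩ | h'⟩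
    · simp at h'
    · exact absurd (R.out₂_singleton ht hi hi' e e') (by simp)
    · simp at h'
  · simp at h
  · simp at h

/-- A value of positive grade is the input of an honest party. -/
theorem exists_inp (R : GCRun t H G) (ht : 3 * t < n) {k : ℕ} {i : Fin n} (hi : i ∈ H)
    {b : Bool} {g : ℕ} (ho : (G k i).out = some (some b, g)) :
    ∃ k', ∃ i' ∈ H, (G k' i').inp = some b := by
  obtain ⟨l, p, hp, hl⟩ := R.exists_out₁ ht hi ho
  exact ⟨l, p, hp, ((R.good l hp).out₁_some b hl).1⟩

/-- If all honest inputs are `v`, then all honest outputs are `(v, 2)`. -/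
theorem out_of_unanimous (R : GCRun t H G) (ht : 3 * t < n) {v : Bool}
    (hv : ∀ k, ∀ i ∈ H, ∀ b, (G k i).inp = some b → b = v) {k : ℕ} {i : Fin n} (hi : i ∈ H)
    {o : Option Bool × ℕ} (ho : (G k i).out = some o) : o = (some v, 2) := by
  have key : ∀ {Y}, (G k i).out₂ = some Y → ∀ x ∈ Y, x = some v := fun hY x hx =>
    let ⟨_, _, hi', h⟩ := R.out₁_of_mem_out₂ ht hi hY hx
    R.out₁_of_unanimous ht hv hi' h
  rcases R.out_cases ht hi ho with h | ⟨c, h | h⟩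
  · exact absurd (key h.1 none (by simp)) (by simp)
  · obtain rfl : c = v := by simpa using key h.1 (some c) (by simp)
    exact h.2
  · exact absurd (key h.1 none (by simp)) (by simp)

/-- If some honest party has an output of grade at most `1`, then both bits are honest inputs. -/
theorem exists_inp_of_grade_le_one (R : GCRun t H G) (ht : 3 * t < n) {k : ℕ} {i : Fin n}
    (hi : i ∈ H) {x : Option Bool} {g : ℕ} (ho : (G k i).out = some (x, g)) (hg : g ≤ 1)
    (b : Bool) : ∃ k', ∃ i' ∈ H, (G k' i').inp = some b := by
  by_contra hc
  push Not at hc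
  have := R.out_of_unanimous ht (v := !b) (fun k' i' hi' c hc' => by
    cases b <;> cases c <;> simp_all) hi ho
  simp at this
  omega

end GCRun

/-! ### Rounds -/

/-- `W r k` says that the `k`-th point of the execution comes at most `r` rounds after some fixed
moment. In the sense of `W`, messages take one round and local computation takes no time. -/
structure Paced {n : ℕ} {M : Type} (W : ℕ → ℕ → Prop) (H : Finset (Fin n))
    (sent : ℕ → Fin n → Set M) (recv : ℕ → Fin n → Fin n → Set M)
    (quiet : ℕ → Fin n → Prop) : Prop where
  succ : ∀ r k, W r k → W (r + 1) k
  quiet : ∀ r k, W r k → ∀ i ∈ H, ∃ k' ≥ k, W r k' ∧ quiet k' i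
  deliver : ∀ r k, W r k → ∀ p ∈ H, ∀ i ∈ H, ∀ m ∈ sent k p, ∃ k', W (r + 1) k' ∧ m ∈ recv k' i p
  recv_mono : ∀ k k', k ≤ k' → ∀ i ∈ H, ∀ p, recv k i p ⊆ recv k' i p

/-- One round later everything sent by honest parties has arrived and has been processed. -/
theorem Paced.settled {n : ℕ} {M : Type} [Finite M] {W : ℕ → ℕ → Prop} {H : Finset (Fin n)}
    {sent : ℕ → Fin n → Set M} {recv : ℕ → Fin n → Fin n → Set M} {quiet : ℕ → Fin n → Prop}
    (h : Paced W H sent recv quiet) {r k₀ : ℕ} (hk₀ : W r k₀) {i : Fin n} (hi : i ∈ H) :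
    ∃ k ≥ k₀, W (r + 1) k ∧ quiet k i ∧
      ∀ p ∈ H, ∀ k', W r k' → ∀ m ∈ sent k' p, m ∈ recv k i p := by
  -- Only finitely many pairs of a sender and a message occur, so the latest of their delivery
  -- points serves for all. The additional index `none` keeps the index type nonempty; pairs that
  -- are never sent get the default `k₀`.
  have key : ∀ x : Option (Fin n × M), ∃ κ, W (r + 1) κ ∧ ∀ p m, x = some (p, m) → p ∈ H →
      ∀ k', W r k' → m ∈ sent k' p → m ∈ recv κ i p := by
    rintro (_ | ⟨p, m⟩)
    · exact ⟨k₀, h.succ _ _ hk₀, by simp⟩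
    · by_cases hex : p ∈ H ∧ ∃ k', W r k' ∧ m ∈ sent k' p
      · obtain ⟨hp, k', hW, hm⟩ := hex
        obtain ⟨κ, hκ, hr⟩ := h.deliver r k' hW p hp i hi m hm
        refine ⟨κ, hκ, ?_⟩
        rintro p' m' ⟨⟩
        exact fun _ _ _ _ => hr
      · refine ⟨k₀, h.succ _ _ hk₀, ?_⟩
        rintro p' m' ⟨⟩
        exact fun hp k' hW hm => absurd ⟨hp, k', hW, hm⟩ hex
  choose κ hκ hr using key
  obtain ⟨x₀, hx₀⟩ := Finite.exists_max κ
  have hW : W (r + 1) (max k₀ (κ x₀)) := by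
    rcases max_choice k₀ (κ x₀) with e | e <;> rw [e]
    · exact h.succ _ _ hk₀
    · exact hκ x₀
  obtain ⟨k, hk, hWk, hq⟩ := h.quiet _ _ hW i hi
  refine ⟨k, (le_max_left _ _).trans hk, hWk, hq, fun p hp k' hk' m hm => ?_⟩
  exact h.recv_mono (κ (some (p, m))) k ((hx₀ _).trans ((le_max_right _ _).trans hk)) i hi p
    (hr (some (p, m)) p m rfl hp k' hk' hm)

theorem Paced.mono {n : ℕ} {M : Type} {W : ℕ → ℕ → Prop} {H : Finset (Fin n)}
    {sent : ℕ → Fin n → Set M} {recv : ℕ → Fin n → Fin n → Set M} {quiet : ℕ → Fin n → Prop}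
    (h : Paced W H sent recv quiet) {r r' : ℕ} (hr : r ≤ r') {k : ℕ} (hk : W r k) : W r' k := by
  induction r', hr using Nat.le_induction with
  | base => exact hk
  | succ r' _ ih => exact h.succ _ _ ih

/-- Finiteness is what allows `Paced.settled` to wait for all messages of a round at once. -/
instance : Finite GCMsg := by
  refine Finite.of_surjective (α := Fin 4 × Option Bool) (fun x => match x with
    | (0, x) => .echo₁ x
    | (1, x) => .prop₁ (x.getD false)
    | (2, x) => .echo₂ x
    | (3, x) => .prop₂ x) fun m => ?_
  cases m with
  | echo₁ x => exact ⟨(0, x), rfl⟩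
  | prop₁ b => exact ⟨(1, some b), rfl⟩
  | echo₂ x => exact ⟨(2, x), rfl⟩
  | prop₂ x => exact ⟨(3, x), rfl⟩

namespace GCRun

variable {n t : ℕ} {H : Finset (Fin n)} {G : ℕ → Fin n → GCState n} {W : ℕ → ℕ → Prop}

/-- Rounds in an instance of 2-graded consensus. -/
abbrev IsPaced (t : ℕ) (H : Finset (Fin n)) (G : ℕ → Fin n → GCState n) (W : ℕ → ℕ → Prop) :
    Prop :=
  Paced W H (fun k i => (G k i).sent) (fun k i => (G k i).recv)
    (fun k i => ∀ g, ¬ GCStep t (G k i) g)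

/-- 1-graded consensus takes 3 rounds. -/
theorem out₁_live (R : GCRun t H G) (ht : 3 * t < n) (hW : IsPaced t H G W) {r : ℕ}
    (hin : ∀ i ∈ H, ∃ k, W r k ∧ (G k i).inp ≠ none) :
    ∀ i ∈ H, ∃ k, W (r + 3) k ∧ (G k i).out₁ ≠ none := by
  classical
  have hcard := card_honest R.card
  have h0 : ∀ i ∈ H, ∃ v k, W r k ∧ (G k i).inp = some v ∧ .echo₁ (some v) ∈ (G k i).sent := by
    intro i hi
    obtain ⟨k, hk, hne⟩ := hin i hi
    obtain ⟨v, hv⟩ := Option.ne_none_iff_exists'.1 hne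
    obtain ⟨k', hkk, hk', hq⟩ := hW.quiet r k hk i hi
    have hv' := (R.le hkk hi).inp v hv
    exact ⟨v, k', hk', hv', by_contra fun hc => hq _ (.echoInput _ v hv' hc)⟩
  choose! v k hk hv hs using h0
  -- Pigeonhole among at least `2 * t + 1` honest parties.
  obtain ⟨b, hb⟩ : ∃ b, t + 1 ≤ (H.filter fun i => v i = b).card := by
    by_contra! hc
    have h1 := hc true
    have h2 := hc false
    have h3 := Finset.card_filter_add_card_filter_not (s := H) (fun i => v i = true)
    simp only [Bool.not_eq_true] at h3
    omega
  -- After one round, those with the other input have heard `t + 1` deviating echoes. So every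
  -- honest party supports `b`, by an echo on `b` or on `⊥`. As in all liveness arguments, a rule
  -- that is enabled at a quiescent point must already have been applied.
  have h1 : ∀ i ∈ H, ∃ k', W (r + 1) k' ∧ k i ≤ k' ∧
      (.echo₁ none ∈ (G k' i).sent ∨ .echo₁ (some b) ∈ (G k' i).sent) := by
    intro i hi
    by_cases hvi : v i = b
    · exact ⟨k i, hW.succ _ _ (hk i hi), le_rfl, .inr (hvi ▸ hs i hi)⟩
    · obtain ⟨k', hkk, hk', hq, hr⟩ := hW.settled (hk i hi) hi
      refine ⟨k', hk', hkk, .inl (by_contra fun hc => hq _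
        (.echoBot _ (v i) ((R.le hkk hi).inp _ (hv i hi)) hc (hb.trans (le_heard fun p hp => ?_))))⟩
      obtain ⟨hp, hpv⟩ := Finset.mem_filter.1 hp
      exact ⟨_, hr p hp (k p) (hk p hp) _ (hs p hp), _, rfl, fun e => hvi (by simp_all)⟩
  choose! k₁ hk₁ hkk₁ hs₁ using h1
  have h2 : ∀ i ∈ H, ∃ c k', W (r + 2) k' ∧ k i ≤ k' ∧ .prop₁ c ∈ (G k' i).sent := by
    intro i hi
    obtain ⟨k', hkk, hk', hq, hr⟩ := hW.settled (hk₁ i hi) hi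
    have hbW : b ∈ (G k' i).W₁ := by
      refine by_contra fun hc => hq _ (.addW₁ _ (v i) b ((R.le ((hkk₁ i hi).trans hkk) hi).inp _
        (hv i hi)) hc ((by omega : 2 * t + 1 ≤ H.card).trans (le_heard fun p hp => ?_)))
      rcases hs₁ p hp with h | h
      · exact ⟨_, hr p hp _ (hk₁ p hp) _ h, .inl rfl⟩
      · exact ⟨_, hr p hp _ (hk₁ p hp) _ h, .inr rfl⟩
    obtain ⟨c, hc⟩ := (R.good k' hi).W₁_prop₁ b hbW
    exact ⟨c, k', hk', (hkk₁ i hi).trans hkk, hc⟩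
  choose! c k₂ hk₂ hkk₂ hs₂ using h2
  intro i hi
  obtain ⟨k', hkk, hk', hq, hr⟩ := hW.settled (hk₂ i hi) hi
  have hinp := (R.le ((hkk₂ i hi).trans hkk) hi).inp _ (hv i hi)
  refine ⟨k', hk', ?_⟩
  by_cases hall : ∀ p ∈ H, c p = c i
  · intro hnone
    refine hq _ (.decide₁ _ (v i) (c i) hinp hnone (hcard.trans (le_heard fun p hp => ?_)))
    exact ⟨_, hr p hp _ (hk₂ p hp) _ (hs₂ p hp), by rw [hall p hp]⟩
  · push Not at hall
    obtain ⟨p, hp, hpc⟩ := hall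
    -- The proposer `q` had heard support for its bit from `2 * t + 1` parties. At least `t + 1` of
    -- them are honest, and they sent it before `q` proposed, so within one more round it has
    -- reached `i` too. With two different bits proposed, `V` fills up.
    have key : ∀ q ∈ H, c q ∈ (G k' i).V₁ := by
      intro q hq'
      obtain ⟨S, hS, hSc, hSm⟩ := exists_honest_senders (a := t + 1) R.card
        (by have := (R.good _ hq').W₁ _ ((R.good _ hq').prop₁_W₁ _ (hs₂ q hq')); linarith)
      refine by_contra fun hc => hq _ (.addV₁ _ (v i) _ hinp hc
        (hSc.trans (le_heard fun x hx => ?_)))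
      obtain ⟨m, hm, hP⟩ := hSm x hx
      obtain ⟨l, hl, hms⟩ := R.sent_of_recv hq' (hS hx) hm
      exact ⟨m, hr x (hS hx) _ (hk₂ q hq') _ ((R.le hl.le (hS hx)).sent hms), hP⟩
    refine (R.good k' hi).V₁_univ (Finset.eq_univ_iff_forall.2 fun d => ?_)
    have h1 := key p hp
    have h2 := key i hi
    generalize c p = x at *
    generalize c i = y at *
    cases d <;> cases x <;> cases y <;> simp_all

/-- The proposal protocol takes 3 rounds. -/
theorem out₂_live (R : GCRun t H G) (ht : 3 * t < n) (hW : IsPaced t H G W) {r : ℕ}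
    (hin : ∀ i ∈ H, ∃ k, W r k ∧ (G k i).out₁ ≠ none) :
    ∀ i ∈ H, ∃ k, W (r + 3) k ∧ (G k i).out₂ ≠ none := by
  classical
  have hcard := card_honest R.card
  have h0 : ∀ i ∈ H, ∃ v x k, W r k ∧ (G k i).inp = some v ∧ (G k i).out₁ = some x ∧
      .echo₂ x ∈ (G k i).sent := by
    intro i hi
    obtain ⟨k, hk, hne⟩ := hin i hi
    obtain ⟨x, hx⟩ := Option.ne_none_iff_exists'.1 hne
    obtain ⟨k', hkk, hk', hq⟩ := hW.quiet r k hk i hi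
    have hx' := (R.le hkk hi).out₁ x hx
    obtain ⟨v, hv⟩ : ∃ v, (G k' i).inp = some v := by
      cases x with
      | none => exact ((R.good k' hi).out₁_none hx').imp fun v h => h.1
      | some b => exact ⟨b, ((R.good k' hi).out₁_some b hx').1⟩
    exact ⟨v, x, k', hk', hv, hx', by_contra fun hc => hq _ (.echoOut₁ _ x hx' hc)⟩
  choose! v x k hk hv hx hs using h0
  -- Pigeonhole again: by `out₁_agree`, the honest outputs of 1-graded consensus take at most two
  -- values, `⊥` and one bit.
  obtain ⟨y, hy⟩ : ∃ y, t + 1 ≤ (H.filter fun i => x i = y).card := by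
    by_contra! hc
    have h1 := hc none
    have h3 := Finset.card_filter_add_card_filter_not (s := H) (fun i => x i = none)
    obtain ⟨i, hi⟩ : (H.filter fun i => ¬ x i = none).Nonempty :=
      Finset.card_pos.1 (by omega)
    obtain ⟨hi, hxi⟩ := Finset.mem_filter.1 hi
    obtain ⟨b, hb⟩ := Option.ne_none_iff_exists'.1 hxi
    have h2 := hc (some b)
    have h4 : (H.filter fun i => ¬ x i = none) ⊆ H.filter fun i => x i = some b := by
      intro p hp
      obtain ⟨hp, hxp⟩ := Finset.mem_filter.1 hp
      obtain ⟨b', hb'⟩ := Option.ne_none_iff_exists'.1 hxp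
      rw [Finset.mem_filter, hb']
      exact ⟨hp, congrArg some (R.out₁_agree ht hp hi (hb' ▸ hx p hp) (hb ▸ hx i hi))⟩
    have h5 := Finset.card_le_card h4
    omega
  have h1 : ∀ i ∈ H, ∃ k', W (r + 1) k' ∧ k i ≤ k' ∧ .echo₂ y ∈ (G k' i).sent := by
    intro i hi
    obtain ⟨k', hkk, hk', hq, hr⟩ := hW.settled (hk i hi) hi
    refine ⟨k', hk', hkk, ((R.good k' hi).V₂ y (by_contra fun hc => hq _ (.addV₂ _ (v i) y
      ((R.le hkk hi).inp _ (hv i hi)) hc (hy.trans (le_heard fun p hp => ?_))))).1⟩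
    obtain ⟨hp, hpv⟩ := Finset.mem_filter.1 hp
    exact ⟨_, hr p hp (k p) (hk p hp) _ (hs p hp), by rw [hpv]⟩
  choose! k₁ hk₁ hkk₁ hs₁ using h1
  have h2 : ∀ i ∈ H, ∃ c k', W (r + 2) k' ∧ k i ≤ k' ∧ .prop₂ c ∈ (G k' i).sent := by
    intro i hi
    obtain ⟨k', hkk, hk', hq, hr⟩ := hW.settled (hk₁ i hi) hi
    obtain ⟨c, hc⟩ : ∃ c, .prop₂ c ∈ (G k' i).sent := by
      by_contra! hc
      refine hq _ (.propose₂ _ (v i) y ((R.le ((hkk₁ i hi).trans hkk) hi).inp _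
        (hv i hi)) hc ((by omega : 2 * t + 1 ≤ H.card).trans (le_heard fun p hp => ?_)))
      exact ⟨_, hr p hp _ (hk₁ p hp) _ (hs₁ p hp), rfl⟩
    exact ⟨c, k', hk', (hkk₁ i hi).trans hkk, hc⟩
  choose! c k₂ hk₂ hkk₂ hs₂ using h2
  intro i hi
  obtain ⟨k', hkk, hk', hq, hr⟩ := hW.settled (hk₂ i hi) hi
  have hinp := (R.le ((hkk₂ i hi).trans hkk) hi).inp _ (hv i hi)
  refine ⟨k', hk', ?_⟩
  by_cases hall : ∀ p ∈ H, c p = c i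
  · intro hnone
    refine hq _ (.decide₂ _ (v i) (c i) hinp hnone (hcard.trans (le_heard fun p hp => ?_)))
    exact ⟨_, hr p hp _ (hk₂ p hp) _ (hs₂ p hp), by rw [hall p hp]⟩
  · push Not at hall
    obtain ⟨p, hp, hpc⟩ := hall
    -- As in 1-graded consensus: the honest echoes behind each proposal reach everybody one round
    -- later, so two different proposals give `V` two elements.
    have key : ∀ q ∈ H, c q ∈ (G k' i).V₂ := by
      intro q hq'
      obtain ⟨S, hS, hSc, hSm⟩ := exists_honest_senders (a := t + 1) R.card
        (by have := (R.good _ hq').prop₂ _ (hs₂ q hq'); linarith)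
      refine by_contra fun hc => hq _ (.addV₂ _ (v i) _ hinp hc
        (hSc.trans (le_heard fun x hx => ?_)))
      obtain ⟨m, hm, hP⟩ := hSm x hx
      obtain ⟨l, hl, hms⟩ := R.sent_of_recv hq' (hS hx) hm
      exact ⟨m, hr x (hS hx) _ (hk₂ q hq') _ ((R.le hl.le (hS hx)).sent hms), hP⟩
    exact (R.good k' hi).V₂_card (Finset.one_lt_card.2 ⟨_, key p hp, _, key i hi, hpc⟩)

/-- 2-graded consensus takes 6 rounds. -/
theorem out_live (R : GCRun t H G) (ht : 3 * t < n) (hW : IsPaced t H G W) {r : ℕ}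
    (hin : ∀ i ∈ H, ∃ k, W r k ∧ (G k i).inp ≠ none) :
    ∀ i ∈ H, ∃ k, W (r + 6) k ∧ ∃ o, (G k i).out = some o := fun i hi =>
  let ⟨k, hk, h⟩ := R.out₂_live ht hW (R.out₁_live ht hW hin) i hi
  ⟨k, hk, R.out_ne_none ht hi h⟩

end GCRun

/-! ### Local invariants of the edge agreement protocols -/

namespace TCInput

/-- The input of `TC (l + 1)` to 2-graded consensus. -/
def bit (y : TCInput) : Bool :=
  match y.T, y.a with
  | none, some _ => false
  | none, none => true
  | some (lo, hi), some a => if OnPath y.v (centralSubtree lo hi a false) then false else true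
  | some _, none => true

/-- The input `x` that `TC (l + 1)` with the input `y` gives to `TC l`, where `o` is the output
register of 2-graded consensus. -/
def Next (y : TCInput) (o : Option (Option Bool × ℕ)) (x : TCInput) : Prop :=
  (y.T = none ∧ x = ⟨y.v, none, none, y.a.or y.b⟩) ∨
  ∃ lo hi a, y.T = some (lo, hi) ∧ y.a = some a ∧
    ((o = some (none, 0) ∧ x = ⟨pathCenter lo hi, none, some (pathCenter lo hi), none⟩) ∨
      ∃ k g, o = some (some k, g) ∧
        x = ⟨if g = 2 ∧ OnPath y.v (centralSubtree lo hi a k) then y.v else pathCenter lo hi,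
          some (centralSubtree lo hi a k), some (pathCenter lo hi),
          if k = false then some a else y.b⟩)

/-- `TC (l + 1)` with the input `y` outputs `z` without an output from `TC l`, where `o` is the
output register of 2-graded consensus. -/
def Direct (y : TCInput) (o : Option (Option Bool × ℕ)) (z : ℕ) : Prop :=
  (y.T = none ∧ y.a.or y.b = some z) ∨
  ∃ lo hi a, y.T = some (lo, hi) ∧ y.a = some a ∧ o = some (none, 0) ∧ z = pathCenter lo hi

end TCInput

namespace PState

variable {n : ℕ}

/-- The state `s'` arises from `s` by setting registers and adding elements to sets. -/
structure Le (s s' : PState n) : Prop where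
  gc : ∀ id, (s.gc id).Le (s'.gc id)
  tc_inp : ∀ m l x, (s.tc m l).inp = some x → (s'.tc m l).inp = some x
  tc_out : ∀ m l y, (s.tc m l).out = some y → (s'.tc m l).out = some y
  exp_inp : ∀ m v, (s.exp m).inp = some v → (s'.exp m).inp = some v
  exp_recv : ∀ m p, (s.exp m).recv p ⊆ (s'.exp m).recv p
  exp_sent : ∀ m, (s.exp m).sent ⊆ (s'.exp m).sent
  exp_next : ∀ m w, (s.exp m).next = some w → (s'.exp m).next = some w
  exp_side : ∀ m k, (s.exp m).side = some k → (s'.exp m).side = some k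
  exp_out : ∀ m y, (s.exp m).out = some y → (s'.exp m).out = some y

theorem Le.rfl {s : PState n} : s.Le s := by constructor <;> simp [GCState.Le.rfl]

theorem Le.trans {s s' s'' : PState n} (h : s.Le s') (h' : s'.Le s'') : s.Le s'' where
  gc id := (h.gc id).trans (h'.gc id)
  tc_inp m l x hx := h'.tc_inp m l x (h.tc_inp m l x hx)
  tc_out m l x hx := h'.tc_out m l x (h.tc_out m l x hx)
  exp_inp m x hx := h'.exp_inp m x (h.exp_inp m x hx)
  exp_recv m p := (h.exp_recv m p).trans (h'.exp_recv m p)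
  exp_sent m := (h.exp_sent m).trans (h'.exp_sent m)
  exp_next m x hx := h'.exp_next m x (h.exp_next m x hx)
  exp_side m x hx := h'.exp_side m x (h.exp_side m x hx)
  exp_out m x hx := h'.exp_out m x (h.exp_out m x hx)

/-- How the value `v_next` of `Exp m` arises from the input `u` and the output `o` of 2-graded
consensus. -/
def NextOf (s : PState n) (m u w : ℕ) (o : Option Bool × ℕ) : Prop :=
  (o = (some false, 2) ∧ w = min u (2 ^ (m + 1) - 1) ∧ (s.exp m).side = some false) ∨
  (o = (some true, 2) ∧ w = max u (2 ^ (m + 1) - 1) ∧ (s.exp m).side = some true) ∨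
  (∃ k, o = (some k, 1) ∧ w = 2 ^ (m + 1) - 1 ∧ (s.exp m).side = some k ∧
    .side k ∈ (s.exp m).sent) ∨
  (o = (none, 0) ∧ w = 2 ^ (m + 1) - 1 ∧ .center ∈ (s.exp m).sent ∧ (s.exp m).out ≠ none)

/-- How an output of `Exp m` arises. -/
def OutOf (t : ℕ) (s : PState n) (m y : ℕ) : Prop :=
  (y = 2 ^ (m + 1) - 1 ∧ (s.gc (.exp m)).out = some (none, 0)) ∨
  (y = 2 ^ (m + 1) - 1 ∧ t + 1 ≤ heard (s.exp m).recv (fun c => c = ExpMsg.center)) ∨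
  ((s.exp m).side = some false ∧ (s.tc m m).out = some y) ∨
  ((s.exp m).side = some true ∧ (s.exp (m + 1)).out = some y)

/-- The origins of the contents of the registers of a party that runs `Exp j` with the input
`v`. -/
structure Good (t j : ℕ) (leaf : ℕ → ℕ) (v : ℕ) (s : PState n) : Prop where
  gc : ∀ id, (s.gc id).Good t
  tc_gt : ∀ m l x, (s.tc m l).inp = some x → l ≤ m
  tc_top : ∀ m x, (s.tc m m).inp = some x → ∃ w, (s.exp m).next = some w ∧
    (s.exp m).side = some false ∧
    x = ⟨w, some (2 ^ m - 1, 2 ^ (m + 1) - 1), some (leaf m), none⟩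
  tc_down : ∀ m l x, l < m → (s.tc m l).inp = some x → ∃ y, (s.tc m (l + 1)).inp = some y ∧
    (s.gc (.tc m (l + 1))).inp ≠ none ∧ y.Next (s.gc (.tc m (l + 1))).out x
  gc_tc : ∀ m l b, (s.gc (.tc m (l + 1))).inp = some b → ∃ y, (s.tc m (l + 1)).inp = some y ∧
    b = y.bit ∧ (y.T = none → (s.tc m l).inp ≠ none)
  tc_out_zero : ∀ m y, (s.tc m 0).out = some y → ∃ x, (s.tc m 0).inp = some x ∧ y = x.v
  tc_out_succ : ∀ m l y, (s.tc m (l + 1)).out = some y → ∃ x, (s.tc m (l + 1)).inp = some x ∧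
    ((s.tc m l).out = some y ∨ x.Direct (s.gc (.tc m (l + 1))).out y)
  gc_exp : ∀ m b, (s.gc (.exp m)).inp = some b → ∃ u, (s.exp m).inp = some u ∧
    b = if u < 2 ^ (m + 1) then false else true
  exp_next : ∀ m w, (s.exp m).next = some w → ∃ u o, (s.exp m).inp = some u ∧
    (s.gc (.exp m)).out = some o ∧ s.NextOf m u w o
  exp_side : ∀ m k, (s.exp m).side = some k → (s.exp m).next ≠ none ∧
    ((∃ g, (s.gc (.exp m)).out = some (some k, g)) ∨
      t + 1 ≤ heard (s.exp m).recv (fun c => c = ExpMsg.side k))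
  exp_sent_side : ∀ m k, .side k ∈ (s.exp m).sent → (s.gc (.exp m)).out = some (some k, 1)
  exp_sent_center : ∀ m, .center ∈ (s.exp m).sent → (s.gc (.exp m)).out = some (none, 0)
  exp_inp : ∀ m w, (s.exp m).inp = some w → j ≤ m ∧ (m = j → w = v) ∧
    ∀ m', m = m' + 1 → j ≤ m' → (s.exp m').next = some w ∧ (s.exp m').side = some true
  exp_out : ∀ m y, (s.exp m).out = some y → s.OutOf t m y

theorem good_initial (t j : ℕ) (leaf : ℕ → ℕ) (v : ℕ) : (initial n).Good t j leaf v := by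
  constructor <;> simp [initial, ExpState.initial, GCState.good_initial] <;>
    simp [GCState.initial]

theorem NextOf.mono {s s' : PState n} (h : s.Le s') {m u w : ℕ} {o : Option Bool × ℕ}
    (hn : s.NextOf m u w o) : s'.NextOf m u w o := by
  rcases hn with ⟨a, b, c⟩ | ⟨a, b, c⟩ | ⟨k, a, b, c, d⟩ | ⟨a, b, c, d⟩
  · exact .inl ⟨a, b, h.exp_side _ _ c⟩
  · exact .inr (.inl ⟨a, b, h.exp_side _ _ c⟩)
  · exact .inr (.inr (.inl ⟨k, a, b, h.exp_side _ _ c, h.exp_sent _ d⟩))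
  · obtain ⟨y, hy⟩ := Option.ne_none_iff_exists'.1 d
    exact .inr (.inr (.inr ⟨a, b, h.exp_sent _ c, by simp [h.exp_out _ _ hy]⟩))

theorem OutOf.mono {t : ℕ} {s s' : PState n} (h : s.Le s') {m y : ℕ} (hn : s.OutOf t m y) :
    s'.OutOf t m y := by
  rcases hn with ⟨a, b⟩ | ⟨a, b⟩ | ⟨a, b⟩ | ⟨a, b⟩
  · exact .inl ⟨a, (h.gc _).out b⟩
  · exact .inr (.inl ⟨a, b.trans (heard_mono (h.exp_recv m) fun _ => id)⟩)
  · exact .inr (.inr (.inl ⟨h.exp_side _ _ a, h.tc_out _ _ _ b⟩))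
  · exact .inr (.inr (.inr ⟨h.exp_side _ _ a, h.exp_out _ _ b⟩))

end PState

theorem TCInput.Next.mono {s s' : GCState n} (h : s.Le s') {x y : TCInput}
    (hn : y.Next s.out x) : y.Next s'.out x := by
  rcases hn with hn | ⟨lo, hi, a, hT, ha, ⟨ho, e⟩ | ⟨k, g, ho, e⟩⟩
  · exact .inl hn
  · exact .inr ⟨lo, hi, a, hT, ha, .inl ⟨h.out ho, e⟩⟩
  · exact .inr ⟨lo, hi, a, hT, ha, .inr ⟨k, g, h.out ho, e⟩⟩

theorem TCInput.Direct.mono {s s' : GCState n} (h : s.Le s') {x : TCInput} {y : ℕ}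
    (hn : x.Direct s.out y) : x.Direct s'.out y := by
  rcases hn with hn | ⟨lo, hi, a, hT, ha, ho, e⟩
  · exact .inl hn
  · exact .inr ⟨lo, hi, a, hT, ha, h.out ho, e⟩

theorem Option.persist {α : Type*} {o o' : Option α} (h : ∀ x, o = some x → o' = some x)
    (ho : o ≠ none) : o' ≠ none := by
  obtain ⟨x, hx⟩ := Option.ne_none_iff_exists'.1 ho
  simp [h x hx]

namespace PState

variable {n t j : ℕ} {leaf : ℕ → ℕ} {v : ℕ} {s s' : PState n}

/-- To keep the local invariants, it suffices that whatever is new in a register has a proper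
origin. -/
theorem Good.of_le (g : s.Good t j leaf v) (h : s.Le s')
    (gc : ∀ id, (s'.gc id).Good t)
    (tc_inp : ∀ m l x, (s'.tc m l).inp = some x → (s.tc m l).inp = some x ∨
      (l = m ∧ ∃ w, (s.exp m).next = some w ∧ (s.exp m).side = some false ∧
        x = ⟨w, some (2 ^ m - 1, 2 ^ (m + 1) - 1), some (leaf m), none⟩) ∨
      ∃ y, (s.tc m (l + 1)).inp = some y ∧ (s'.gc (.tc m (l + 1))).inp ≠ none ∧
        y.Next (s.gc (.tc m (l + 1))).out x)
    (gc_tc : ∀ m l b, (s'.gc (.tc m (l + 1))).inp = some b →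
      (s.gc (.tc m (l + 1))).inp = some b ∨ ∃ y, (s.tc m (l + 1)).inp = some y ∧
        b = y.bit ∧ (y.T = none → (s'.tc m l).inp ≠ none))
    (tc_out_zero : ∀ m y, (s'.tc m 0).out = some y → (s.tc m 0).out = some y ∨
      ∃ x, (s.tc m 0).inp = some x ∧ y = x.v)
    (tc_out_succ : ∀ m l y, (s'.tc m (l + 1)).out = some y → (s.tc m (l + 1)).out = some y ∨
      ∃ x, (s.tc m (l + 1)).inp = some x ∧
        ((s.tc m l).out = some y ∨ x.Direct (s.gc (.tc m (l + 1))).out y))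
    (gc_exp : ∀ m b, (s'.gc (.exp m)).inp = some b → (s.gc (.exp m)).inp = some b ∨
      ∃ u, (s.exp m).inp = some u ∧ b = if u < 2 ^ (m + 1) then false else true)
    (exp_next : ∀ m w, (s'.exp m).next = some w → (s.exp m).next = some w ∨
      ∃ u o, (s.exp m).inp = some u ∧ (s.gc (.exp m)).out = some o ∧ s'.NextOf m u w o)
    (exp_side : ∀ m k, (s'.exp m).side = some k → (s.exp m).side = some k ∨
      (s'.exp m).next ≠ none ∧ ((∃ g, (s.gc (.exp m)).out = some (some k, g)) ∨
        t + 1 ≤ heard (s.exp m).recv (fun c => c = ExpMsg.side k)))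
    (exp_sent_side : ∀ m k, .side k ∈ (s'.exp m).sent → .side k ∈ (s.exp m).sent ∨
      (s.gc (.exp m)).out = some (some k, 1))
    (exp_sent_center : ∀ m, .center ∈ (s'.exp m).sent → .center ∈ (s.exp m).sent ∨
      (s.gc (.exp m)).out = some (none, 0))
    (exp_inp : ∀ m w, (s'.exp m).inp = some w → (s.exp m).inp = some w ∨ (m = j ∧ w = v) ∨
      ∃ m', m = m' + 1 ∧ (s.exp m').next = some w ∧ (s.exp m').side = some true)
    (exp_out : ∀ m y, (s'.exp m).out = some y → (s.exp m).out = some y ∨ s.OutOf t m y) :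
    s'.Good t j leaf v where
  gc := gc
  tc_gt m l x hx := by
    rcases tc_inp m l x hx with h1 | ⟨rfl, -⟩ | ⟨y, hy, -⟩
    · exact g.tc_gt m l x h1
    · exact le_rfl
    · exact (Nat.le_succ l).trans (g.tc_gt m _ y hy)
  tc_top m x hx := by
    have key : ∃ w, (s.exp m).next = some w ∧ (s.exp m).side = some false ∧
        x = ⟨w, some (2 ^ m - 1, 2 ^ (m + 1) - 1), some (leaf m), none⟩ := by
      rcases tc_inp m m x hx with h1 | ⟨-, h1⟩ | ⟨y, hy, -⟩
      · exact g.tc_top m x h1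
      · exact h1
      · exact absurd (g.tc_gt m _ y hy) (by omega)
    obtain ⟨w, h1, h2, h3⟩ := key
    exact ⟨w, h.exp_next _ _ h1, h.exp_side _ _ h2, h3⟩
  tc_down m l x hl hx := by
    rcases tc_inp m l x hx with h1 | ⟨rfl, -⟩ | ⟨y, hy, hg, hn⟩
    · obtain ⟨y, hy, hg, hn⟩ := g.tc_down m l x hl h1
      exact ⟨y, h.tc_inp _ _ _ hy, Option.persist (h.gc _).inp hg, hn.mono (h.gc _)⟩
    · omega
    · exact ⟨y, h.tc_inp _ _ _ hy, hg, hn.mono (h.gc _)⟩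
  gc_tc m l b hb := by
    rcases gc_tc m l b hb with h1 | ⟨y, hy, e, hT⟩
    · obtain ⟨y, hy, e, hT⟩ := g.gc_tc m l b h1
      exact ⟨y, h.tc_inp _ _ _ hy, e, fun hy => Option.persist (h.tc_inp _ _) (hT hy)⟩
    · exact ⟨y, h.tc_inp _ _ _ hy, e, hT⟩
  tc_out_zero m y hy := by
    obtain ⟨x, hx, e⟩ := (tc_out_zero m y hy).elim (g.tc_out_zero m y) id
    exact ⟨x, h.tc_inp _ _ _ hx, e⟩
  tc_out_succ m l y hy := by
    obtain ⟨x, hx, e⟩ := (tc_out_succ m l y hy).elim (g.tc_out_succ m l y) id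
    exact ⟨x, h.tc_inp _ _ _ hx, e.imp (h.tc_out _ _ _) fun e => e.mono (h.gc _)⟩
  gc_exp m b hb := by
    obtain ⟨x, hx, e⟩ := (gc_exp m b hb).elim (g.gc_exp m b) id
    exact ⟨x, h.exp_inp _ _ hx, e⟩
  exp_next m w hw := by
    rcases exp_next m w hw with h1 | ⟨u, o, hu, ho, hn⟩
    · obtain ⟨u, o, hu, ho, hn⟩ := g.exp_next m w h1
      exact ⟨u, o, h.exp_inp _ _ hu, (h.gc _).out ho, hn.mono h⟩
    · exact ⟨u, o, h.exp_inp _ _ hu, (h.gc _).out ho, hn⟩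
  exp_side m k hk := by
    have key : (s'.exp m).next ≠ none ∧ ((∃ g, (s.gc (.exp m)).out = some (some k, g)) ∨
        t + 1 ≤ heard (s.exp m).recv (fun c => c = ExpMsg.side k)) := by
      rcases exp_side m k hk with h1 | h1
      · exact ⟨Option.persist (h.exp_next m) (g.exp_side m k h1).1, (g.exp_side m k h1).2⟩
      · exact h1
    exact ⟨key.1, key.2.imp (fun ⟨g, hg⟩ => ⟨g, (h.gc _).out hg⟩)
      fun hh => hh.trans (heard_mono (h.exp_recv m) fun _ => id)⟩
  exp_sent_side m k hk :=
    (h.gc _).out ((exp_sent_side m k hk).elim (g.exp_sent_side m k) id)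
  exp_sent_center m hm :=
    (h.gc _).out ((exp_sent_center m hm).elim (g.exp_sent_center m) id)
  exp_inp m w hw := by
    have key : j ≤ m ∧ (m = j → w = v) ∧
        ∀ m', m = m' + 1 → j ≤ m' → (s.exp m').next = some w ∧ (s.exp m').side = some true := by
      rcases exp_inp m w hw with h1 | ⟨rfl, rfl⟩ | ⟨m', rfl, h1, h2⟩
      · exact g.exp_inp m w h1
      · exact ⟨le_rfl, fun _ => rfl, fun m' _ _ => by omega⟩
      · obtain ⟨u, o, hu, -⟩ := g.exp_next m' w h1
        have := (g.exp_inp m' u hu).1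
        refine ⟨by omega, fun _ => by omega, fun m'' e _ => ?_⟩
        obtain rfl : m' = m'' := by omega
        exact ⟨h1, h2⟩
    exact ⟨key.1, key.2.1, fun m' e hm => ⟨h.exp_next _ _ (key.2.2 m' e hm).1,
      h.exp_side _ _ (key.2.2 m' e hm).2⟩⟩
  exp_out m y hy := ((exp_out m y hy).elim (g.exp_out m y) id).mono h

end PState

/-! ### Moves keep the local invariants -/

namespace PState

variable {n : ℕ} (s : PState n)

section Projections

variable (id id' : GCId) (m m' l l' w : ℕ) (b : Bool) (x : TCInput) (y : Option ℕ)
  (g : GCState n) (e : ExpState n)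

@[simp] theorem setGC_gc : (s.setGC id g).gc id' = if id' = id then g else s.gc id' := by
  simp [setGC, Function.update_apply]
@[simp] theorem setGC_tc : (s.setGC id g).tc = s.tc := rfl
@[simp] theorem setGC_exp : (s.setGC id g).exp = s.exp := rfl

@[simp] theorem inputGC_gc : (s.inputGC id b).gc id' =
    if id' = id then { s.gc id with inp := some b } else s.gc id' := by
  simp [inputGC]
@[simp] theorem inputGC_tc : (s.inputGC id b).tc = s.tc := rfl
@[simp] theorem inputGC_exp : (s.inputGC id b).exp = s.exp := rfl

@[simp] theorem inputTC_gc : (s.inputTC m l x).gc = s.gc := rfl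
@[simp] theorem inputTC_tc_inp : ((s.inputTC m l x).tc m' l').inp =
    if m' = m ∧ l' = l then some x else (s.tc m' l').inp := by
  by_cases hm : m' = m
  · subst hm
    by_cases hl : l' = l
    · subst hl; simp [inputTC, setTC]
    · simp [inputTC, setTC, hl]
  · simp [inputTC, setTC, hm]
@[simp] theorem inputTC_tc_out : ((s.inputTC m l x).tc m' l').out = (s.tc m' l').out := by
  by_cases hm : m' = m
  · subst hm
    by_cases hl : l' = l
    · subst hl; simp [inputTC, setTC]
    · simp [inputTC, setTC, hl]
  · simp [inputTC, setTC, hm]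
@[simp] theorem inputTC_exp : (s.inputTC m l x).exp = s.exp := rfl

@[simp] theorem outputTC_gc : (s.outputTC m l y).gc = s.gc := rfl
@[simp] theorem outputTC_tc_inp : ((s.outputTC m l y).tc m' l').inp = (s.tc m' l').inp := by
  by_cases hm : m' = m
  · subst hm
    by_cases hl : l' = l
    · subst hl; simp [outputTC, setTC]
    · simp [outputTC, setTC, hl]
  · simp [outputTC, setTC, hm]
@[simp] theorem outputTC_tc_out : ((s.outputTC m l y).tc m' l').out =
    if m' = m ∧ l' = l then (s.tc m l).out.or y else (s.tc m' l').out := by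
  by_cases hm : m' = m
  · subst hm
    by_cases hl : l' = l
    · subst hl; simp [outputTC, setTC]
    · simp [outputTC, setTC, hl]
  · simp [outputTC, setTC, hm]
@[simp] theorem outputTC_exp : (s.outputTC m l y).exp = s.exp := rfl

@[simp] theorem setExp_gc : (s.setExp m e).gc = s.gc := rfl
@[simp] theorem setExp_tc : (s.setExp m e).tc = s.tc := rfl
@[simp] theorem setExp_exp : (s.setExp m e).exp m' = if m' = m then e else s.exp m' := by
  simp [setExp, Function.update_apply]

@[simp] theorem inputExp_gc : (s.inputExp m w).gc = s.gc := rfl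
@[simp] theorem inputExp_tc : (s.inputExp m w).tc = s.tc := rfl
@[simp] theorem inputExp_exp : (s.inputExp m w).exp m' =
    if m' = m then { s.exp m with inp := some w } else s.exp m' := by
  simp [inputExp]

@[simp] theorem outputExp_gc : (s.outputExp m w).gc = s.gc := rfl
@[simp] theorem outputExp_tc : (s.outputExp m w).tc = s.tc := rfl
@[simp] theorem outputExp_exp : (s.outputExp m w).exp m' =
    if m' = m then { s.exp m with out := (s.exp m).out.or (some w) } else s.exp m' := by
  simp [outputExp]

end Projections

variable {s} {t j : ℕ} {leaf : ℕ → ℕ} {v : ℕ}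

theorem Good.gc_out_ne (g : s.Good t j leaf v) {id : GCId} {o : Option Bool × ℕ}
    (ho : (s.gc id).out = some o) : (s.gc id).inp ≠ none := by
  obtain ⟨Y, hY, -⟩ := Option.bind_eq_some_iff.1 ho
  exact ((g.gc id).out₂ Y hY).1

theorem le_inputGC {id : GCId} (h : (s.gc id).inp = none) (b : Bool) :
    s.Le (s.inputGC id b) := by
  refine ⟨fun id' => ?_, ?_, ?_, ?_, ?_, ?_, ?_, ?_, ?_⟩ <;> try simp
  split_ifs with e
  · subst e; constructor <;> simp [h]
  · exact .rfl

theorem le_inputTC {m l : ℕ} (h : (s.tc m l).inp = none) (x : TCInput) :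
    s.Le (s.inputTC m l x) := by
  refine ⟨?_, ?_, ?_, ?_, ?_, ?_, ?_, ?_, ?_⟩ <;> simp [GCState.Le.rfl]
  grind

theorem le_outputTC (m l : ℕ) (y : Option ℕ) : s.Le (s.outputTC m l y) := by
  refine ⟨?_, ?_, ?_, ?_, ?_, ?_, ?_, ?_, ?_⟩ <;> simp [GCState.Le.rfl]
  grind [Option.or_eq_some_iff]

theorem le_inputExp {m : ℕ} (h : (s.exp m).inp = none) (w : ℕ) : s.Le (s.inputExp m w) := by
  refine ⟨?_, ?_, ?_, ?_, ?_, ?_, ?_, ?_, ?_⟩ <;> simp [GCState.Le.rfl] <;> grind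

theorem le_outputExp (m y : ℕ) : s.Le (s.outputExp m y) := by
  refine ⟨?_, ?_, ?_, ?_, ?_, ?_, ?_, ?_, ?_⟩ <;> simp [GCState.Le.rfl] <;>
    grind [Option.or_eq_some_iff]

theorem _root_.TCStep.le {m : ℕ} {s' : PState n} (h : TCStep m s s') (g : s.Good t j leaf v) :
    s.Le s' := by
  -- The rules for `T = ⊥` write the input of `TC l` without testing that it is dormant. It is,
  -- because `TC l` never has an input before the 2-graded consensus of `TC (l + 1)` has one.
  have inp_none : ∀ l y, (s.tc m (l + 1)).inp = some y → (s.gc (.tc m (l + 1))).inp = none →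
      ∀ b, ((s.inputGC (.tc m (l + 1)) b).tc m l).inp = none := by
    intro l y hy hg b
    by_contra hc
    obtain ⟨x, hx⟩ := Option.ne_none_iff_exists'.1 hc
    obtain ⟨-, -, h, -⟩ := g.tc_down m l x (g.tc_gt m _ y hy) hx
    exact h hg
  cases h with
  | base x hx ho => exact le_outputTC _ _ _
  | inputA l v a b hx hg =>
    exact (le_inputGC hg _).trans ((le_inputTC (inp_none l _ hx hg _) _).trans (le_outputTC _ _ _))
  | inputB l v b hx hg =>
    exact (le_inputGC hg _).trans ((le_inputTC (inp_none l _ hx hg _) _).trans (le_outputTC _ _ _))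
  | inputT l v lo hi a b hx hg => exact le_inputGC hg _
  | grade0 l v lo hi a b hx hg hl => exact (le_inputTC hl _).trans (le_outputTC _ _ _)
  | gradePos l v lo hi a g b k hx hg hl => exact le_inputTC hl _
  | inner l y x hx hl ho => exact le_outputTC _ _ _

theorem _root_.ExpStep.le {m : ℕ} {s' : PState n} (h : ExpStep t leaf m s s')
    (g : s.Good t j leaf v) : s.Le s' := by
  -- Most rules that set `next` write `side` as well; nothing is overwritten, since `side` is never
  -- set before `next`.
  have side_none : (s.exp m).next = none → (s.exp m).side = none := by
    intro h
    by_contra hc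
    obtain ⟨k, hk⟩ := Option.ne_none_iff_exists'.1 hc
    exact (g.exp_side m k hk).1 h
  cases h with
  | inputGC v hv hg => exact le_inputGC hg _
  | runTC w hw hs hi => exact le_inputTC hi _
  | runExp w hw hs hi => exact le_inputExp hi _
  | outLeft k g y hs hg h1 ht ho => exact le_outputExp _ _
  | outRight k g y hs hg h1 ht ho => exact le_outputExp _ _
  | center v hv ho hh => exact le_outputExp _ _
  | _ =>
    refine ⟨?_, ?_, ?_, ?_, ?_, ?_, ?_, ?_, ?_⟩ <;> simp [GCState.Le.rfl] <;>
      grind [Option.or_eq_some_iff]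

theorem _root_.LocalStep.le {s' : PState n} (h : LocalStep t leaf s s')
    (g : s.Good t j leaf v) : s.Le s' := by
  cases h with
  | gc id c h =>
    refine ⟨?_, ?_, ?_, ?_, ?_, ?_, ?_, ?_, ?_⟩ <;> simp
    intro id'
    split_ifs with e
    · exact e ▸ h.le
    · exact .rfl
  | tc m _ h => exact h.le g
  | exp m _ h => exact h.le g

theorem _root_.TCStep.good {m : ℕ} {s' : PState n} (h : TCStep m s s')
    (g : s.Good t j leaf v) : s'.Good t j leaf v := by
  have hle := h.le g
  have inpGood : ∀ id b, (s.gc id).inp = none → ∀ id', ((s.inputGC id b).gc id').Good t := by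
    intro id b h id'
    rw [inputGC_gc]
    split_ifs with e
    · exact (g.gc id).input h b
    · exact g.gc id'
  have g' := g.gc
  have go := @g.gc_out_ne
  cases h <;> refine g.of_le hle ?_ ?_ ?_ ?_ ?_ ?_ ?_ ?_ ?_ ?_ ?_ ?_ <;>
    try simp only [inputGC_tc, inputGC_exp, inputTC_gc, inputTC_exp, outputTC_gc, outputTC_exp,
      outputTC_tc_inp, inputTC_tc_out]
  all_goals clear hle
  case inputA.refine_5 l v a b hx hg =>
    intro m₁ l₁ y h
    simp only [outputTC_tc_out, inputTC_tc_out, inputGC_tc] at h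
    split_ifs at h with e
    · obtain ⟨rfl, e⟩ := e
      obtain rfl : l₁ = l := by omega
      exact (Option.or_eq_some_iff.1 h).imp_right fun h => ⟨_, hx, .inr (.inl ⟨rfl, h.2⟩)⟩
    · exact .inl h
  case grade0.refine_5 l v lo hi a b hx hg hl =>
    intro m₁ l₁ y h
    simp only [outputTC_tc_out, inputTC_tc_out] at h
    split_ifs at h with e
    · obtain ⟨rfl, e⟩ := e
      obtain rfl : l₁ = l := by omega
      exact (Option.or_eq_some_iff.1 h).imp_right fun h => ⟨_, hx, .inr (.inr
        ⟨lo, hi, a, rfl, rfl, hg, (Option.some.inj h.2).symm⟩)⟩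
    · exact .inl h
  all_goals first
    | assumption
    | (intros; left; assumption)
    | (exact inpGood _ _ (by assumption))
    | (clear inpGood g' g; intros; simp at *
       grind [TCInput.Next, TCInput.Direct, TCInput.bit, Option.or_eq_some_iff])

theorem _root_.ExpStep.good {m : ℕ} {s' : PState n} (h : ExpStep t leaf m s s')
    (g : s.Good t j leaf v) : s'.Good t j leaf v := by
  have hle := h.le g
  have inpGood : ∀ id b, (s.gc id).inp = none → ∀ id', ((s.inputGC id b).gc id').Good t := by
    intro id b h id'
    rw [inputGC_gc]
    split_ifs with e
    · exact (g.gc id).input h b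
    · exact g.gc id'
  have g' := g.gc
  cases h <;> refine g.of_le hle ?_ ?_ ?_ ?_ ?_ ?_ ?_ ?_ ?_ ?_ ?_ ?_ <;>
    try simp only [inputGC_tc, inputGC_exp, inputTC_gc, inputTC_exp, inputTC_tc_out, setExp_gc,
      setExp_tc, inputExp_gc, inputExp_tc, outputExp_gc, outputExp_tc]
  all_goals clear hle
  all_goals first
    | assumption
    | (intros; left; assumption)
    | (exact inpGood _ _ (by assumption))
    | (clear inpGood g' g; intros; simp at *
       grind [NextOf, OutOf, Option.or_eq_some_iff])
    | skip
  case grade0.refine_12 u hu ho hn =>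
    intro m₁ y h
    rw [setExp_exp] at h
    split_ifs at h with e
    · subst e
      exact (Option.or_eq_some_iff.1 h).imp_right fun h => .inl ⟨(Option.some.inj h.2).symm, ho⟩
    · exact .inl h
  all_goals
    clear inpGood g' g
    intro m₁ w h
    rw [setExp_exp] at h
    split_ifs at h with e
    · subst e
      exact .inr ⟨_, _, by assumption, by assumption, by
        simp [NextOf, (Option.some.inj h).symm]⟩
    · exact .inl h

theorem _root_.LocalStep.good {s' : PState n} (h : LocalStep t leaf s s')
    (g : s.Good t j leaf v) : s'.Good t j leaf v := by
  have hle := h.le g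
  cases h with
  | gc id c h =>
    have hi : ∀ id' b, ((s.setGC id c).gc id').inp = some b → (s.gc id').inp = some b := by
      intro id' b
      rw [setGC_gc]
      split_ifs with e
      · rw [e, h.inp_eq]
        exact fun h => h
      · exact fun h => h
    refine g.of_le hle (fun id' => ?_) (fun _ _ _ h => .inl h) (fun m l b hb => .inl (hi _ _ hb))
      (fun _ _ h => .inl h) (fun _ _ _ h => .inl h) (fun m b hb => .inl (hi _ _ hb))
      (fun _ _ h => .inl h) (fun _ _ h => .inl h) (fun _ _ h => .inl h) (fun _ h => .inl h)
      (fun _ _ h => .inl h) (fun _ _ h => .inl h)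
    rw [setGC_gc]
    split_ifs with e
    · exact h.good (g.gc id)
    · exact g.gc id'
  | tc m _ h => exact h.good g
  | exp m _ h => exact h.good g

theorem le_receive (p : Fin n) (c : Msg) : s.Le (s.receive p c) := by
  cases c with
  | gc id c =>
    refine ⟨fun id' => ?_, ?_, ?_, ?_, ?_, ?_, ?_, ?_, ?_⟩ <;> simp [receive]
    split_ifs with e
    · subst e
      refine ⟨fun _ => _root_.id, fun q => ?_, subset_rfl, subset_rfl, subset_rfl,
        fun _ => _root_.id, subset_rfl, fun _ => _root_.id⟩
      by_cases hq : q = p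
      · subst hq; simp
      · simp [hq]
    · exact .rfl
  | exp m c =>
    refine ⟨?_, ?_, ?_, ?_, fun m' q => ?_, ?_, ?_, ?_, ?_⟩ <;>
      simp only [receive, setExp_exp, setExp_gc, setExp_tc]
    case refine_5 =>
      split_ifs with e
      · subst e
        by_cases hq : q = p
        · subst hq; simp
        · simp [hq]
      · exact subset_rfl
    case refine_1 => exact fun _ => .rfl
    all_goals grind

theorem Good.receive (g : s.Good t j leaf v) (p : Fin n) (c : Msg) :
    (s.receive p c).Good t j leaf v := by
  have hle := le_receive (s := s) p c
  cases c with
  | gc id c =>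
    refine g.of_le hle (fun id' => ?_) (fun _ _ _ h => .inl h) (fun m l b hb => .inl ?_)
      (fun _ _ h => .inl h) (fun _ _ _ h => .inl h) (fun m b hb => .inl ?_)
      (fun _ _ h => .inl h) (fun _ _ h => .inl h) (fun _ _ h => .inl h) (fun _ h => .inl h)
      (fun _ _ h => .inl h) (fun _ _ h => .inl h)
    · have := (hle.gc id').recv
      simp only [PState.receive, setGC_gc] at this ⊢
      split_ifs at this ⊢ with e
      · subst e
        exact (g.gc id').receive this
      · exact g.gc id'
    · simp only [PState.receive, setGC_gc] at hb
      split_ifs at hb with e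
      · rwa [e]
      · exact hb
    · simp only [PState.receive, setGC_gc] at hb
      split_ifs at hb with e
      · rwa [e]
      · exact hb
  | exp m c =>
    refine g.of_le hle g.gc (fun _ _ _ h => .inl h) (fun _ _ _ h => .inl h) (fun _ _ h => .inl h)
      (fun _ _ _ h => .inl h) (fun _ _ h => .inl h) ?_ ?_ ?_ ?_ ?_ ?_ <;>
    · clear hle g
      intros
      left
      simp only [PState.receive, setExp_exp] at *
      grind

theorem _root_.Move.le {H : Finset (Fin n)} {c : Fin n → PState n} {s' : PState n}
    (h : Move t j leaf H v c s s') (g : s.Good t j leaf v) : s.Le s' := by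
  cases h with
  | idle => exact .rfl
  | acquire h => exact le_inputExp h _
  | receive p m h => exact le_receive p m
  | compute _ h => exact h.le g

theorem _root_.Move.good {H : Finset (Fin n)} {c : Fin n → PState n} {s' : PState n}
    (h : Move t j leaf H v c s s') (g : s.Good t j leaf v) : s'.Good t j leaf v := by
  have hle := h.le g
  cases h with
  | idle => exact g
  | acquire h =>
    refine g.of_le hle g.gc (fun _ _ _ h => .inl h) (fun _ _ _ h => .inl h) (fun _ _ h => .inl h)
      (fun _ _ _ h => .inl h) (fun _ _ h => .inl h) ?_ ?_ ?_ ?_ ?_ ?_ <;>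
    · clear hle g
      intros
      simp only [inputExp_exp] at *
      grind
  | receive p m h => exact g.receive p m
  | compute _ h => exact h.good g

end PState

/-! ### Executions -/

/-- Each instance of 2-graded consensus, seen on its own, is a `GCRun`: moves that concern other
instances are idle for it. -/
theorem Move.gcMove {n t j : ℕ} {leaf : ℕ → ℕ} {H : Finset (Fin n)} {v : ℕ}
    {c : Fin n → PState n} {s s' : PState n} (h : Move t j leaf H v c s s') (id : GCId) :
    GCMove t H (fun p => (c p).gc id) (s.gc id) (s'.gc id) := by
  have inp : ∀ id' b, (s.gc id').inp = none →
      GCMove t H (fun p => (c p).gc id) (s.gc id) ((s.inputGC id' b).gc id) := by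
    intro id' b h
    rw [PState.inputGC_gc]
    split_ifs with e
    · subst e
      exact .acquire b h rfl
    · exact .idle rfl
  cases h with
  | idle => exact .idle rfl
  | acquire => exact .idle rfl
  | receive p m hm =>
    cases m with
    | gc id' m =>
      simp only [PState.receive, PState.setGC_gc]
      split_ifs with e
      · subst e
        exact .receive p m hm rfl
      · exact .idle rfl
    | exp => exact .idle rfl
  | compute _ h =>
    cases h with
    | gc id' g h =>
      rw [PState.setGC_gc]
      split_ifs with e
      · subst e
        exact .compute h
      · exact .idle rfl
    | tc m _ h => cases h <;> first | exact .idle rfl | exact inp _ _ (by assumption)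
    | exp m _ h => cases h <;> first | exact .idle rfl | exact inp _ _ (by assumption)

theorem LocalStep.exp_recv {n t : ℕ} {leaf : ℕ → ℕ} {s s' : PState n}
    (h : LocalStep t leaf s s') (m : ℕ) : (s'.exp m).recv = (s.exp m).recv := by
  cases h with
  | gc => rfl
  | tc m _ h => cases h <;> rfl
  | exp m' _ h =>
    cases h <;> first
      | rfl
      | (simp only [PState.setExp_exp, PState.outputExp_exp, PState.inputExp_exp]
         split_ifs with e <;> simp [e])

instance : Finite ExpMsg := by
  refine Finite.of_surjective (α := Option Bool) (fun x => match x with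
    | none => .center
    | some k => .side k) fun m => ?_
  cases m with
  | side k => exact ⟨some k, rfl⟩
  | center => exact ⟨none, rfl⟩

namespace Execution

variable {n t j : ℕ} {leaf : ℕ → ℕ} (E : Execution n t j leaf)

theorem good (k : ℕ) {i : Fin n} (hi : i ∈ E.honest) :
    (E.state k i).Good t j leaf (E.input i) := by
  induction k with
  | zero => rw [E.state_zero i hi]; exact PState.good_initial _ _ _ _
  | succ k ih => exact (E.move k i hi).good ih

theorem le {k k' : ℕ} (hk : k ≤ k') {i : Fin n} (hi : i ∈ E.honest) :
    (E.state k i).Le (E.state k' i) := by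
  induction k', hk using Nat.le_induction with
  | base => exact .rfl
  | succ k' _ ih => exact ih.trans ((E.move k' i hi).le (E.good k' hi))

theorem gcRun (id : GCId) : GCRun t E.honest (fun k i => (E.state k i).gc id) where
  card := E.card_corrupted
  zero i hi := by rw [E.state_zero i hi]; rfl
  move k i hi := (E.move k i hi).gcMove id

theorem exp_sent_of_recv {m k : ℕ} {i p : Fin n} (hi : i ∈ E.honest) (hp : p ∈ E.honest)
    {c : ExpMsg} (hc : c ∈ ((E.state k i).exp m).recv p) :
    ∃ k', c ∈ ((E.state k' p).exp m).sent := by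
  induction k with
  | zero => simp [E.state_zero i hi, PState.initial, ExpState.initial] at hc
  | succ k ih =>
    have h := E.move k i hi
    generalize E.state (k + 1) i = s' at h hc
    cases h with
    | idle => exact ih hc
    | acquire _ =>
      rw [PState.inputExp_exp] at hc
      split_ifs at hc with e
      · exact ih (e ▸ hc)
      · exact ih hc
    | receive q msg hq =>
      cases msg with
      | gc => exact ih hc
      | exp m' c' =>
        simp only [PState.receive, PState.setExp_exp] at hc
        split_ifs at hc with e
        · subst e
          by_cases hpq : p = q
          · subst hpq
            simp only [Function.update_self, Set.mem_insert_iff] at hc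
            rcases hc with rfl | hc
            · exact ⟨k, hq hp⟩
            · exact ih hc
          · simp only [Function.update_of_ne hpq] at hc
            exact ih hc
        · exact ih hc
    | compute _ h => exact ih (h.exp_recv m ▸ hc)

theorem exp_sent_of_heard {m k : ℕ} {i : Fin n} (hi : i ∈ E.honest) {c : ExpMsg}
    (h : t + 1 ≤ heard ((E.state k i).exp m).recv (fun m => m = c)) :
    ∃ p ∈ E.honest, ∃ k', c ∈ ((E.state k' p).exp m).sent := by
  obtain ⟨p, hp, m, hm, rfl⟩ := exists_honest_of_heard E.card_corrupted h
  obtain ⟨k', hs⟩ := E.exp_sent_of_recv hi hp hm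
  exact ⟨p, hp, k', hs⟩

/-- `W r k` says that the `k`-th point of the execution comes at most `r` rounds after some fixed
moment. In the sense of `W`, messages take one round and local computation takes no time. -/
structure Rounds (W : ℕ → ℕ → Prop) : Prop where
  succ : ∀ r k, W r k → W (r + 1) k
  quiet : ∀ r k, W r k → ∀ i ∈ E.honest, ∃ k' ≥ k, W r k' ∧ Quiescent t leaf (E.state k' i)
  deliver : ∀ r k, W r k → ∀ p ∈ E.honest, ∀ i ∈ E.honest, ∀ msg, (E.state k p).Sent msg →
    ∃ k', W (r + 1) k' ∧ E.HasReceived k' i p msg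

variable {E} {W : ℕ → ℕ → Prop}

theorem Rounds.gc (h : E.Rounds W) (id : GCId) :
    GCRun.IsPaced t E.honest (fun k i => (E.state k i).gc id) W where
  succ := h.succ
  quiet r k hk i hi :=
    let ⟨k', h1, h2, h3⟩ := h.quiet r k hk i hi
    ⟨k', h1, h2, fun g hg => h3 _ (.gc _ id g hg)⟩
  deliver r k hk p hp i hi m hm := h.deliver r k hk p hp i hi (.gc id m) hm
  recv_mono _ _ hk _ hi p := ((E.le hk hi).gc id).recv p

theorem Rounds.exp (h : E.Rounds W) (m : ℕ) :
    Paced W E.honest (fun k i => ((E.state k i).exp m).sent)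
      (fun k i => ((E.state k i).exp m).recv) (fun k i => Quiescent t leaf (E.state k i)) where
  succ := h.succ
  quiet := h.quiet
  deliver r k hk p hp i hi c hm := h.deliver r k hk p hp i hi (.exp m c) hm
  recv_mono _ _ hk _ hi p := (E.le hk hi).exp_recv m p

theorem Rounds.mono (h : E.Rounds W) {r r' : ℕ} (hr : r ≤ r') {k : ℕ} (hk : W r k) : W r' k :=
  -- Any instance would do; only the clause `succ` matters.
  (h.gc (.exp 0)).mono hr hk

/-- Registers persist, so facts established at two different points hold together at a later
quiescent point within the same round. -/
theorem Rounds.settle (h : E.Rounds W) {r k k' : ℕ} (hk : W r k) (hk' : W r k') {i : Fin n}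
    (hi : i ∈ E.honest) : ∃ k'' ≥ k, k' ≤ k'' ∧ W r k'' ∧ Quiescent t leaf (E.state k'' i) := by
  have : W r (max k k') := by rcases max_choice k k' with e | e <;> rw [e] <;> assumption
  obtain ⟨k'', h1, h2⟩ := h.quiet r _ this i hi
  exact ⟨k'', (le_max_left _ _).trans h1, (le_max_right _ _).trans h1, h2⟩

end Execution

/-! ### The protocol `TC` on paths -/

/-- A path always comes with an end `a`. The inputs excluded here, a path with `a = ⊥`, are those
for which `TC` has no rule and would block. -/
theorem PState.Good.tc_shape {n t j v : ℕ} {leaf : ℕ → ℕ} {s : PState n}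
    (g : s.Good t j leaf v) {m l : ℕ} {x : TCInput} (hx : (s.tc m l).inp = some x) :
    x.T = none ∨ ∃ lo hi a, x.T = some (lo, hi) ∧ x.a = some a := by
  rcases (g.tc_gt m l x hx).lt_or_eq with hl | rfl
  · obtain ⟨y, -, -, ⟨-, rfl⟩ | ⟨lo, hi, a, -, -, ⟨-, rfl⟩ | ⟨k, g, -, rfl⟩⟩⟩ :=
      g.tc_down m l x hl hx
    · exact .inl rfl
    · exact .inl rfl
    · exact .inr ⟨_, _, _, rfl, rfl⟩
  · obtain ⟨w, -, -, rfl⟩ := g.tc_top l x hx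
    exact .inr ⟨_, _, _, rfl, rfl⟩

theorem pathCenter_eq (lo l : ℕ) : pathCenter lo (lo + 2 ^ (l + 1)) = lo + 2 ^ l := by
  rw [pathCenter, pow_succ]
  omega

theorem centralSubtree_lo (lo l : ℕ) (k : Bool) : centralSubtree lo (lo + 2 ^ (l + 1)) lo k =
    if k = false then (lo, lo + 2 ^ l) else (lo + 2 ^ l, lo + 2 ^ l + 2 ^ l) := by
  rw [centralSubtree, pathCenter_eq, pow_succ]
  cases k <;> simp <;> omega

theorem centralSubtree_hi (lo l : ℕ) (k : Bool) :
    centralSubtree lo (lo + 2 ^ (l + 1)) (lo + 2 ^ (l + 1)) k =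
    if k = false then (lo + 2 ^ l, lo + 2 ^ l + 2 ^ l) else (lo, lo + 2 ^ l) := by
  -- The halves are nondegenerate, so the upper end is not below the center and `H₁` is the upper
  -- half.
  have := Nat.pow_pos (n := l) (show 0 < 2 by decide)
  rw [centralSubtree, pathCenter_eq]
  cases k <;> simp [pow_succ] <;> omega

namespace Execution

variable {n t j : ℕ} {leaf : ℕ → ℕ} {E : Execution n t j leaf} {W : ℕ → ℕ → Prop}

/-- `TC l` takes `6 * l` rounds. -/
theorem Rounds.tc_live (h : E.Rounds W) (ht : 3 * t < n) {m l : ℕ} :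
    ∀ {r : ℕ}, (∀ i ∈ E.honest, ∃ k, W r k ∧ ((E.state k i).tc m l).inp ≠ none) →
    ∀ i ∈ E.honest, ∃ k, W (r + 6 * l) k ∧ ((E.state k i).tc m l).out ≠ none := by
  induction l with
  | zero =>
    intro r hin i hi
    obtain ⟨k, hk, hne⟩ := hin i hi
    obtain ⟨x, hx⟩ := Option.ne_none_iff_exists'.1 hne
    obtain ⟨k', hkk, hk', hq⟩ := h.quiet r k hk i hi
    exact ⟨k', hk', fun hc => hq _ (.tc _ _ m (.base _ x ((E.le hkk hi).tc_inp _ _ _ hx) hc))⟩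
  | succ l ih =>
    intro r hin
    have h1 : ∀ i ∈ E.honest, ∃ k, W r k ∧
        ((E.state k i).gc (.tc m (l + 1))).inp ≠ none := by
      intro i hi
      obtain ⟨k, hk, hne⟩ := hin i hi
      obtain ⟨x, hx⟩ := Option.ne_none_iff_exists'.1 hne
      obtain ⟨k', hkk, hk', hq⟩ := h.quiet r k hk i hi
      have hx' := (E.le hkk hi).tc_inp _ _ _ hx
      refine ⟨k', hk', fun hc => ?_⟩
      have hs := (E.good k' hi).tc_shape hx'
      obtain ⟨v, T, a, b⟩ := x
      rcases hs with rfl | ⟨lo, hi', a, rfl, rfl⟩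
      · cases a with
        | none => exact hq _ (.tc _ _ m (.inputB _ l v b hx' hc))
        | some a => exact hq _ (.tc _ _ m (.inputA _ l v a b hx' hc))
      · exact hq _ (.tc _ _ m (.inputT _ l v lo hi' a b hx' hc))
    have h2 := (E.gcRun (.tc m (l + 1))).out_live ht (h.gc _) h1
    have h3 : ∀ i ∈ E.honest, ∃ k, W (r + 6) k ∧ ((E.state k i).tc m l).inp ≠ none := by
      intro i hi
      obtain ⟨k, hk, hne⟩ := hin i hi
      obtain ⟨x, hx⟩ := Option.ne_none_iff_exists'.1 hne
      obtain ⟨k₁, hk₁, o, ho⟩ := h2 i hi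
      obtain ⟨k', hkk, hkk₁, hk', hq⟩ := h.settle (h.mono (by omega : r ≤ r + 6) hk) hk₁ hi
      have hx' := (E.le hkk hi).tc_inp _ _ _ hx
      have ho' := ((E.le hkk₁ hi).gc _).out ho
      refine ⟨k', hk', fun hc => ?_⟩
      have hs := (E.good k' hi).tc_shape hx'
      obtain ⟨b', hb'⟩ := Option.ne_none_iff_exists'.1 ((E.good k' hi).gc_out_ne ho')
      obtain ⟨y, hy, -, hT⟩ := (E.good k' hi).gc_tc m l b' hb'
      obtain rfl : x = y := Option.some.inj (hx'.symm.trans hy)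
      obtain ⟨v, T, a, b⟩ := x
      rcases hs with rfl | ⟨lo, hi', a, rfl, rfl⟩
      -- Without a path, `TC l` has received its input together with the 2-graded consensus.
      · exact hT rfl hc
      · rcases (E.gcRun (.tc m (l + 1))).out_shape ht hi ho' with rfl | ⟨c, rfl | rfl⟩
        · exact hq _ (.tc _ _ m (.grade0 _ l v lo hi' a b hx' ho' hc))
        · exact hq _ (.tc _ _ m (.gradePos _ l v lo hi' a _ b c hx' ho' hc))
        · exact hq _ (.tc _ _ m (.gradePos _ l v lo hi' a _ b c hx' ho' hc))
    intro i hi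
    obtain ⟨k, hk, hne⟩ := hin i hi
    obtain ⟨x, hx⟩ := Option.ne_none_iff_exists'.1 hne
    obtain ⟨k₁, hk₁, hne₁⟩ := ih h3 i hi
    obtain ⟨y, hy⟩ := Option.ne_none_iff_exists'.1 hne₁
    obtain ⟨k', hkk, hkk₁, hk', hq⟩ :=
      h.settle (h.mono (by omega : r ≤ r + 6 + 6 * l) hk) hk₁ hi
    refine ⟨k', h.mono (by omega) hk', fun hc => ?_⟩
    exact hq _ (.tc _ _ m (.inner _ l y x ((E.le hkk hi).tc_inp _ _ _ hx)
      ((E.le hkk₁ hi).tc_out _ _ _ hy) hc))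

end Execution

/-! ### Edge agreement and validity of `TC` -/

namespace Execution

variable {n t j : ℕ} {leaf : ℕ → ℕ} {E : Execution n t j leaf} {m l : ℕ}

/-- All inputs that honest parties ever give to `TC l` inside `Exp m` have the property `P`. -/
def TCInputs (E : Execution n t j leaf) (m l : ℕ) (P : TCInput → Prop) : Prop :=
  ∀ k, ∀ i ∈ E.honest, ∀ x, ((E.state k i).tc m l).inp = some x → P x

/-- If all honest parties give the same bit to 2-graded consensus in `TC (l + 1)`, then they all
obtain it with the grade `2`. -/
theorem TCInputs.unanimous {P : TCInput → Prop} (hP : E.TCInputs m (l + 1) P) (ht : 3 * t < n)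
    {b : Bool} (hb : ∀ x, P x → x.bit = b) {k : ℕ} {i : Fin n} (hi : i ∈ E.honest)
    {o : Option Bool × ℕ} (ho : ((E.state k i).gc (.tc m (l + 1))).out = some o) :
    o = (some b, 2) := by
  refine (E.gcRun (.tc m (l + 1))).out_of_unanimous ht (fun k i hi c hc => ?_) hi ho
  obtain ⟨y, hy, rfl, -⟩ := (E.good k hi).gc_tc m l c hc
  exact hb y (hP k i hi y hy)

/-- All parties are at the vertex `σ`, which is the auxiliary input `b` of those without a path,
and which is the end other than `a` of the path of the others. -/
def AtB (l σ lo a : ℕ) (x : TCInput) : Prop :=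
  ((a = lo ∧ σ = lo + 2 ^ l) ∨ (a = lo + 2 ^ l ∧ σ = lo)) ∧
  (x = ⟨σ, none, none, some σ⟩ ∨ ∃ b, x = ⟨σ, some (lo, lo + 2 ^ l), some a, b⟩)

/-- All parties are at the vertex `σ`, which is the auxiliary input `a` and an end of the path of
those who have a path. -/
def AtA (l σ lo : ℕ) (x : TCInput) : Prop :=
  (σ = lo ∨ σ = lo + 2 ^ l) ∧
  (x = ⟨σ, none, some σ, none⟩ ∨ ∃ b, x = ⟨σ, some (lo, lo + 2 ^ l), some σ, b⟩)

/-- All parties have the same path with the same auxiliary input `a`. -/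
def OnCommon (l lo a L U : ℕ) (x : TCInput) : Prop :=
  (a = lo ∨ a = lo + 2 ^ l) ∧ ∃ v b, x = ⟨v, some (lo, lo + 2 ^ l), some a, b⟩ ∧
    lo ≤ v ∧ v ≤ lo + 2 ^ l ∧ L ≤ v ∧ v ≤ U

/-- `H₁` contains `a`, and `σ` is the opposite end, outside `H₁`. Parties without a path have `a =
⊥` and also vote for the second half. -/
theorem AtB.bit {l σ lo a : ℕ} {x : TCInput} (h : AtB (l + 1) σ lo a x) : x.bit = true := by
  have := Nat.pow_pos (n := l) (show 0 < 2 by decide)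
  obtain ⟨⟨rfl, rfl⟩ | ⟨rfl, rfl⟩, rfl | ⟨b, rfl⟩⟩ := h
  · rfl
  · simp only [TCInput.bit, centralSubtree_lo, OnPath]
    simp [pow_succ]
  · rfl
  · simp only [TCInput.bit, centralSubtree_hi, OnPath]
    simp

theorem AtA.bit {l σ lo : ℕ} {x : TCInput} (h : AtA (l + 1) σ lo x) : x.bit = false := by
  obtain ⟨rfl | rfl, rfl | ⟨b, rfl⟩⟩ := h
  · rfl
  · simp [TCInput.bit, centralSubtree_lo, OnPath]
  · rfl
  · simp only [TCInput.bit, centralSubtree_hi, OnPath]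
    simp [pow_succ]
    omega

/-- The invariant reproduces itself: the path `H₂` runs from the old midpoint, which becomes the new
`a`, to `σ`, and parties without a path pass `b = σ` on. -/
theorem AtB.next {l σ lo a : ℕ} {x y : TCInput} (h : AtB (l + 1) σ lo a y)
    (hn : y.Next (some (some true, 2)) x) :
    AtB l σ (if a = lo then lo + 2 ^ l else lo) (lo + 2 ^ l) x := by
  have := Nat.pow_pos (n := l) (show 0 < 2 by decide)
  obtain ⟨hσ, rfl | ⟨b, rfl⟩⟩ := h
  · rcases hn with ⟨-, rfl⟩ | ⟨lo', hi', a', e, -⟩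
    · refine ⟨?_, .inl rfl⟩
      rcases hσ with ⟨rfl, rfl⟩ | ⟨rfl, rfl⟩ <;> simp [pow_succ] <;> omega
    · simp at e
  · rcases hn with ⟨e, -⟩ | ⟨lo', hi', a', e, ea, ⟨e', -⟩ | ⟨k, g, e', rfl⟩⟩
    · simp at e
    · simp at e'
    · simp only [Option.some.injEq, Prod.mk.injEq] at e ea e'
      obtain ⟨rfl, rfl⟩ := e
      obtain ⟨rfl, rfl⟩ := e'
      subst ea
      rw [pathCenter_eq]
      rcases hσ with ⟨rfl, rfl⟩ | ⟨rfl, rfl⟩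
      · refine ⟨by simp [pow_succ]; omega, .inr ⟨b, ?_⟩⟩
        simp only [centralSubtree_lo, OnPath]
        simp [pow_succ]
        omega
      · refine ⟨by simp, .inr ⟨b, ?_⟩⟩
        simp [centralSubtree_hi, OnPath]

/-- `AtA` lasts for one level only. The next path is `H₁`, of which `σ` is still an end, but its
auxiliary end `a` is now the midpoint, while parties without a path shift `σ` from `a` to `b`. -/
theorem AtA.next {l σ lo : ℕ} {x y : TCInput} (h : AtA (l + 1) σ lo y)
    (hn : y.Next (some (some false, 2)) x) :
    AtB l σ (if σ = lo then lo else lo + 2 ^ l) (lo + 2 ^ l) x := by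
  have := Nat.pow_pos (n := l) (show 0 < 2 by decide)
  obtain ⟨hσ, rfl | ⟨b, rfl⟩⟩ := h
  · rcases hn with ⟨-, rfl⟩ | ⟨lo', hi', a', e, -⟩
    · refine ⟨?_, .inl rfl⟩
      rcases hσ with rfl | rfl <;> simp [pow_succ] <;> omega
    · simp at e
  · rcases hn with ⟨e, -⟩ | ⟨lo', hi', a', e, ea, ⟨e', -⟩ | ⟨k, g, e', rfl⟩⟩
    · simp at e
    · simp at e'
    · simp only [Option.some.injEq, Prod.mk.injEq] at e ea e'
      obtain ⟨rfl, rfl⟩ := e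
      obtain ⟨rfl, rfl⟩ := e'
      subst ea
      rw [pathCenter_eq]
      refine ⟨?_, .inr ⟨some σ, ?_⟩⟩
      · rcases hσ with rfl | rfl <;> simp [pow_succ]
        omega
      · rcases hσ with rfl | rfl
        · simp only [centralSubtree_lo, OnPath]
          simp
        · simp only [centralSubtree_hi, OnPath]
          simp [pow_succ]
          omega

/-- By unanimity every output of 2-graded consensus is `(2, 2)`, so `AtB` passes down to `TC 0`,
where `σ` is the input vertex. Direct outputs at parties without a path are `σ` as well. -/
theorem AtB.out (ht : 3 * t < n) {σ : ℕ} : ∀ l lo a, l ≤ m → E.TCInputs m l (AtB l σ lo a) →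
    ∀ k, ∀ i ∈ E.honest, ∀ y, ((E.state k i).tc m l).out = some y → y = σ := by
  intro l
  induction l with
  | zero =>
    intro lo a _ hP k i hi y hy
    obtain ⟨x, hx, rfl⟩ := (E.good k hi).tc_out_zero m y hy
    obtain ⟨-, rfl | ⟨b, rfl⟩⟩ := hP k i hi x hx <;> rfl
  | succ l ih =>
    intro lo a hl hP k i hi y hy
    have hun {k : ℕ} {i : Fin n} (hi : i ∈ E.honest) {o : Option Bool × ℕ}
        (ho : ((E.state k i).gc (.tc m (l + 1))).out = some o) : o = (some true, 2) :=
      hP.unanimous ht (fun x hx => hx.bit) hi ho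
    obtain ⟨x, hx, h | ⟨e, h⟩ | ⟨lo', hi', a', -, -, h, -⟩⟩ := (E.good k hi).tc_out_succ m l y hy
    · refine ih (if a = lo then lo + 2 ^ l else lo) (lo + 2 ^ l) (by omega)
        (fun k i hi x hx => ?_) k i hi y h
      obtain ⟨y, hy, -, hn⟩ := (E.good k hi).tc_down m l x hl hx
      refine (hP k i hi y hy).next ?_
      -- If the register is still empty, only the case `T = ⊥` can have passed an input on; that
      -- case ignores the register, so `(2, 2)` may be put in its place.
      cases ho : ((E.state k i).gc (.tc m (l + 1))).out with
      | none =>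
        rw [ho] at hn
        exact hn.imp_right fun ⟨a, b, c, d, e, f⟩ => by simp at f
      | some o => rwa [ho, hun hi ho] at hn
    · obtain ⟨-, rfl | ⟨b, rfl⟩⟩ := hP k i hi x hx <;> simp_all
    · simpa using hun hi h

theorem AtA.out (ht : 3 * t < n) {σ lo : ℕ} (hl : l ≤ m) (hP : E.TCInputs m l (AtA l σ lo))
    {k : ℕ} {i : Fin n} (hi : i ∈ E.honest) {y : ℕ}
    (hy : ((E.state k i).tc m l).out = some y) : y = σ := by
  cases l with
  | zero =>
    obtain ⟨x, hx, rfl⟩ := (E.good k hi).tc_out_zero m y hy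
    obtain ⟨-, rfl | ⟨b, rfl⟩⟩ := hP k i hi x hx <;> rfl
  | succ l =>
    have hun {k : ℕ} {i : Fin n} (hi : i ∈ E.honest) {o : Option Bool × ℕ}
        (ho : ((E.state k i).gc (.tc m (l + 1))).out = some o) : o = (some false, 2) :=
      hP.unanimous ht (fun x hx => hx.bit) hi ho
    obtain ⟨x, hx, h | ⟨e, h⟩ | ⟨lo', hi', a', -, -, h, -⟩⟩ := (E.good k hi).tc_out_succ m l y hy
    · refine AtB.out ht l (if σ = lo then lo else lo + 2 ^ l) (lo + 2 ^ l) (by omega)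
        (fun k i hi x hx => ?_) k i hi y h
      obtain ⟨y, hy, -, hn⟩ := (E.good k hi).tc_down m l x hl hx
      refine (hP k i hi y hy).next ?_
      cases ho : ((E.state k i).gc (.tc m (l + 1))).out with
      | none =>
        rw [ho] at hn
        exact hn.imp_right fun ⟨a, b, c, d, e, f⟩ => by simp at f
      | some o => rwa [ho, hun hi ho] at hn
    · obtain ⟨-, rfl | ⟨b, rfl⟩⟩ := hP k i hi x hx <;> simp_all
    · simpa using hun hi h

theorem OnCommon.subtree {l lo a : ℕ} (ha : a = lo ∨ a = lo + 2 ^ (l + 1)) (k : Bool) :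
    ∃ lo', centralSubtree lo (lo + 2 ^ (l + 1)) a k = (lo', lo' + 2 ^ l) ∧
      (lo + 2 ^ l = lo' ∨ lo + 2 ^ l = lo' + 2 ^ l) := by
  rcases ha with rfl | rfl
  · rw [centralSubtree_lo]
    cases k <;> simp
  · rw [centralSubtree_hi]
    cases k <;> simp

theorem OnCommon.bit {l lo a L U : ℕ} {x : TCInput} (h : OnCommon (l + 1) lo a L U x) :
    x.a = some a ∧ x.T = some (lo, lo + 2 ^ (l + 1)) ∧ L ≤ x.v ∧ x.v ≤ U ∧
      OnPath x.v (centralSubtree lo (lo + 2 ^ (l + 1)) a x.bit) := by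
  obtain ⟨ha, v, b, rfl, h1, h2, h3, h4⟩ := h
  refine ⟨rfl, rfl, h3, h4, ?_⟩
  simp only [TCInput.bit]
  split_ifs with hp
  · exact hp
  · rcases ha with rfl | rfl
    · rw [centralSubtree_lo] at hp ⊢
      simp [OnPath, pow_succ] at *
      omega
    · rw [centralSubtree_hi] at hp ⊢
      simp [OnPath, pow_succ] at *
      omega

/-- `TC l` on a common path reaches edge agreement. -/
theorem OnCommon.out (ht : 3 * t < n) {L U : ℕ} : ∀ l lo a, l ≤ m →
    E.TCInputs m l (OnCommon l lo a L U) →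
    ∃ y₀, ∀ k, ∀ i ∈ E.honest, ∀ y, ((E.state k i).tc m l).out = some y →
      (y = y₀ ∨ y = y₀ + 1) ∧ L ≤ y ∧ y ≤ U := by
  intro l
  induction l with
  | zero =>
    intro lo a _ hP
    -- The common path has shrunk to the single edge from `lo` to `lo + 1`.
    refine ⟨lo, fun k i hi y hy => ?_⟩
    obtain ⟨x, hx, rfl⟩ := (E.good k hi).tc_out_zero m y hy
    obtain ⟨-, v, b, rfl, h1, h2, h3, h4⟩ := hP k i hi x hx
    simp only [pow_zero] at h2
    exact ⟨by change v = lo ∨ v = lo + 1; omega, h3, h4⟩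
  | succ l ih =>
    intro lo a hl hP
    by_cases hne : ∃ k, ∃ i ∈ E.honest, ∃ x, ((E.state k i).tc m (l + 1)).inp = some x
    swap
    · refine ⟨0, fun k i hi y hy => ?_⟩
      obtain ⟨x, hx, -⟩ := (E.good k hi).tc_out_succ m l y hy
      exact absurd ⟨k, i, hi, x, hx⟩ hne
    obtain ⟨ha, -⟩ : (a = lo ∨ a = lo + 2 ^ (l + 1)) ∧ True := by
      obtain ⟨k, i, hi, x, hx⟩ := hne
      exact ⟨(hP k i hi x hx).1, trivial⟩
    have R := E.gcRun (.tc m (l + 1))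
    have hinp : ∀ {k i b}, i ∈ E.honest → ((E.state k i).gc (.tc m (l + 1))).inp = some b →
        ∃ v, L ≤ v ∧ v ≤ U ∧ OnPath v (centralSubtree lo (lo + 2 ^ (l + 1)) a b) := by
      intro k i b hi hb
      obtain ⟨y, hy, rfl, -⟩ := (E.good k hi).gc_tc m l b hb
      exact ⟨y.v, (hP k i hi y hy).bit.2.2⟩
    -- two honest vertices in different halves have the center between them
    have hmid : ∀ {u v}, OnPath u (centralSubtree lo (lo + 2 ^ (l + 1)) a false) →
        OnPath v (centralSubtree lo (lo + 2 ^ (l + 1)) a true) → L ≤ u → u ≤ U → L ≤ v → v ≤ U →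
        L ≤ lo + 2 ^ l ∧ lo + 2 ^ l ≤ U := by
      intro u v hu hv h1 h2 h3 h4
      rcases ha with rfl | rfl
      · rw [centralSubtree_lo] at hu hv
        simp [OnPath] at hu hv
        omega
      · rw [centralSubtree_hi] at hu hv
        simp [OnPath] at hu hv
        omega
    have hlow : ∀ {k i x g}, i ∈ E.honest →
        ((E.state k i).gc (.tc m (l + 1))).out = some (x, g) → g ≤ 1 →
        L ≤ lo + 2 ^ l ∧ lo + 2 ^ l ≤ U := by
      intro k i x g hi ho hg
      obtain ⟨k₀, i₀, hi₀, h₀⟩ := R.exists_inp_of_grade_le_one ht hi ho hg false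
      obtain ⟨k₁, i₁, hi₁, h₁⟩ := R.exists_inp_of_grade_le_one ht hi ho hg true
      obtain ⟨u, hu1, hu2, hu⟩ := hinp hi₀ h₀
      obtain ⟨v, hv1, hv2, hv⟩ := hinp hi₁ h₁
      exact hmid hu hv hu1 hu2 hv1 hv2
    by_cases hz : ∃ k, ∃ i ∈ E.honest, ((E.state k i).gc (.tc m (l + 1))).out = some (none, 0)
    · -- all honest parties go on from the center
      obtain ⟨k₀, i₀, hi₀, h₀⟩ := hz
      have hσ := hlow hi₀ h₀ (by omega)
      obtain ⟨κ, hκ⟩ : ∃ κ, ∀ k, ∀ i ∈ E.honest, ∀ c g,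
          ((E.state k i).gc (.tc m (l + 1))).out = some (some c, g) → c = κ := by
        by_cases hc : ∃ k, ∃ i ∈ E.honest, ∃ c g,
            ((E.state k i).gc (.tc m (l + 1))).out = some (some c, g)
        · obtain ⟨k, i, hi, c, g, h⟩ := hc
          exact ⟨c, fun k' i' hi' c' g' h' => R.out_agree ht hi' hi h' h⟩
        -- If no honest party obtains a positive grade, any index will do.
        · exact ⟨true, fun k i hi c g h => absurd ⟨k, i, hi, c, g, h⟩ hc⟩
      obtain ⟨lo', hcs, hlo'⟩ := OnCommon.subtree ha κ
      have hA : E.TCInputs m l (AtA l (lo + 2 ^ l) lo') := by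
        intro k i hi x hx
        refine ⟨hlo', ?_⟩
        obtain ⟨y, hy, -, hn⟩ := (E.good k hi).tc_down m l x hl hx
        obtain ⟨-, v, b, rfl, -⟩ := hP k i hi y hy
        rcases hn with ⟨e, -⟩ | ⟨lo₁, hi₁, a₁, e, ea, ⟨-, rfl⟩ | ⟨c, g, ho, rfl⟩⟩
        · simp at e
        · simp only [Option.some.injEq, Prod.mk.injEq] at e
          obtain ⟨rfl, rfl⟩ := e
          rw [pathCenter_eq]
          exact .inl rfl
        · simp only [Option.some.injEq, Prod.mk.injEq] at e ea
          obtain ⟨rfl, rfl⟩ := e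
          subst ea
          obtain rfl := hκ k i hi c g ho
          -- Grade 2 is excluded by the grade 0 of `i₀`, so this party too restarts from the
          -- midpoint.
          have hg : g ≠ 2 := fun e => R.not_zero_two ht hi₀ hi h₀ (e ▸ ho)
          rw [pathCenter_eq, hcs]
          simp only [hg, false_and, if_false]
          exact .inr ⟨_, rfl⟩
      refine ⟨lo + 2 ^ l, fun k i hi y hy => ?_⟩
      obtain rfl : y = lo + 2 ^ l := by
        obtain ⟨x, hx, h | h⟩ := (E.good k hi).tc_out_succ m l y hy
        · exact AtA.out ht (by omega) hA hi h
        · obtain ⟨-, v, b, rfl, -⟩ := hP k i hi x hx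
          rcases h with ⟨e, -⟩ | ⟨lo₁, hi₁, a₁, e, -, -, rfl⟩
          · simp at e
          · simp only [Option.some.injEq, Prod.mk.injEq] at e
            obtain ⟨rfl, rfl⟩ := e
            exact pathCenter_eq _ _
      exact ⟨.inl rfl, hσ⟩
    · -- all honest parties go on with the same half of the path
      obtain ⟨κ, hκ⟩ : ∃ κ, ∀ k, ∀ i ∈ E.honest, ∀ c g,
          ((E.state k i).gc (.tc m (l + 1))).out = some (some c, g) → c = κ := by
        by_cases hc : ∃ k, ∃ i ∈ E.honest, ∃ c g,
            ((E.state k i).gc (.tc m (l + 1))).out = some (some c, g)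
        · obtain ⟨k, i, hi, c, g, h⟩ := hc
          exact ⟨c, fun k' i' hi' c' g' h' => R.out_agree ht hi' hi h' h⟩
        · exact ⟨true, fun k i hi c g h => absurd ⟨k, i, hi, c, g, h⟩ hc⟩
      obtain ⟨lo', hcs, hlo'⟩ := OnCommon.subtree ha κ
      obtain ⟨y₀, hy₀⟩ := ih lo' (lo + 2 ^ l) (by omega) (by
        intro k i hi x hx
        refine ⟨hlo', ?_⟩
        obtain ⟨y, hy, -, hn⟩ := (E.good k hi).tc_down m l x hl hx
        have hyb := (hP k i hi y hy).bit
        obtain ⟨-, v, b, rfl, -⟩ := hP k i hi y hy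
        rcases hn with ⟨e, -⟩ | ⟨lo₁, hi₁, a₁, e, ea, ⟨ho, -⟩ | ⟨c, g, ho, rfl⟩⟩
        · simp at e
        · exact absurd ⟨k, i, hi, ho⟩ hz
        · simp only [Option.some.injEq, Prod.mk.injEq] at e ea
          obtain ⟨rfl, rfl⟩ := e
          subst ea
          obtain rfl := hκ k i hi c g ho
          rw [pathCenter_eq]
          refine ⟨if g = 2 ∧ OnPath v (centralSubtree lo (lo + 2 ^ (l + 1)) a c) then v
            else lo + 2 ^ l, if c = false then some a else b, by rw [hcs], ?_⟩
          split_ifs with hv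
          · obtain ⟨-, -, h3, h4, -⟩ := hyb
            rw [hcs] at hv
            exact ⟨hv.2.1, hv.2.2, h3, h4⟩
          · have := Nat.pow_pos (n := l) (show 0 < 2 by decide)
            refine ⟨by omega, by omega, ?_⟩
            -- A party moves to the midpoint either because of a grade below 2 or because its vertex
            -- is not in the chosen half `c`. In the second case some honest party has voted for `c`
            -- from within that half. Either way the midpoint lies between two honest vertices.
            by_cases hg : g ≤ 1
            · exact hlow hi ho hg
            · have hg2 : g = 2 := by
                rcases R.out_shape ht hi ho with e | ⟨c', e | e⟩ <;> simp at e <;> omega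
              have hv' : ¬ OnPath v (centralSubtree lo (lo + 2 ^ (l + 1)) a c) :=
                fun h => hv ⟨hg2, h⟩
              obtain ⟨k', i', hi', hc⟩ := R.exists_inp ht hi ho
              obtain ⟨u, hu1, hu2, hu⟩ := hinp hi' hc
              obtain ⟨-, -, h3, h4, h5⟩ := hyb
              generalize TCInput.bit _ = d at h5
              simp only at h3 h4 h5
              cases c <;> cases d
              · exact absurd h5 hv'
              · exact hmid hu h5 hu1 hu2 h3 h4
              · exact hmid h5 hu h3 h4 hu1 hu2
              · exact absurd h5 hv')
      refine ⟨y₀, fun k i hi y hy => ?_⟩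
      obtain ⟨x, hx, h | h⟩ := (E.good k hi).tc_out_succ m l y hy
      · exact hy₀ k i hi y h
      · obtain ⟨-, v, b, rfl, -⟩ := hP k i hi x hx
        rcases h with ⟨e, -⟩ | ⟨lo₁, hi₁, a₁, e, -, h, rfl⟩
        · simp at e
        · exact absurd ⟨k, i, hi, h⟩ hz

end Execution

/-! ### The protocol `Exp` -/

namespace Execution

variable {n t j : ℕ} {leaf : ℕ → ℕ} {E : Execution n t j leaf} {m : ℕ}

/-- All inputs that honest parties ever give to `Exp m` have the property `P`. -/
def ExpInputs (E : Execution n t j leaf) (m : ℕ) (P : ℕ → Prop) : Prop :=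
  ∀ k, ∀ i ∈ E.honest, ∀ v, ((E.state k i).exp m).inp = some v → P v

/-- A variable `side` is the value of a positive grade that an honest party has obtained. -/
theorem exists_out_of_side {k : ℕ} {i : Fin n} (hi : i ∈ E.honest) {b : Bool}
    (h : ((E.state k i).exp m).side = some b) :
    ∃ k', ∃ i' ∈ E.honest, ∃ g, ((E.state k' i').gc (.exp m)).out = some (some b, g) := by
  rcases ((E.good k hi).exp_side m b h).2 with ⟨g, hg⟩ | hh
  · exact ⟨k, i, hi, g, hg⟩
  · obtain ⟨p, hp, k', hs⟩ := E.exp_sent_of_heard hi hh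
    exact ⟨k', p, hp, 1, (E.good k' hp).exp_sent_side m b hs⟩

/-- Each `side` leads back to a positive grade of an honest party, and the values of positive grade
agree. -/
theorem side_agree (ht : 3 * t < n) {k k' : ℕ} {i i' : Fin n} (hi : i ∈ E.honest)
    (hi' : i' ∈ E.honest) {b b' : Bool} (h : ((E.state k i).exp m).side = some b)
    (h' : ((E.state k' i').exp m).side = some b') : b = b' := by
  obtain ⟨l, p, hp, g, ho⟩ := exists_out_of_side hi h
  obtain ⟨l', p', hp', g', ho'⟩ := exists_out_of_side hi' h'
  exact (E.gcRun (.exp m)).out_agree ht hp hp' ho ho'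

theorem exists_left (ht : 3 * t < n) {k : ℕ} {i : Fin n} (hi : i ∈ E.honest) {x : Option Bool}
    {g : ℕ} (ho : ((E.state k i).gc (.exp m)).out = some (x, g)) (hx : x = some false ∨ g ≤ 1) :
    ∃ k', ∃ i' ∈ E.honest, ∃ u, ((E.state k' i').exp m).inp = some u ∧ u < 2 ^ (m + 1) := by
  obtain ⟨k', i', hi', h⟩ : ∃ k', ∃ i' ∈ E.honest,
      ((E.state k' i').gc (.exp m)).inp = some false := by
    rcases hx with rfl | hg
    · exact (E.gcRun (.exp m)).exists_inp ht hi ho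
    · exact (E.gcRun (.exp m)).exists_inp_of_grade_le_one ht hi ho hg false
  obtain ⟨u, hu, e⟩ := (E.good k' hi').gc_exp m _ h
  exact ⟨k', i', hi', u, hu, by by_contra hc; simp [hc] at e⟩

theorem exists_right (ht : 3 * t < n) {k : ℕ} {i : Fin n} (hi : i ∈ E.honest) {x : Option Bool}
    {g : ℕ} (ho : ((E.state k i).gc (.exp m)).out = some (x, g)) (hx : x = some true ∨ g ≤ 1) :
    ∃ k', ∃ i' ∈ E.honest, ∃ u, ((E.state k' i').exp m).inp = some u ∧ 2 ^ (m + 1) ≤ u := by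
  obtain ⟨k', i', hi', h⟩ : ∃ k', ∃ i' ∈ E.honest,
      ((E.state k' i').gc (.exp m)).inp = some true := by
    rcases hx with rfl | hg
    · exact (E.gcRun (.exp m)).exists_inp ht hi ho
    · exact (E.gcRun (.exp m)).exists_inp_of_grade_le_one ht hi ho hg true
  obtain ⟨u, hu, e⟩ := (E.good k' hi').gc_exp m _ h
  exact ⟨k', i', hi', u, hu, by by_contra hc; simp [hc] at e⟩

/-- `RIGHT` needs an honest input of at least `2 ^ (m + 1)`. So the recursion never goes beyond `Exp
(q - 1)`. -/
theorem lt_of_side (ht : 3 * t < n) {q : ℕ} (hP : E.ExpInputs m (fun v => v ≤ 2 ^ q - 1)) {k : ℕ}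
    {i : Fin n} (hi : i ∈ E.honest) (h : ((E.state k i).exp m).side = some true) : m + 1 < q := by
  obtain ⟨k', i', hi', g, ho⟩ := exists_out_of_side hi h
  obtain ⟨k₁, i₁, hi₁, u, hu, hle⟩ := exists_right ht hi' ho (.inl rfl)
  have h1 := hP k₁ i₁ hi₁ u hu
  by_contra hc
  have h2 := Nat.pow_le_pow_right (show 0 < 2 by decide) (by omega : q ≤ m + 1)
  have h3 := Nat.pow_pos (n := q) (show 0 < 2 by decide)
  omega

/-- If some honest party obtains the grade `0`, then all honest parties go on from the center, and
the center is between two honest inputs. -/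
theorem next_of_grade_zero (ht : 3 * t < n) {k : ℕ} {i : Fin n} (hi : i ∈ E.honest)
    (ho : ((E.state k i).gc (.exp m)).out = some (none, 0)) :
    ∀ k', ∀ i' ∈ E.honest, ∀ w, ((E.state k' i').exp m).next = some w → w = 2 ^ (m + 1) - 1 := by
  intro k' i' hi' w hw
  have R := E.gcRun (.exp m)
  obtain ⟨u, o, -, ho', ⟨rfl, -⟩ | ⟨rfl, -⟩ | ⟨-, -, h, -⟩ | ⟨-, h, -⟩⟩ :=
    (E.good k' hi').exp_next m w hw
  · exact (R.not_zero_two ht hi hi' ho ho').elim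
  · exact (R.not_zero_two ht hi hi' ho ho').elim
  · exact h
  · exact h

/-- The value `v_next` is between two honest inputs and on the proper side. -/
theorem next_bounds (ht : 3 * t < n) {L U : ℕ} (hP : E.ExpInputs m (fun v => L ≤ v ∧ v ≤ U))
    {k : ℕ} {i : Fin n} (hi : i ∈ E.honest) {w : ℕ} (hw : ((E.state k i).exp m).next = some w) :
    L ≤ w ∧ w ≤ U ∧
      (((E.state k i).exp m).side = some false → w ≤ 2 ^ (m + 1) - 1 ∧
        ∀ B, B ≤ 2 ^ (m + 1) - 1 → E.ExpInputs m (fun v => B ≤ v) → B ≤ w) ∧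
      (((E.state k i).exp m).side = some true → 2 ^ (m + 1) - 1 ≤ w) := by
  obtain ⟨u, o, hu, ho, h⟩ := (E.good k hi).exp_next m w hw
  have hu' := hP k i hi u hu
  -- A grade of at most 1 gives honest inputs `a < 2 ^ (m + 1) ≤ b`, hence `a ≤ 2 ^ (m + 1) - 1 ≤
  -- b`.
  have low : ∀ x g, o = (x, g) → g ≤ 1 → L ≤ 2 ^ (m + 1) - 1 ∧ 2 ^ (m + 1) - 1 ≤ U := by
    rintro x g rfl hg
    obtain ⟨k₀, i₀, hi₀, a, ha, ha'⟩ := exists_left ht hi ho (.inr hg)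
    obtain ⟨k₁, i₁, hi₁, b, hb, hb'⟩ := exists_right ht hi ho (.inr hg)
    have := hP k₀ i₀ hi₀ a ha
    have := hP k₁ i₁ hi₁ b hb
    omega
  rcases h with ⟨rfl, rfl, hs⟩ | ⟨rfl, rfl, hs⟩ | ⟨b, e, rfl, -⟩ | ⟨e, rfl, -⟩
  -- The honest voter for `LEFT` has an input of at most the center, so `L` bounds the center and
  -- the minimum from below.
  · obtain ⟨k₀, i₀, hi₀, a, ha, ha'⟩ := exists_left ht hi ho (.inl rfl)
    have := hP k₀ i₀ hi₀ a ha
    refine ⟨by omega, by omega, fun _ => ⟨by omega, fun B hB hB' => ?_⟩, fun h => ?_⟩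
    · have := hB' k i hi u hu
      omega
    · simp [hs] at h
  · obtain ⟨k₁, i₁, hi₁, b, hb, hb'⟩ := exists_right ht hi ho (.inl rfl)
    have := hP k₁ i₁ hi₁ b hb
    refine ⟨by omega, by omega, fun h => ?_, fun _ => by omega⟩
    simp [hs] at h
  · have := low _ _ e le_rfl
    exact ⟨this.1, this.2, fun _ => ⟨le_rfl, fun _ h _ => h⟩, fun _ => le_rfl⟩
  · have := low _ _ e (by omega)
    exact ⟨this.1, this.2, fun _ => ⟨le_rfl, fun _ h _ => h⟩, fun _ => le_rfl⟩

/-- Edge agreement and validity of `TC m` inside `Exp m`. -/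
theorem tc_safe (ht : 3 * t < n) (hleaf : leaf m = 2 ^ m - 1 ∨ leaf m = 2 ^ (m + 1) - 1)
    {L U : ℕ} (hP : ∀ k, ∀ i ∈ E.honest, ∀ w, ((E.state k i).exp m).next = some w →
      ((E.state k i).exp m).side = some false →
      2 ^ m - 1 ≤ w ∧ w ≤ 2 ^ (m + 1) - 1 ∧ L ≤ w ∧ w ≤ U) :
    ∃ y₀, ∀ k, ∀ i ∈ E.honest, ∀ y, ((E.state k i).tc m m).out = some y →
      (y = y₀ ∨ y = y₀ + 1) ∧ L ≤ y ∧ y ≤ U := by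
  have e : 2 ^ (m + 1) - 1 = 2 ^ m - 1 + 2 ^ m := by
    have := Nat.pow_pos (n := m) (show 0 < 2 by decide)
    rw [pow_succ]
    omega
  refine OnCommon.out ht m (2 ^ m - 1) (leaf m) le_rfl fun k i hi x hx => ?_
  obtain ⟨w, hw, hs, rfl⟩ := (E.good k hi).tc_top m x hx
  obtain ⟨h1, h2, h3, h4⟩ := hP k i hi w hw hs
  rw [e] at h2 hleaf
  exact ⟨hleaf, w, none, by rw [e], h1, h2, h3, h4⟩

/-- Edge agreement and validity of `Exp m`. -/
theorem exp_safe (ht : 3 * t < n)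
    (hleaf : ∀ m, leaf m = 2 ^ m - 1 ∨ leaf m = 2 ^ (m + 1) - 1) {q : ℕ} :
    ∀ d m, q = m + 1 + d → j ≤ m → ∀ L U,
      E.ExpInputs m (fun v => 2 ^ m - 1 ≤ v) → E.ExpInputs m (fun v => v ≤ 2 ^ q - 1) →
      E.ExpInputs m (fun v => L ≤ v ∧ v ≤ U) →
      ∃ y₀, ∀ k, ∀ i ∈ E.honest, ∀ y, ((E.state k i).exp m).out = some y →
        (y = y₀ ∨ y = y₀ + 1) ∧ L ≤ y ∧ y ≤ U := by
  intro d
  induction d with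
  | zero =>
    intro m hq hj L U h1 h2 h3
    have R := E.gcRun (.exp m)
    -- For `q = m + 1` nobody votes `RIGHT`, so neither grade 0 nor `CENTER` from an honest party
    -- can occur, and all outputs come from `TC m`.
    have nright : ∀ k, ∀ i ∈ E.honest, ∀ u, ((E.state k i).exp m).inp = some u →
        ¬ 2 ^ (m + 1) ≤ u := by
      intro k i hi u hu hle
      have := h2 k i hi u hu
      have := Nat.pow_pos (n := m + 1) (show 0 < 2 by decide)
      rw [show q = m + 1 by omega] at *
      omega
    obtain ⟨y₀, hy₀⟩ := tc_safe (E := E) ht (hleaf m) (L := L) (U := U) (by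
      intro k i hi w hw hs
      obtain ⟨a, b, c, -⟩ := next_bounds ht h3 hi hw
      have hpow := Nat.pow_le_pow_right (show 0 < 2 by decide) (Nat.le_succ m)
      exact ⟨(c hs).2 _ (by omega) h1, (c hs).1, a, b⟩)
    refine ⟨y₀, fun k i hi y hy => ?_⟩
    rcases (E.good k hi).exp_out m y hy with ⟨-, h⟩ | ⟨-, h⟩ | ⟨-, h⟩ | ⟨h, -⟩
    · obtain ⟨k', i', hi', u, hu, hle⟩ := exists_right ht hi h (.inr (by omega))
      exact absurd hle (nright k' i' hi' u hu)
    · obtain ⟨p, hp, k', hs⟩ := E.exp_sent_of_heard hi h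
      obtain ⟨k', i', hi', u, hu, hle⟩ :=
        exists_right ht hp ((E.good k' hp).exp_sent_center m hs) (.inr (by omega))
      exact absurd hle (nright k' i' hi' u hu)
    · exact hy₀ k i hi y h
    · have := lt_of_side ht h2 hi h
      omega
  | succ d ih =>
    intro m hq hj L U h1 h2 h3
    have hpow := Nat.pow_le_pow_right (show 0 < 2 by decide) (Nat.le_succ m)
    have hpow' := Nat.pow_le_pow_right (show 0 < 2 by decide) (by omega : m + 1 ≤ q)
    -- the subprotocols, for any bounds on the values from which they are started
    have sub : ∀ L U, (∀ k, ∀ i ∈ E.honest, ∀ w, ((E.state k i).exp m).next = some w →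
        L ≤ w ∧ w ≤ U) → ∃ y₀, ∀ k, ∀ i ∈ E.honest, ∀ y,
          (((E.state k i).exp m).side = some false ∧ ((E.state k i).tc m m).out = some y) ∨
            (((E.state k i).exp m).side = some true ∧
              ((E.state k i).exp (m + 1)).out = some y) →
          (y = y₀ ∨ y = y₀ + 1) ∧ L ≤ y ∧ y ≤ U := by
      intro L U hLU
      obtain ⟨y₀, hy₀⟩ := tc_safe (E := E) ht (hleaf m) (L := L) (U := U) (by
        intro k i hi w hw hs
        obtain ⟨-, -, c, -⟩ := next_bounds ht h3 hi hw
        exact ⟨(c hs).2 _ (by omega) h1, (c hs).1, hLU k i hi w hw⟩)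
      have src : ∀ {k i w}, i ∈ E.honest → ((E.state k i).exp (m + 1)).inp = some w →
          ((E.state k i).exp m).next = some w ∧ ((E.state k i).exp m).side = some true :=
        fun {k i w} hi h => ((E.good k hi).exp_inp _ w h).2.2 m rfl hj
      obtain ⟨y₁, hy₁⟩ := ih (m + 1) (by omega) (by omega) L U
        (by
          intro k i hi w hw
          obtain ⟨hn, hs⟩ := src hi hw
          exact (next_bounds ht h3 hi hn).2.2.2 hs)
        (by
          intro k i hi w hw
          obtain ⟨hn, hs⟩ := src hi hw
          -- Validity with the bounds `0` and `2 ^ q - 1` hands the upper bound on to `Exp (m + 1)`.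
          refine (next_bounds (U := 2 ^ q - 1) ht (L := 0) (fun k i hi v hv => ?_) hi hn).2.1
          exact ⟨Nat.zero_le _, h2 k i hi v hv⟩)
        (fun k i hi w hw => hLU k i hi w (src hi hw).1)
      -- As `side` is common, only one of the two subprotocols yields outputs, and its `y₀` is
      -- taken.
      by_cases hs : ∃ k, ∃ i ∈ E.honest, ((E.state k i).exp m).side = some true
      · obtain ⟨k', i', hi', hs'⟩ := hs
        refine ⟨y₁, fun k i hi y h => ?_⟩
        rcases h with ⟨hs, h⟩ | ⟨hs, h⟩
        · exact absurd (side_agree ht hi hi' hs hs') (by simp)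
        · exact hy₁ k i hi y h
      · refine ⟨y₀, fun k i hi y h => ?_⟩
        rcases h with ⟨-, h⟩ | ⟨h, -⟩
        · exact hy₀ k i hi y h
        · exact absurd ⟨k, i, hi, h⟩ hs
    by_cases hz : ∃ k, ∃ i ∈ E.honest, ((E.state k i).gc (.exp m)).out = some (none, 0)
    · obtain ⟨k₀, i₀, hi₀, h₀⟩ := hz
      have hnext := next_of_grade_zero ht hi₀ h₀
      obtain ⟨ka, ia, hia, a, ha, ha'⟩ := exists_left ht hi₀ h₀ (.inr (by omega))
      obtain ⟨kb, ib, hib, b, hb, hb'⟩ := exists_right ht hi₀ h₀ (.inr (by omega))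
      have hac := h3 ka ia hia a ha
      have hbc := h3 kb ib hib b hb
      -- All start from the center, so validity with both bounds equal to it leaves no other output.
      -- This is why the induction is over all `L` and `U`.
      obtain ⟨y₀, hy₀⟩ := sub (2 ^ (m + 1) - 1) (2 ^ (m + 1) - 1) fun k i hi w hw => by
        rw [hnext k i hi w hw]
        exact ⟨le_rfl, le_rfl⟩
      refine ⟨2 ^ (m + 1) - 1, fun k i hi y hy => ?_⟩
      have hyc : y = 2 ^ (m + 1) - 1 := by
        rcases (E.good k hi).exp_out m y hy with ⟨h, -⟩ | ⟨h, -⟩ | h | h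
        · exact h
        · exact h
        · have := (hy₀ k i hi y (.inl h)).2
          omega
        · have := (hy₀ k i hi y (.inr h)).2
          omega
      refine ⟨.inl hyc, ?_⟩
      have := h3 ka ia hia a ha
      omega
    · obtain ⟨y₀, hy₀⟩ := sub L U fun k i hi w hw =>
        let h := next_bounds ht h3 hi hw
        ⟨h.1, h.2.1⟩
      refine ⟨y₀, fun k i hi y hy => ?_⟩
      rcases (E.good k hi).exp_out m y hy with ⟨-, h⟩ | ⟨-, h⟩ | h | h
      · exact absurd ⟨k, i, hi, h⟩ hz
      · obtain ⟨p, hp, k', hs⟩ := E.exp_sent_of_heard hi h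
        exact absurd ⟨k', p, hp, (E.good k' hp).exp_sent_center m hs⟩ hz
      · exact hy₀ k i hi y (.inl h)
      · exact hy₀ k i hi y (.inr h)

/-! ### Rounds of `Exp` -/

variable {W : ℕ → ℕ → Prop}

/-- Six rounds after all honest parties have begun to run `Exp m`, they all have a value
`v_next`. -/
theorem Rounds.next_live (h : E.Rounds W) (ht : 3 * t < n) {r : ℕ}
    (hin : ∀ i ∈ E.honest, ∃ k, W r k ∧ ((E.state k i).exp m).inp ≠ none) :
    ∀ i ∈ E.honest, ∃ k, W (r + 6) k ∧ Quiescent t leaf (E.state k i) ∧ ∃ u o w,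
      ((E.state k i).exp m).inp = some u ∧ ((E.state k i).gc (.exp m)).out = some o ∧
      ((E.state k i).exp m).next = some w ∧ (E.state k i).NextOf m u w o := by
  have h1 : ∀ i ∈ E.honest, ∃ k, W r k ∧ ((E.state k i).gc (.exp m)).inp ≠ none := by
    intro i hi
    obtain ⟨k, hk, hne⟩ := hin i hi
    obtain ⟨x, hx⟩ := Option.ne_none_iff_exists'.1 hne
    obtain ⟨k', hkk, hk', hq⟩ := h.quiet r k hk i hi
    exact ⟨k', hk', fun hc => hq _ (.exp _ _ m (.inputGC _ x ((E.le hkk hi).exp_inp _ _ hx) hc))⟩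
  have h2 := (E.gcRun (.exp m)).out_live ht (h.gc _) h1
  intro i hi
  obtain ⟨k, hk, hne⟩ := hin i hi
  obtain ⟨x, hx⟩ := Option.ne_none_iff_exists'.1 hne
  obtain ⟨k₁, hk₁, o, ho⟩ := h2 i hi
  obtain ⟨k', hkk, hkk₁, hk', hq⟩ := h.settle (h.mono (by omega : r ≤ r + 6) hk) hk₁ hi
  have hx' := (E.le hkk hi).exp_inp _ _ hx
  have ho' := ((E.le hkk₁ hi).gc _).out ho
  have hnext : ((E.state k' i).exp m).next ≠ none := by
    intro hc
    rcases (E.gcRun (.exp m)).out_shape ht hi ho' with rfl | ⟨c, rfl | rfl⟩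
    · exact hq _ (.exp _ _ m (.grade0 _ x hx' ho' hc))
    · exact hq _ (.exp _ _ m (.grade1 _ x c hx' ho' hc))
    · cases c with
      | false => exact hq _ (.exp _ _ m (.left2 _ x hx' ho' hc))
      | true => exact hq _ (.exp _ _ m (.right2 _ x hx' ho' hc))
  obtain ⟨w, hw⟩ := Option.ne_none_iff_exists'.1 hnext
  obtain ⟨u, o', hu, ho'', hn⟩ := (E.good k' hi).exp_next m w hw
  exact ⟨k', hk', hq, u, o', w, hu, ho'', hw, hn⟩

/-- If all honest parties obtain `side = LEFT` within `r` rounds, then they output within `6 * m`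
further rounds. -/
theorem Rounds.left_live (h : E.Rounds W) (ht : 3 * t < n) {r : ℕ}
    (hin : ∀ i ∈ E.honest, ∃ k, W r k ∧ ((E.state k i).exp m).side = some false ∧
      (((E.state k i).exp m).out ≠ none ∨
        ∃ x g, ((E.state k i).gc (.exp m)).out = some (x, g) ∧ 1 ≤ g)) :
    ∀ i ∈ E.honest, ∃ k, W (r + 6 * m) k ∧ ((E.state k i).exp m).out ≠ none := by
  have h1 : ∀ i ∈ E.honest, ∃ k, W r k ∧ ((E.state k i).tc m m).inp ≠ none := by
    intro i hi
    obtain ⟨k, hk, hs, -⟩ := hin i hi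
    obtain ⟨k', hkk, hk', hq⟩ := h.quiet r k hk i hi
    have hs' := (E.le hkk hi).exp_side _ _ hs
    obtain ⟨w, hw⟩ := Option.ne_none_iff_exists'.1 ((E.good k' hi).exp_side m _ hs').1
    exact ⟨k', hk', fun hc => hq _ (.exp _ _ m (.runTC _ w hw hs' hc))⟩
  intro i hi
  obtain ⟨k₁, hk₁, hne⟩ := h.tc_live ht h1 i hi
  obtain ⟨y, hy⟩ := Option.ne_none_iff_exists'.1 hne
  obtain ⟨k, hk, hs, ho⟩ := hin i hi
  obtain ⟨k', hkk, hkk₁, hk', hq⟩ := h.settle (h.mono (by omega : r ≤ r + 6 * m) hk) hk₁ hi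
  refine ⟨k', hk', ?_⟩
  rcases ho with ho | ⟨x, g, ho, hg⟩
  · exact Option.persist ((E.le hkk hi).exp_out _) ho
  · exact fun hc => hq _ (.exp _ _ m (.outLeft _ x g y ((E.le hkk hi).exp_side _ _ hs)
      (((E.le hkk hi).gc _).out ho) hg ((E.le hkk₁ hi).tc_out _ _ _ hy) hc))

/-- If all honest parties obtain `side = RIGHT` within `r` rounds, and `Exp (m + 1)` takes `R`
rounds, then they output within `R` further rounds. -/
theorem Rounds.right_live (h : E.Rounds W) {r R : ℕ}
    (hR : (∀ i ∈ E.honest, ∃ k, W r k ∧ ((E.state k i).exp (m + 1)).inp ≠ none) →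
      ∀ i ∈ E.honest, ∃ k, W (r + R) k ∧ ((E.state k i).exp (m + 1)).out ≠ none)
    (hin : ∀ i ∈ E.honest, ∃ k, W r k ∧ ((E.state k i).exp m).side = some true ∧
      (((E.state k i).exp m).out ≠ none ∨
        ∃ x g, ((E.state k i).gc (.exp m)).out = some (x, g) ∧ 1 ≤ g)) :
    ∀ i ∈ E.honest, ∃ k, W (r + R) k ∧ ((E.state k i).exp m).out ≠ none := by
  have h1 : ∀ i ∈ E.honest, ∃ k, W r k ∧ ((E.state k i).exp (m + 1)).inp ≠ none := by
    intro i hi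
    obtain ⟨k, hk, hs, -⟩ := hin i hi
    obtain ⟨k', hkk, hk', hq⟩ := h.quiet r k hk i hi
    have hs' := (E.le hkk hi).exp_side _ _ hs
    obtain ⟨w, hw⟩ := Option.ne_none_iff_exists'.1 ((E.good k' hi).exp_side m _ hs').1
    exact ⟨k', hk', fun hc => hq _ (.exp _ _ m (.runExp _ w hw hs' hc))⟩
  intro i hi
  obtain ⟨k₁, hk₁, hne⟩ := hR h1 i hi
  obtain ⟨y, hy⟩ := Option.ne_none_iff_exists'.1 hne
  obtain ⟨k, hk, hs, ho⟩ := hin i hi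
  obtain ⟨k', hkk, hkk₁, hk', hq⟩ := h.settle (h.mono (by omega : r ≤ r + R) hk) hk₁ hi
  refine ⟨k', hk', ?_⟩
  rcases ho with ho | ⟨x, g, ho, hg⟩
  · exact Option.persist ((E.le hkk hi).exp_out _) ho
  · exact fun hc => hq _ (.exp _ _ m (.outRight _ x g y ((E.le hkk hi).exp_side _ _ hs)
      (((E.le hkk hi).gc _).out ho) hg ((E.le hkk₁ hi).exp_out _ _ hy) hc))

/-- If all honest inputs are to the left, then `Exp m` takes `6 * (m + 1)` rounds. -/
theorem Rounds.exp_live_of_left (h : E.Rounds W) (ht : 3 * t < n)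
    (hP : E.ExpInputs m (fun v => v < 2 ^ (m + 1))) {r : ℕ}
    (hin : ∀ i ∈ E.honest, ∃ k, W r k ∧ ((E.state k i).exp m).inp ≠ none) :
    ∀ i ∈ E.honest, ∃ k, W (r + 6 * (m + 1)) k ∧ ((E.state k i).exp m).out ≠ none := by
  have key := h.left_live (m := m) ht (r := r + 6) (fun i hi => by
    obtain ⟨k, hk, -, u, o, w, hu, ho, hw, hn⟩ := h.next_live ht hin i hi
    -- All vote `LEFT`, so all obtain `(LEFT, 2)` after 6 rounds, and `TC m` takes `6 * m` more.
    have ho' := (E.gcRun (.exp m)).out_of_unanimous ht (v := false) (fun k i hi b hb => by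
      obtain ⟨u, hu, rfl⟩ := (E.good k hi).gc_exp m b hb
      simp [hP k i hi u hu]) hi ho
    subst ho'
    rcases hn with ⟨-, -, hs⟩ | ⟨e, -⟩ | ⟨b, e, -⟩ | ⟨e, -⟩
    · exact ⟨k, hk, hs, .inr ⟨_, _, ho, by omega⟩⟩
    all_goals simp at e)
  rwa [show r + 6 + 6 * m = r + 6 * (m + 1) by ring] at key

/-- The rounds of `Exp m` if some honest party obtains the grade `0`. -/
theorem Rounds.exp_live_of_grade_zero (h : E.Rounds W) (ht : 3 * t < n) (hj : j ≤ m) {k₀ : ℕ}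
    {i₀ : Fin n} (hi₀ : i₀ ∈ E.honest)
    (h₀ : ((E.state k₀ i₀).gc (.exp m)).out = some (none, 0)) {r : ℕ}
    (hin : ∀ i ∈ E.honest, ∃ k, W r k ∧ ((E.state k i).exp m).inp ≠ none) :
    ∀ i ∈ E.honest, ∃ k, W (r + 7 + 6 * (m + 2)) k ∧ ((E.state k i).exp m).out ≠ none := by
  classical
  have R := E.gcRun (.exp m)
  have hnext := next_of_grade_zero ht hi₀ h₀
  have h1 := h.next_live ht hin
  choose! κ hκ hq u o w hu ho hw hn using h1
  have hcard := card_honest E.card_corrupted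
  have hsplit := Finset.card_filter_add_card_filter_not (s := E.honest) (fun i => o i = (none, 0))
  -- Either `t + 1` honest parties multicast `CENTER`, and one round later all output; or at least
  -- `t + 1` of the `2 * t + 1` or more honest parties have grade 1 and multicast their common `k`,
  -- so that `side` is known to all one round later.
  by_cases hc : t + 1 ≤ (E.honest.filter fun i => o i = (none, 0)).card
  · intro i hi
    obtain ⟨k, hk, hWk, hqk, hr⟩ := (h.exp m).settled (hκ i hi) hi
    refine ⟨k, h.mono (by omega : r + 6 + 1 ≤ _) hWk, fun hnone => ?_⟩
    refine hqk _ (.exp _ _ m (.center _ (u i) ((E.le hk hi).exp_inp _ _ (hu i hi)) hnone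
      (hc.trans (le_heard fun p hp => ?_))))
    obtain ⟨hp, hop⟩ := Finset.mem_filter.1 hp
    rcases hn p hp with ⟨e, -⟩ | ⟨e, -⟩ | ⟨b, e, -⟩ | ⟨-, -, hs, -⟩
    · simp [e] at hop
    · simp [e] at hop
    · simp [e] at hop
    · exact ⟨_, hr p hp (κ p) (hκ p hp) _ hs, rfl⟩
  · have hpos : ∀ p ∈ E.honest, o p ≠ (none, 0) →
        ∃ b, o p = (some b, 1) ∧ .side b ∈ ((E.state (κ p) p).exp m).sent := by
      intro p hp hop
      rcases hn p hp with ⟨e, -⟩ | ⟨e, -⟩ | ⟨b, e, -, -, hs⟩ | ⟨e, -⟩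
      · exact (R.not_zero_two ht hi₀ hp h₀ (e ▸ ho p hp)).elim
      · exact (R.not_zero_two ht hi₀ hp h₀ (e ▸ ho p hp)).elim
      · exact ⟨b, e, hs⟩
      · exact absurd e hop
    obtain ⟨p₀, hp₀⟩ : (E.honest.filter fun i => ¬ o i = (none, 0)).Nonempty :=
      Finset.card_pos.1 (by omega)
    obtain ⟨hp₀, hop₀⟩ := Finset.mem_filter.1 hp₀
    obtain ⟨b, hb, hbs⟩ := hpos p₀ hp₀ hop₀
    have hside : ∀ i ∈ E.honest, ∃ k, W (r + 7) k ∧ ((E.state k i).exp m).side = some b ∧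
        (((E.state k i).exp m).out ≠ none ∨
          ∃ x g, ((E.state k i).gc (.exp m)).out = some (x, g) ∧ 1 ≤ g) := by
      intro i hi
      obtain ⟨k, hk, hWk, hqk, hr⟩ := (h.exp m).settled (hκ i hi) hi
      have hw' := (E.le hk hi).exp_next _ _ (hw i hi)
      have hs : ((E.state k i).exp m).side ≠ none := by
        intro hnone
        refine hqk _ (.exp _ _ m (.learnSide _ (w i) b hw' hnone
          ((by omega : t + 1 ≤ (E.honest.filter fun i => ¬ o i = (none, 0)).card).trans
            (le_heard fun p hp => ?_))))
        obtain ⟨hp, hop⟩ := Finset.mem_filter.1 hp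
        obtain ⟨c, hc, hcs⟩ := hpos p hp hop
        obtain rfl := R.out_agree ht hp hp₀ (hc ▸ ho p hp) (hb ▸ ho p₀ hp₀)
        exact ⟨_, hr p hp (κ p) (hκ p hp) _ hcs, rfl⟩
      obtain ⟨c, hc⟩ := Option.ne_none_iff_exists'.1 hs
      obtain ⟨l, p, hp, g, hg⟩ := exists_out_of_side hi hc
      obtain rfl := R.out_agree ht hp hp₀ hg (hb ▸ ho p₀ hp₀)
      refine ⟨k, hWk, hc, ?_⟩
      by_cases hoi : o i = (none, 0)
      · left
        rcases hn i hi with ⟨e, -⟩ | ⟨e, -⟩ | ⟨b, e, -⟩ | ⟨-, -, -, hout⟩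
        · simp [e] at hoi
        · simp [e] at hoi
        · simp [e] at hoi
        · exact Option.persist ((E.le hk hi).exp_out _) hout
      · obtain ⟨d, hd, -⟩ := hpos i hi hoi
        exact .inr ⟨_, _, ((E.le hk hi).gc _).out (hd ▸ ho i hi), le_rfl⟩
    cases b with
    | false =>
      intro i hi
      obtain ⟨k, hk, hout⟩ := h.left_live ht hside i hi
      exact ⟨k, h.mono (by omega) hk, hout⟩
    | true =>
      -- Every input of `Exp (m + 1)` is now the center `2 ^ (m + 1) - 1 < 2 ^ (m + 2)`, so all vote
      -- `LEFT` there.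
      refine h.right_live (R := 6 * (m + 2)) (fun hin' => ?_) hside
      refine h.exp_live_of_left ht (fun k i hi v hv => ?_) hin'
      obtain ⟨hv', -⟩ := ((E.good k hi).exp_inp _ v hv).2.2 m rfl hj
      rw [hnext k i hi v hv']
      have := Nat.pow_pos (n := m + 1) (show 0 < 2 by decide)
      rw [pow_succ 2 (m + 1)]
      omega

/-- The rounds of `Exp m` in general. -/
theorem Rounds.exp_live (h : E.Rounds W) (ht : 3 * t < n) {q : ℕ} :
    ∀ d m, q = m + 1 + d → j ≤ m → E.ExpInputs m (fun v => v ≤ 2 ^ q - 1) → ∀ {r : ℕ},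
      (∀ i ∈ E.honest, ∃ k, W r k ∧ ((E.state k i).exp m).inp ≠ none) →
      ∀ i ∈ E.honest, ∃ k, W (r + (19 + 6 * m + 12 * d)) k ∧
        ((E.state k i).exp m).out ≠ none := by
  -- `19 + 6 * m = 7 + 6 * (m + 2)` is the bound in the presence of grade 0. Each level without
  -- grade 0 costs 6 rounds and raises `m` by 1, which adds 12 in total. For `d = 0` the bound is
  -- generous.
  intro d
  induction d with
  | zero =>
    intro m hq hj hP r hin i hi
    obtain ⟨k, hk, hout⟩ := h.exp_live_of_left ht (fun k i hi v hv => by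
      have h1 := hP k i hi v hv
      have h2 := Nat.pow_pos (n := q) (show 0 < 2 by decide)
      rw [hq] at h1 h2
      simp only [Nat.add_zero] at h1 h2
      omega) hin i hi
    exact ⟨k, h.mono (by omega) hk, hout⟩
  | succ d ih =>
    intro m hq hj hP r hin
    by_cases hz : ∃ k, ∃ i ∈ E.honest, ((E.state k i).gc (.exp m)).out = some (none, 0)
    · obtain ⟨k₀, i₀, hi₀, h₀⟩ := hz
      intro i hi
      obtain ⟨k, hk, hout⟩ := h.exp_live_of_grade_zero ht hj hi₀ h₀ hin i hi
      exact ⟨k, h.mono (by omega) hk, hout⟩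
    · have h1 := h.next_live ht hin
      have hside : ∀ i ∈ E.honest, ∃ k, W (r + 6) k ∧ ∃ b, ((E.state k i).exp m).side = some b ∧
          (((E.state k i).exp m).out ≠ none ∨
            ∃ x g, ((E.state k i).gc (.exp m)).out = some (x, g) ∧ 1 ≤ g) := by
        intro i hi
        obtain ⟨k, hk, -, u, o, w, hu, ho, hw, hn⟩ := h1 i hi
        rcases hn with ⟨rfl, -, hs⟩ | ⟨rfl, -, hs⟩ | ⟨b, rfl, -, hs, -⟩ | ⟨rfl, -⟩
        · exact ⟨k, hk, _, hs, .inr ⟨_, _, ho, by omega⟩⟩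
        · exact ⟨k, hk, _, hs, .inr ⟨_, _, ho, by omega⟩⟩
        · exact ⟨k, hk, _, hs, .inr ⟨_, _, ho, by omega⟩⟩
        · exact absurd ⟨k, i, hi, ho⟩ hz
      intro i hi
      obtain ⟨k₀, -, b, hb, -⟩ := hside i hi
      have hside' : ∀ i ∈ E.honest, ∃ k, W (r + 6) k ∧ ((E.state k i).exp m).side = some b ∧
          (((E.state k i).exp m).out ≠ none ∨
            ∃ x g, ((E.state k i).gc (.exp m)).out = some (x, g) ∧ 1 ≤ g) := by
        intro i' hi'
        obtain ⟨k, hk, c, hc, h2⟩ := hside i' hi'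
        obtain rfl := side_agree ht hi hi' hb hc
        exact ⟨k, hk, hc, h2⟩
      cases b with
      | false =>
        obtain ⟨k, hk, hout⟩ := h.left_live ht hside' i hi
        exact ⟨k, h.mono (by omega) hk, hout⟩
      | true =>
        obtain ⟨k, hk, hout⟩ := h.right_live (R := 19 + 6 * (m + 1) + 12 * d) (fun hin' => by
          refine ih (m + 1) (by omega) (by omega) (fun k i hi w hw => ?_) hin'
          obtain ⟨hn, -⟩ := ((E.good k hi).exp_inp _ w hw).2.2 m rfl hj
          refine (next_bounds (U := 2 ^ q - 1) ht (L := 0) (fun k i hi v hv => ?_) hi hn).2.1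
          exact ⟨Nat.zero_le _, hP k i hi v hv⟩) hside' i hi
        exact ⟨k, h.mono (by omega) hk, hout⟩

end Execution

/-! ### The main theorem -/

/-- The path from `a` to `a + d` in `ℕ`. -/
theorem exists_path_hasse (d : ℕ) : ∀ a b : ℕ, b = a + d →
    ∃ p : (SimpleGraph.hasse ℕ).Walk a b, p.IsPath ∧ ∀ z, z ∈ p.support ↔ a ≤ z ∧ z ≤ b := by
  induction d with
  | zero =>
    rintro a b rfl
    exact ⟨.nil, .nil, fun z => by simp; omega⟩
  | succ d ih =>
    intro a b hb
    obtain ⟨p, hp, hs⟩ := ih (a + 1) b (by omega)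
    have hadj : (SimpleGraph.hasse ℕ).Adj a (a + 1) := by simp [SimpleGraph.hasse_adj]
    refine ⟨.cons hadj p, ?_, fun z => ?_⟩
    · rw [SimpleGraph.Walk.cons_isPath_iff, hs]
      exact ⟨hp, by omega⟩
    · rw [SimpleGraph.Walk.support_cons, List.mem_cons, hs]
      omega

namespace Execution

variable {n t j : ℕ} {leaf : ℕ → ℕ} {E : Execution n t j leaf}

theorem expInputs {P : ℕ → Prop} (h : ∀ i ∈ E.honest, P (E.input i)) : E.ExpInputs j P := by
  intro k i hi v hv
  rw [((E.good k hi).exp_inp j v hv).2.1 rfl]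
  exact h i hi

/-- With a trivial `W`, any bound on rounds says only that the event happens eventually. -/
theorem rounds_of_eventualDelivery (h : E.EventualDelivery) : E.Rounds fun _ _ => True where
  succ _ _ _ := trivial
  quiet _ k _ i hi :=
    let ⟨k', h1, _, h3⟩ := E.instant k i hi
    ⟨k', h1, trivial, h3⟩
  deliver _ k _ p hp i hi msg hm :=
    let ⟨k', h'⟩ := h p hp i hi k msg hm
    ⟨k', trivial, h'⟩

/-- The sign of `Δ` matters only for `succ`: a later round must not have an earlier deadline. -/
theorem rounds_of_delayAtMost {Δ : ℝ} (hΔ : 0 ≤ Δ) (h : E.DelayAtMost Δ) (τ : ℝ) :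
    E.Rounds fun r k => E.time k ≤ τ + r * Δ where
  succ r k hk := by push_cast; linarith
  quiet r k hk i hi :=
    let ⟨k', h1, h2, h3⟩ := E.instant k i hi
    ⟨k', h1, h2.trans_le hk, h3⟩
  deliver r k hk p hp i hi msg hm :=
    let ⟨k', h1, h2⟩ := h p hp i hi k msg hm
    ⟨k', by push_cast; linarith, h2⟩

/-- A bound on the delays is nonnegative if some honest party acquires its input. -/
theorem delay_nonneg {Δ : ℝ} (h : E.DelayAtMost Δ) {i : Fin n} (hi : i ∈ E.honest) {k : ℕ}
    (hk : E.HasInput k i) : 0 ≤ Δ := by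
  classical
  obtain ⟨k₁, hk₁, -, hq⟩ := E.instant k i hi
  have hinp : ((E.state k₁ i).gc (.exp j)).inp ≠ none := fun hc =>
    hq _ (.exp _ _ j (.inputGC _ _ ((E.le hk₁ hi).exp_inp _ _ hk) hc))
  obtain ⟨v, hv⟩ := Option.ne_none_iff_exists'.1 hinp
  have hs : ∃ k, .echo₁ (some v) ∈ ((E.state k i).gc (.exp j)).sent :=
    ⟨k₁, by_contra fun hc => hq _ (.gc _ (.exp j) _ (.echoInput _ v hv hc))⟩
  -- The echo that the party sends to itself, taken at the first point at which it is sent, cannot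
  -- be received before that point; a negative delay would require it.
  obtain ⟨k', hk', hr⟩ := h i hi i hi (Nat.find hs) (.gc (.exp j) (.echo₁ (some v)))
    (Nat.find_spec hs)
  obtain ⟨k'', hlt, hs''⟩ := (E.gcRun (.exp j)).sent_of_recv hi hi hr
  have := E.time_mono ((Nat.find_min' hs hs'').trans hlt.le)
  linarith

theorem edgeAgreement_convexValidity {q : ℕ} (ht : 3 * t < n) (hj : j < q)
    (hleaf : ∀ m, leaf m = 2 ^ m - 1 ∨ leaf m = 2 ^ (m + 1) - 1)
    (hinput : ∀ i ∈ E.honest, 2 ^ j - 1 ≤ E.input i ∧ E.input i ≤ 2 ^ q - 1) :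
    E.EdgeAgreement (SimpleGraph.hasse ℕ) ∧ E.ConvexValidity (SimpleGraph.hasse ℕ) := by
  have hne : E.honest.Nonempty := Finset.card_pos.1 (by
    have := card_honest E.card_corrupted
    omega)
  obtain ⟨i₁, hi₁, h₁⟩ := E.honest.exists_min_image E.input hne
  obtain ⟨i₂, hi₂, h₂⟩ := E.honest.exists_max_image E.input hne
  obtain ⟨y₀, hy₀⟩ := exp_safe (E := E) ht hleaf (q - (j + 1)) j (by omega) le_rfl
    (E.input i₁) (E.input i₂) (expInputs fun i hi => (hinput i hi).1)
    (expInputs fun i hi => (hinput i hi).2) (expInputs fun i hi => ⟨h₁ i hi, h₂ i hi⟩)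
  refine ⟨fun i hi i' hi' k k' y y' hy hy' => ?_, fun i hi k y hy => ?_⟩
  · rcases (hy₀ k i hi y hy).1 with rfl | rfl <;>
      rcases (hy₀ k' i' hi' y' hy').1 with rfl | rfl <;> simp [SimpleGraph.hasse_adj]
  · obtain ⟨-, hL, hU⟩ := hy₀ k i hi y hy
    obtain ⟨p, hp, hs⟩ := exists_path_hasse (E.input i₂ - E.input i₁) (E.input i₁) (E.input i₂)
      (by omega)
    exact ⟨i₁, hi₁, i₂, hi₂, p, hp, (hs y).2 ⟨hL, hU⟩⟩

theorem Rounds.hasOutput {W : ℕ → ℕ → Prop} (h : E.Rounds W) {q : ℕ} (ht : 3 * t < n)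
    (hj : j < q) (hinput : ∀ i ∈ E.honest, E.input i ≤ 2 ^ q - 1)
    (hin : ∀ i ∈ E.honest, ∃ k, W 0 k ∧ E.HasInput k i) :
    ∀ i ∈ E.honest, ∃ k y,
      W (if q = j + 1 then 6 * q else 19 + 6 * j + 12 * (q - (j + 1))) k ∧
        E.HasOutput k i y := by
  have hin' : ∀ i ∈ E.honest, ∃ k, W 0 k ∧ ((E.state k i).exp j).inp ≠ none := fun i hi =>
    let ⟨k, hk, h⟩ := hin i hi
    ⟨k, hk, Option.ne_none_iff_exists'.2 ⟨_, h⟩⟩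
  intro i hi
  suffices ∃ k, W (if q = j + 1 then 6 * q else 19 + 6 * j + 12 * (q - (j + 1))) k ∧
      ((E.state k i).exp j).out ≠ none by
    obtain ⟨k, hk, hne⟩ := this
    obtain ⟨y, hy⟩ := Option.ne_none_iff_exists'.1 hne
    exact ⟨k, y, hk, hy⟩
  split_ifs with hq
  · have := h.exp_live_of_left ht (expInputs fun i hi => by
      have h1 := hinput i hi
      have h2 := Nat.pow_pos (n := q) (show 0 < 2 by decide)
      rw [← hq]
      omega) hin' i hi
    rwa [Nat.zero_add, ← hq] at this
  · have := h.exp_live ht (q - (j + 1)) j (by omega) le_rfl (expInputs hinput) hin' i hi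
    rwa [Nat.zero_add] at this

end Execution

theorem mainTheorem2 (n t q j : ℕ) (ht : 3 * t < n) (hq : 1 ≤ q) (hj : j < q)
    (leaf : ℕ → ℕ) (hleaf : ∀ m, leaf m = 2 ^ m - 1 ∨ leaf m = 2 ^ (m + 1) - 1)
    (E : Execution n t j leaf)
    (hinput : ∀ i ∈ E.honest, 2 ^ j - 1 ≤ E.input i ∧ E.input i ≤ 2 ^ q - 1) :
    E.EdgeAgreement (SimpleGraph.hasse ℕ) ∧
    E.ConvexValidity (SimpleGraph.hasse ℕ) ∧
    E.AtMostRounds (if q = j + 1 then 6 * (q : ℝ) else 7 + 12 * (q : ℝ) - 6 * (j : ℝ)) := by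
  have hinput' : ∀ i ∈ E.honest, E.input i ≤ 2 ^ q - 1 := fun i hi => (hinput i hi).2
  obtain ⟨hagree, hvalid⟩ := Execution.edgeAgreement_convexValidity ht hj hleaf hinput
  refine ⟨hagree, hvalid, fun hdel hin i hi => ?_, fun Δ τ hdel hin i hi => ?_⟩
  · obtain ⟨k, y, -, hy⟩ := (Execution.rounds_of_eventualDelivery hdel).hasOutput ht hj hinput'
      (fun i hi => (hin i hi).imp fun k h => ⟨trivial, h⟩) i hi
    exact ⟨k, y, hy⟩
  · obtain ⟨k₀, -, hk₀⟩ := hin i hi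
    have hΔ := Execution.delay_nonneg hdel hi hk₀
    obtain ⟨k, y, hk, hy⟩ := (Execution.rounds_of_delayAtMost hΔ hdel τ).hasOutput ht hj hinput'
      (fun i hi => (hin i hi).imp fun k h => ⟨by simpa using h.1, h.2⟩) i hi
    refine ⟨k, y, hk.trans_eq ?_, hy⟩
    congr 2
    split_ifs
    · push_cast
      ring
    -- `19 + 6 * j + 12 * (q - (j + 1)) = 7 + 12 * q - 6 * j`, where the subtraction of naturals is
    -- exact because `j < q`.
    · push_cast [Nat.cast_sub (show j + 1 ≤ q from hj)]
      ring
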